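/- Let $m\ge 1$, let $P$ be an $m$-user multiple access channel (MAC) with binary inputs, given by the conditional law $P(\cdot\mid \bar x)$ of its output, $\bar x\in\mathbb F_2^m$, on an arbitrary (measurable) output alphabet $\mathcal Y$, and let $\beta<1/2$. Put $E_m=\{1,\dots,m\}$. **Uniform mutual informations.** For a MAC $W$ with inputs in $\mathbb F_2^m$, let $X[1],\dots,X[m]$ be independent uniform bits, $Y$ the corresponding output, and, for $J\subseteq E_m$, $I[J](W)=I(X[J];\,Y\,X[J^c])$, in bits. The uniform sum rate of $W$ is $I[E_m](W)=I(X[E_m];Y)$. **Synthetic channels.** Let $n=2^l$, $l\ge 0$, and $G_n=\begin{bmatrix}1&0\\1&1\end{bmatrix}^{\otimes l}$. Let $U_i[k]$ ($1\le i\le n$, $k\in E_m$) be independent uniform bits, let $X[k]^n=U[k]^nG_n$ over $\mathbb F_2$ for each user $k$, and let $Y^n$ be the output of $n$ independent uses of $P$ with inputs $X_1[E_m],\dots,X_n[E_m]$. Let $P_{(i)}$ be the MAC with input $U_i[E_m]$ and output $(Y^n,U^{i-1}[E_m])$, where $U^{i-1}[E_m]=(U_1[E_m],\dots,U_{i-1}[E_m])$.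 **Polar codes.** Let $0<\varepsilon<1/2$ and $0<\gamma<1$. Call $P_{(i)}$ *polarized* if each $I[J](P_{(i)})$, $J\subseteq E_m$, is at distance less than $\varepsilon$ from $\mathbb Z$ and if, $r_i$ being the integer at distance less than $\varepsilon$ from $I[E_m](P_{(i)})$, there is $A_i\in\mathbb F_2^{r_i\times m}$ with $$I\bigl(A_iU_i[E_m];\,Y^n\,U^{i-1}[E_m]\bigr)>r_i-\gamma .$$ A *polar code* of block length $n$ for $P$ with thresholds $(\varepsilon,\gamma)$ is given by the following data. For each polarized $P_{(i)}$, one chooses such a matrix $A_i$, a set $B_i\subseteq E_m$ of $r_i$ users for which the columns of $A_i$ indexed by $B_i$ are linearly independent, and a measurable rule that estimates $A_iU_i[E_m]$ from $(Y^n,U^{i-1}[E_m])$. If $P_{(i)}$ is not polarized, $B_i=\emptyset$. Let $\mathcal G[k]=\{i: k\in B_i\}$. * *Encoding.* User $k$ transmits $X[k]^n=U[k]^nG_n$, where the $U_i[k]$ with $i\in\mathcal G[k]$ are its data bits, and the others are frozen bits, chosen independently and uniformly at random and known to the decoder. The data bits are uniform and independent as well. * *Successive-decision decoding.* For $i=1,\dots,n$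 in this order, the decoder estimates $A_iU_i[E_m]$ by applying the chosen rule to $Y^n$ and its own earlier decisions $\tilde U^{i-1}[E_m]$. It sets $\tilde U_i[k]=U_i[k]$ for the frozen bits $k\notin B_i$, and it obtains $\tilde U_i[B_i]$ by solving the linear system that equates $A_i\tilde U_i[E_m]$ to the estimate. (If $B_i=\emptyset$, it only copies the frozen bits.) The block error probability of the code is $P_e=\mathbb P(\tilde U^n[E_m]\ne U^n[E_m])$, and its sum rate is $\frac1n\sum_{k=1}^m|\mathcal G[k]|$. **Theorem.** There are an integer $n_0$, thresholds $\varepsilon_n\in(0,1/2)$ and $\gamma_n\in(0,1)$ that tend to $0$, and, for every $n=2^l$ with $l\ge0$, a polar code of block length $n$ for $P$ with thresholds $(\varepsilon_n,\gamma_n)$, whose block error probability $P_e(n)$ and sum rate $\text{Sum-Rate}(n)$ satisfy $$P_e(n)\le 2^{-n^{\beta}}\quad\text{for all } n=2^l\ge n_0,\qquad\text{and}\qquad \liminf_{l\to\infty}\ \text{Sum-Rate}(2^l)\ \ge\ I[E_m](P).$$ -/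

import Mathlib

open MeasureTheory ProbabilityTheory Filter
open scoped Matrix

noncomputable section

namespace PolarMAC

/-! ### Multiple access channels and their uniform mutual informations -/

/-- The input alphabet `𝔽₂ᵐ` of an `m`-user binary-input multiple access channel: one bit per user. -/
abbrev Input (m : ℕ) : Type := Fin m → ZMod 2

/-- The mutual information, in bits, of a pair of random variables with joint law `μ`: the
Kullback-Leibler divergence of `μ` from the product of its marginals. -/
def mutualInfo {α β : Type*} [MeasurableSpace α] [MeasurableSpace β] (μ : Measure (α × β)) : ℝ :=
  (InformationTheory.klDiv μ (μ.fst.prod μ.snd)).toReal / Real.log 2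

/-- The joint law of the input `X[1], …, X[m]` (independent uniform bits) and the output of the
multiple access channel `W`. -/
def jointLaw {m : ℕ} {𝓩 : Type*} [MeasurableSpace 𝓩] (W : Kernel (Input m) 𝓩) :
    Measure (Input m × 𝓩) :=
  uniformOn (Set.univ : Set (Input m)) ⊗ₘ W

/-- `I[J](W) = I(X[J] ; Y X[Jᶜ])`, where `Y` is the output of `W` under uniform inputs. -/
def info {m : ℕ} {𝓩 : Type*} [MeasurableSpace 𝓩] (W : Kernel (Input m) 𝓩) (J : Finset (Fin m)) :
    ℝ :=
  mutualInfo ((jointLaw W).map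
    (fun p : Input m × 𝓩 => (J.restrict p.1, (p.2, (Jᶜ : Finset (Fin m)).restrict p.1))))

/-- `I(A X[E_m] ; Y)`: the information that the output of `W` gives on the linear forms `A X[E_m]`
of its uniform inputs. -/
def linearInfo {m r : ℕ} {𝓩 : Type*} [MeasurableSpace 𝓩] (W : Kernel (Input m) 𝓩)
    (A : Matrix (Fin r) (Fin m) (ZMod 2)) : ℝ :=
  mutualInfo ((jointLaw W).map (fun p : Input m × 𝓩 => (A *ᵥ p.1, p.2)))

/-- The uniform sum rate `I[E_m](W)`. -/
def uniformSumRate {m : ℕ} {𝓩 : Type*} [MeasurableSpace 𝓩] (W : Kernel (Input m) 𝓩) : ℝ :=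
  info W Finset.univ

/-! ### The polar transform and the synthetic channels -/

/-- The `l`-th Kronecker power of the matrix with rows `(1, 0)` and `(1, 1)`. -/
def polarMatrix : (l : ℕ) → Matrix (Fin (2 ^ l)) (Fin (2 ^ l)) (ZMod 2)
  | 0 => 1
  | l + 1 =>
    Matrix.reindex (finProdFinEquiv.trans (finCongr (pow_succ 2 l).symm))
      (finProdFinEquiv.trans (finCongr (pow_succ 2 l).symm))
      (Matrix.kronecker (polarMatrix l) !![1, 0; 1, 1])

/-- The polar transform applied to each user separately: `X[k]ⁿ = U[k]ⁿ Gₙ` for every user `k`.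
Here `u i k` is the bit `U_i[k]`, and `polarTransform l u j k` is the bit `X_j[k]`. -/
def polarTransform {m : ℕ} (l : ℕ) (u : Fin (2 ^ l) → Input m) : Fin (2 ^ l) → Input m :=
  fun j k => ((fun i => u i k) ᵥ* polarMatrix l) j

variable {m : ℕ} {𝓨 : Type*} [MeasurableSpace 𝓨]

/-- The law of the output `Yⁿ` of `n = 2 ^ l` independent uses of `P`, given `Uⁿ[E_m]`. -/
def blockChannel (P : Kernel (Input m) 𝓨) (l : ℕ) :
    Kernel (Fin (2 ^ l) → Input m) (Fin (2 ^ l) → 𝓨) :=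
  Kernel.ofFunOfCountable fun u => Measure.pi fun j => P (polarTransform l u j)

instance blockChannel_isMarkovKernel (P : Kernel (Input m) 𝓨) [IsMarkovKernel P] (l : ℕ) :
    IsMarkovKernel (blockChannel P l) :=
  ⟨fun u => by
    change IsProbabilityMeasure (Measure.pi fun j => P (polarTransform l u j))
    infer_instance⟩

/-- The channel `P_(i)`, with input `U_i[E_m]` and output `(Yⁿ, U^{i-1}[E_m])`: conditionally on
`U_i[E_m] = x`, all the other bits are independent and uniform. (Indices start from `0`, so that
`U^{i-1}` is the family of the `U_j` with `j < i`.) -/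
def synthChannel (P : Kernel (Input m) 𝓨) (l : ℕ) (i : Fin (2 ^ l)) :
    Kernel (Input m) ((Fin (2 ^ l) → 𝓨) × (Fin (i : ℕ) → Input m)) :=
  Kernel.ofFunOfCountable fun x =>
    (uniformOn {u : Fin (2 ^ l) → Input m | u i = x} ⊗ₘ blockChannel P l).map
      fun p => (p.2, fun j : Fin (i : ℕ) => p.1 (j.castLE i.isLt.le))

instance synthChannel_isMarkovKernel (P : Kernel (Input m) 𝓨) [IsMarkovKernel P] (l : ℕ)
    (i : Fin (2 ^ l)) :
    IsMarkovKernel (synthChannel P l i) :=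
  ⟨fun x => by
    have : IsProbabilityMeasure (uniformOn {u : Fin (2 ^ l) → Input m | u i = x}) :=
      isProbabilityMeasure_uniformOn (Set.toFinite _) ⟨fun _ => x, rfl⟩
    refine Measure.isProbabilityMeasure_map (Measurable.aemeasurable ?_)
    fun_prop⟩

/-! ### Polar codes -/

/-- The data of a polar code of block length `n = 2 ^ l` for an `m`-user binary-input multiple
access channel with output alphabet `𝓨`. -/
structure PolarCode (m l : ℕ) (𝓨 : Type*) [MeasurableSpace 𝓨] where
  /-- `r i` is the number of data bits sent on the `i`-th synthetic channel -/
  r : Fin (2 ^ l) → ℕ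
  /-- the linear forms `A_i` of `U_i[E_m]` that are decoded at stage `i` -/
  A : (i : Fin (2 ^ l)) → Matrix (Fin (r i)) (Fin m) (ZMod 2)
  /-- a selection of `r i` distinct columns of `A_i`; its range is the set `B_i` of the users that
  send data on the `i`-th synthetic channel -/
  sel : (i : Fin (2 ^ l)) → Fin (r i) ↪ Fin m
  /-- the selected columns are linearly independent -/
  linearIndependent : ∀ i, LinearIndependent (ZMod 2) fun j : Fin (r i) => (A i).col (sel i j)
  /-- the rule by which the decoder estimates `A_i U_i[E_m]` from `(Yⁿ, U^{i-1}[E_m])` -/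
  est : (i : Fin (2 ^ l)) →
    (Fin (2 ^ l) → 𝓨) × (Fin (i : ℕ) → Input m) → (Fin (r i) → ZMod 2)
  measurable_est : ∀ i, Measurable (est i)

namespace PolarCode

variable {l : ℕ} (c : PolarCode m l 𝓨)

/-- `B_i`, the set of the users that send data on the `i`-th synthetic channel. -/
def activeUsers (i : Fin (2 ^ l)) : Finset (Fin m) := Finset.univ.map (c.sel i)

/-- `𝓖[k]`, the set of the indices `i` at which user `k` sends data. -/
def dataIndices (k : Fin m) : Finset (Fin (2 ^ l)) :=
  Finset.univ.filter fun i => k ∈ c.activeUsers i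

/-- The sum rate: the total number of data bits of all the users, divided by the block length. -/
def sumRate : ℝ := (∑ k : Fin m, ((c.dataIndices k).card : ℝ)) / (2 : ℝ) ^ l

/-- The frozen bits of `uⁿ[E_m]`, that is those with `k ∉ B_i`; the data bits are replaced by `0`.
This is all that the decoder is told about `uⁿ[E_m]` in advance. -/
def frozenPart (u : Fin (2 ^ l) → Input m) : Fin (2 ^ l) → Input m :=
  fun i k => if k ∈ c.activeUsers i then 0 else u i k

/-- Stage `i` of the decoder, given the channel output and the previous decisions in `out` and the
frozen bits `f` of index `i` (with `f k = 0` for `k ∈ B_i`). The value `a` of `A_i U_i[E_m]` is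
estimated from `out`. The frozen bits are copied. The bits `v_k`, `k ∈ B_i`, are found by solving
the invertible system `∑_{k ∈ B_i} v_k A_i[k] = a - ∑_{k ∉ B_i} f_k A_i[k]`. -/
def decodeStage (i : Fin (2 ^ l)) (out : (Fin (2 ^ l) → 𝓨) × (Fin (i : ℕ) → Input m))
    (f : Input m) : Input m :=
  Function.extend (c.sel i)
    (((c.A i).submatrix id (c.sel i))⁻¹ *ᵥ (c.est i out - c.A i *ᵥ f)) f

/-- The first `i` decisions of the successive-decision decoder, which has received `y` and knows the
frozen bits `f`. Each stage uses the decisions of the previous stages. -/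
def decodeUpTo (y : Fin (2 ^ l) → 𝓨) (f : Fin (2 ^ l) → Input m) :
    (i : ℕ) → i ≤ 2 ^ l → (Fin i → Input m)
  | 0, _ => Fin.elim0
  | i + 1, h =>
    Fin.snoc (α := fun _ => Input m) (decodeUpTo y f i (Nat.le_of_succ_le h))
      (c.decodeStage ⟨i, h⟩ (y, decodeUpTo y f i (Nat.le_of_succ_le h)) (f ⟨i, h⟩))

/-- The decisions of the successive-decision decoder on all the bits. -/
def decode (y : Fin (2 ^ l) → 𝓨) (f : Fin (2 ^ l) → Input m) : Fin (2 ^ l) → Input m :=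
  c.decodeUpTo y f (2 ^ l) le_rfl

/-- The block error probability over the channel `P`: all the bits `U_i[k]` (data bits as well as
frozen bits) are independent and uniform, user `k` sends `X[k]ⁿ = U[k]ⁿ Gₙ`, and the decoder is
given `Yⁿ` and the frozen bits. An error occurs unless all the bits are recovered. -/
def blockErrorProb (P : Kernel (Input m) 𝓨) : ℝ :=
  (uniformOn (Set.univ : Set (Fin (2 ^ l) → Input m)) ⊗ₘ blockChannel P l).real
    {p | c.decode p.2 (c.frozenPart p.1) ≠ p.1}

end PolarCode

/-- The `r × m` matrix `A` suits a channel `W`: `r` is the integer within `ε` of `I[E_m](W)`, and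
`I(A X[E_m] ; Y) > r - γ`, so that the output of `W` almost determines `A X[E_m]`. -/
def IsGoodMatrix {𝓩 : Type*} [MeasurableSpace 𝓩] (W : Kernel (Input m) 𝓩) (ε γ : ℝ) {r : ℕ}
    (A : Matrix (Fin r) (Fin m) (ZMod 2)) : Prop :=
  |uniformSumRate W - r| < ε ∧ (r : ℝ) - γ < linearInfo W A

/-- The channel `W` is polarized: every `I[J](W)` is within `ε` of an integer, and there are
`r` linear forms of the inputs, `r` being the integer within `ε` of `I[E_m](W)`, that are determined
by the output up to `γ`. -/
def IsPolarized {𝓩 : Type*} [MeasurableSpace 𝓩] (W : Kernel (Input m) 𝓩) (ε γ : ℝ) : Prop :=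
  (∀ J : Finset (Fin m), ∃ z : ℤ, |info W J - z| < ε) ∧
    ∃ (r : ℕ) (A : Matrix (Fin r) (Fin m) (ZMod 2)), IsGoodMatrix W ε γ A

/-- The code is built for the channel `P` with thresholds `ε` and `γ`: data are sent exactly on the
polarized synthetic channels (and nothing is sent on the others), through matrices that suit
them. -/
def PolarCode.IsPolarFor {l : ℕ} (c : PolarCode m l 𝓨) (P : Kernel (Input m) 𝓨) (ε γ : ℝ) : Prop :=
  ∀ i, (IsPolarized (synthChannel P l i) ε γ →
      IsGoodMatrix (synthChannel P l i) ε γ (c.A i)) ∧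
    (¬ IsPolarized (synthChannel P l i) ε γ → c.activeUsers i = ∅)

end PolarMAC

end

/-! The polar transform acts on each user separately with the same matrix, so it commutes with every
linear form a·X over 𝔽₂. Each form by itself therefore undergoes the single-user transform, and its
mean Bhattacharyya parameter Z obeys the classical bounds Z⁻ ≤ 2Z − Z² and Z⁺ ≤ Z²
(`isPolarArray_bhatt`). In the plus step one conditions on the whole vector of first inputs and not
only on its value under a, which can only lower Z. Arrays with these bounds are studied abstractly:
the mean of Z(1 − Z) tends to 0, and for d < 1/2 the fraction of indices with 2^(−n^d) < Z < 3/4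
vanishes (`tendsto_levelMean_slow`). Since there are only 2^m forms, for all but a vanishing
fraction of the indices every form has Z ≤ θ = 2^(−n^d) or Z ≥ 1 − τ, with τ → 0.

A channel with this dichotomy is polarized (`exists_matrix_of_extremal`, `isPolarized_of_extremal`).
Let S be the span of the forms with Z ≤ θ, r its dimension, and A a basis of S made of such forms.
The output almost determines AX, so H(X | Y) is at most about m − r bits. The forms outside S are
almost uniform given the output, so the Fourier mass of the posterior sits on the 2^r elements of S;
by Parseval the collision sum of the posterior is at most about 2^(r−m), and H(X | Y) is at least
about m − r bits. The same argument for X[Jᶜ], with the chain rule, puts every I[J] near an integer.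

For the rate, the chain rule keeps the mean conditional entropy of the synthetic channels constant
(`levelMean_entropy`), hence also their mean sum rate. A polarized channel loses at most ε of it,
any other at most m.

For the error, I(AX; Y) > r − γ forces rank r and H(AX | Y) < γ log 2, and a majority vote on the
posterior then errs with probability at most 2γ log 2 (`majority_error_le`). A decoding error
requires that some rule errs on the true past, so a union bound over the stages suffices
(`PolarCode.blockErrorProb_le`). With β < b < d < 1/2, θ = 2^(−n^d) and γ = 2^(−n^b), each gap
between exponents absorbs the polynomial factors in n. -/

noncomputable section

namespace PolarMAC

/-! ### Polarization of arrays of real numbers -/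

/-- The pairs of a parent index and a bit enumerate the indices of the next level. -/
def childEquiv (l : ℕ) : Fin (2 ^ l) × Fin 2 ≃ Fin (2 ^ (l + 1)) :=
  finProdFinEquiv.trans (finCongr (pow_succ 2 l).symm)

lemma childEquiv_val (l : ℕ) (i : Fin (2 ^ l)) (b : Fin 2) :
    (childEquiv l (i, b) : ℕ) = b + 2 * i := by
  simp [childEquiv]

lemma sum_childEquiv {M : Type*} [AddCommMonoid M] (l : ℕ) (f : Fin (2 ^ (l + 1)) → M) :
    ∑ j, f j = ∑ i, (f (childEquiv l (i, 0)) + f (childEquiv l (i, 1))) := by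
  rw [← (childEquiv l).sum_comp, Fintype.sum_prod_type]
  simp [Fin.sum_univ_two]

/-- The mean over one level of the tree. -/
def levelMean (l : ℕ) (f : Fin (2 ^ l) → ℝ) : ℝ := (∑ i, f i) / 2 ^ l

lemma levelMean_mono {l : ℕ} {f g : Fin (2 ^ l) → ℝ} (h : ∀ i, f i ≤ g i) :
    levelMean l f ≤ levelMean l g := by
  unfold levelMean
  gcongr with i
  exact h i

lemma levelMean_nonneg {l : ℕ} {f : Fin (2 ^ l) → ℝ} (h : ∀ i, 0 ≤ f i) :
    0 ≤ levelMean l f := by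
  unfold levelMean
  have := Finset.sum_nonneg fun i (_ : i ∈ Finset.univ) => h i
  positivity

lemma levelMean_const (l : ℕ) (c : ℝ) : levelMean l (fun _ => c) = c := by
  simp [levelMean]

lemma levelMean_add {l : ℕ} (f g : Fin (2 ^ l) → ℝ) :
    levelMean l (fun i => f i + g i) = levelMean l f + levelMean l g := by
  simp [levelMean, Finset.sum_add_distrib, add_div]

lemma levelMean_sub {l : ℕ} (f g : Fin (2 ^ l) → ℝ) :
    levelMean l (fun i => f i - g i) = levelMean l f - levelMean l g := by
  simp [levelMean, Finset.sum_sub_distrib, sub_div]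

lemma levelMean_const_mul {l : ℕ} (c : ℝ) (f : Fin (2 ^ l) → ℝ) :
    levelMean l (fun i => c * f i) = c * levelMean l f := by
  simp [levelMean, ← Finset.mul_sum, mul_div_assoc]

lemma levelMean_sum {ι : Type*} (s : Finset ι) {l : ℕ} (f : ι → Fin (2 ^ l) → ℝ) :
    levelMean l (fun i => ∑ a ∈ s, f a i) = ∑ a ∈ s, levelMean l (f a) := by
  simp only [levelMean, Finset.sum_div]
  rw [Finset.sum_comm]

lemma levelMean_succ (l : ℕ) (f : Fin (2 ^ (l + 1)) → ℝ) :
    levelMean (l + 1) f =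
      levelMean l fun i => (f (childEquiv l (i, 0)) + f (childEquiv l (i, 1))) / 2 := by
  unfold levelMean
  rw [sum_childEquiv, ← Finset.sum_div, div_div, pow_succ (2 : ℝ) l, mul_comm]

lemma sq_levelMean_le {l : ℕ} (f : Fin (2 ^ l) → ℝ) :
    levelMean l f ^ 2 ≤ levelMean l fun i => f i ^ 2 := by
  unfold levelMean
  have h := sq_sum_le_card_mul_sum_sq (s := (Finset.univ : Finset (Fin (2 ^ l)))) (f := f)
  simp only [Finset.card_univ, Fintype.card_fin, Nat.cast_pow, Nat.cast_ofNat] at h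
  rw [div_pow, div_le_div_iff₀ (by positivity) (by positivity)]
  calc (∑ i, f i) ^ 2 * 2 ^ l ≤ (2 ^ l * ∑ i, f i ^ 2) * 2 ^ l := by gcongr
    _ = _ := by ring

/-- An array of numbers in the unit interval that obeys the one-step bounds of Bhattacharyya
parameters under the polar transform. -/
structure IsPolarArray (Z : (l : ℕ) → Fin (2 ^ l) → ℝ) : Prop where
  nonneg : ∀ l i, 0 ≤ Z l i
  le_one : ∀ l i, Z l i ≤ 1
  minus : ∀ l i, Z (l + 1) (childEquiv l (i, 0)) ≤ 2 * Z l i - Z l i ^ 2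
  plus : ∀ l i, Z (l + 1) (childEquiv l (i, 1)) ≤ Z l i ^ 2

namespace IsPolarArray

variable {Z : (l : ℕ) → Fin (2 ^ l) → ℝ} (hZ : IsPolarArray Z)
include hZ

/-- Every drift argument below is an instance: an inequality between a parent and its two children
becomes one between consecutive level means. -/
lemma levelMean_succ_le {g h : ℝ → ℝ}
    (hgh : ∀ z zm zp : ℝ, 0 ≤ z → z ≤ 1 → 0 ≤ zm → zm ≤ 1 → 0 ≤ zp → zp ≤ 1 →
      zm ≤ 2 * z - z ^ 2 → zp ≤ z ^ 2 → h zm + h zp ≤ 2 * g z) (l : ℕ) :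
    levelMean (l + 1) (fun i => h (Z (l + 1) i)) ≤ levelMean l fun i => g (Z l i) := by
  rw [levelMean_succ]
  refine levelMean_mono fun i => ?_
  have := hgh (Z l i) _ _ (hZ.nonneg _ _) (hZ.le_one _ _) (hZ.nonneg _ _) (hZ.le_one _ _)
    (hZ.nonneg _ _) (hZ.le_one _ _) (hZ.minus l i) (hZ.plus l i)
  linarith

/-- The two one-step bounds add up to 2Z: the array is a supermartingale. -/
lemma antitone_levelMean : Antitone fun l => levelMean l (Z l) :=
  antitone_nat_of_succ_le fun l => hZ.levelMean_succ_le (g := id) (h := id)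
    (fun z zm zp _ _ _ _ _ _ h1 h2 => by simp only [id]; linarith) l

lemma tendsto_levelMean_sq :
    Tendsto (fun l => levelMean l fun i => (Z l i * (1 - Z l i)) ^ 2) atTop (nhds 0) := by
  -- The potential 2z − z² increases on [0, 1], so upper bounds on the children suffice. When these
  -- bounds are attained its mean over the two children drops by exactly (z(1 − z))², and the drops
  -- telescope.
  set a : ℕ → ℝ := fun l => levelMean l fun i => 2 * Z l i - Z l i ^ 2 with ha
  have hstep : ∀ l, a (l + 1) ≤ a l - levelMean l fun i => (Z l i * (1 - Z l i)) ^ 2 := by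
    intro l
    have := hZ.levelMean_succ_le (g := fun z => (2 * z - z ^ 2) - (z * (1 - z)) ^ 2)
      (h := fun z => 2 * z - z ^ 2) (fun z zm zp h0 h1 hm0 hm1 hp0 hp1 h2 h3 => by
        nlinarith [mul_nonneg (sub_nonneg.2 h2) (by nlinarith : 0 ≤ 2 - zm - (2 * z - z ^ 2)),
          mul_nonneg (sub_nonneg.2 h3) (by nlinarith : 0 ≤ 2 - zp - z ^ 2)]) l
    rwa [levelMean_sub (fun i => 2 * Z l i - Z l i ^ 2)] at this
  have hnn : ∀ l, 0 ≤ levelMean l fun i => (Z l i * (1 - Z l i)) ^ 2 :=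
    fun l => levelMean_nonneg fun i => sq_nonneg _
  have hanti : Antitone a := antitone_nat_of_succ_le fun l => by linarith [hstep l, hnn l]
  have hbdd : BddBelow (Set.range a) := by
    refine ⟨0, ?_⟩
    rintro _ ⟨l, rfl⟩
    refine levelMean_nonneg fun i => ?_
    nlinarith [hZ.nonneg l i, hZ.le_one l i]
  have hlim := tendsto_atTop_ciInf hanti hbdd
  have hdiff : Tendsto (fun l => a l - a (l + 1)) atTop (nhds 0) := by
    simpa using hlim.sub (hlim.comp (tendsto_add_atTop_nat 1))
  exact squeeze_zero hnn (fun l => by linarith [hstep l]) hdiff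

lemma tendsto_levelMean_mul_one_sub :
    Tendsto (fun l => levelMean l fun i => Z l i * (1 - Z l i)) atTop (nhds 0) := by
  have h := (hZ.tendsto_levelMean_sq).sqrt
  rw [Real.sqrt_zero] at h
  refine squeeze_zero (fun l => levelMean_nonneg fun i =>
    mul_nonneg (hZ.nonneg l i) (sub_nonneg.2 (hZ.le_one l i))) (fun l => ?_) h
  exact Real.le_sqrt_of_sq_le (sq_levelMean_le _)

end IsPolarArray

/-! ### The rate of polarization. -/

/-- The potential `(log₂ (1 / z)) ^ (-s)` of the rate of polarization. -/
def ratePotential (s z : ℝ) : ℝ := (-Real.logb 2 z) ^ (-s)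

lemma ratePotential_nonneg {s z : ℝ} (h0 : 0 ≤ z) (h1 : z ≤ 1) : 0 ≤ ratePotential s z := by
  refine Real.rpow_nonneg ?_ _
  have : Real.logb 2 z ≤ 0 := Real.logb_nonpos (by norm_num) h0 h1
  linarith

/-- At z = 0 the conventions log 0 = 0 and 0 ^ (−s) = 0 give the correct limit 0. At z = 1 the
potential is also 0, which is not its limit; hence the condition w < 1 in `ratePotential_mono` and
the separate case z = 1 in `tendsto_levelMean_slow`. -/
lemma ratePotential_le {s z c : ℝ} (hs : 0 < s) (h0 : 0 ≤ z) (hc : 0 < c)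
    (h : z ≤ (2 : ℝ) ^ (-c)) : ratePotential s z ≤ c ^ (-s) := by
  unfold ratePotential
  rcases h0.eq_or_lt with rfl | h0
  · simp only [Real.logb_zero, neg_zero]
    rw [Real.zero_rpow (by linarith)]
    positivity
  · refine Real.rpow_le_rpow_of_nonpos hc ?_ (by linarith)
    have := (Real.logb_le_iff_le_rpow (by norm_num : (1 : ℝ) < 2) h0).2 h
    linarith

lemma ratePotential_mono {s z w : ℝ} (hs : 0 < s) (h0 : 0 ≤ z) (hzw : z ≤ w) (hw0 : 0 < w)
    (hw : w < 1) : ratePotential s z ≤ ratePotential s w := by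
  have hc : 0 < -Real.logb 2 w := by
    have := Real.logb_neg (by norm_num : (1 : ℝ) < 2) hw0 hw
    linarith
  refine ratePotential_le hs h0 hc ?_
  rwa [neg_neg, Real.rpow_logb (by norm_num) (by norm_num) hw0]

/-- Put c = log₂ (1/z). The plus child at least doubles c. The minus child subtracts at most 1,
which leaves at least uc as soon as c ≥ 1/(1 − u), that is, for z below the stated threshold. The
potentials of the children are thus at most 2^(−s) and u^(−s) times that of z. -/
lemma ratePotential_step {s u ρ z zm zp : ℝ} (hs : 0 < s) (hu0 : 0 < u) (hu1 : u < 1)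
    (hρ : (u ^ (-s) + 2 ^ (-s)) / 2 ≤ ρ) (hz0 : 0 ≤ z) (hz : z ≤ (2 : ℝ) ^ (-(1 - u)⁻¹))
    (hm0 : 0 ≤ zm) (hp0 : 0 ≤ zp) (hm : zm ≤ 2 * z - z ^ 2) (hp : zp ≤ z ^ 2) :
    ratePotential s zm + ratePotential s zp ≤ 2 * ρ * ratePotential s z := by
  rcases hz0.eq_or_lt with rfl | hz0
  · obtain rfl : zm = 0 := by nlinarith
    obtain rfl : zp = 0 := by nlinarith
    simp [ratePotential, Real.zero_rpow (by linarith : -s ≠ 0)]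
  · set c := -Real.logb 2 z with hc
    have hzc : z = (2 : ℝ) ^ (-c) := by
      rw [hc, neg_neg, Real.rpow_logb (by norm_num) (by norm_num) hz0]
    have hu : 0 < 1 - u := by linarith
    have hcu : (1 - u)⁻¹ ≤ c := by
      have := (Real.logb_le_iff_le_rpow (by norm_num : (1 : ℝ) < 2) hz0).2 hz
      linarith
    have hc0 : 0 < c := lt_of_lt_of_le (by positivity) hcu
    have h1 : ratePotential s zm ≤ (u * c) ^ (-s) := by
      refine ratePotential_le hs hm0 (by positivity) ?_
      have h2 : u * c ≤ c - 1 := by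
        have : 1 ≤ c * (1 - u) := by
          rwa [inv_eq_one_div, div_le_iff₀ hu] at hcu
        linarith
      calc zm ≤ 2 * z := by nlinarith
        _ = (2 : ℝ) ^ (-(c - 1)) := by
          rw [hzc, neg_sub, sub_eq_add_neg, Real.rpow_add (by norm_num), Real.rpow_one]
        _ ≤ (2 : ℝ) ^ (-(u * c)) :=
          Real.rpow_le_rpow_of_exponent_le (by norm_num) (by linarith)
    have h2 : ratePotential s zp ≤ (2 * c) ^ (-s) := by
      refine ratePotential_le hs hp0 (by positivity) (hp.trans ?_)
      rw [hzc, ← Real.rpow_natCast, ← Real.rpow_mul (by norm_num)]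
      exact Real.rpow_le_rpow_of_exponent_le (by norm_num) (by push_cast; linarith)
    rw [Real.mul_rpow hu0.le hc0.le] at h1
    rw [Real.mul_rpow (by norm_num) hc0.le] at h2
    have h3 : ratePotential s z = c ^ (-s) := rfl
    rw [h3]
    have : 0 ≤ c ^ (-s) := by positivity
    nlinarith

/-- This is where 1/2 comes from: for u = 1 and small s the product is 1 + (β − 1/2) s log 2 to
first order. By continuity some u < 1 still works. -/
lemma exists_rate_parameters {β : ℝ} (hβ0 : 0 < β) (hβ : β < 1 / 2) :
    ∃ s u ρ : ℝ, 0 < s ∧ 0 < u ∧ u < 1 ∧ (u ^ (-s) + 2 ^ (-s)) / 2 ≤ ρ ∧ 0 < ρ ∧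
      (2 : ℝ) ^ (β * s) * ρ < 1 := by
  have hlog : 0 < Real.log 2 := Real.log_pos (by norm_num)
  -- With s log 2 = t the product is the mean of exp(βt) and exp(−(1 − β)t). By exp x ≤ 1 + x + x²
  -- it is at most 1 − (4t² − t²)/2 for this t.
  set t := (1 - 2 * β) / 4 with ht
  have ht0 : 0 < t := by rw [ht]; linarith
  set s := t / Real.log 2 with hs
  have hs0 : 0 < s := by positivity
  have hst : Real.log 2 * s = t := by rw [hs]; field_simp
  have hkey : (2 : ℝ) ^ (β * s) * ((1 + 2 ^ (-s)) / 2) < 1 := by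
    have e1 : (2 : ℝ) ^ (β * s) = Real.exp (β * t) := by
      rw [Real.rpow_def_of_pos (by norm_num), ← hst]; ring_nf
    have e2 : (2 : ℝ) ^ (-s) = Real.exp (-t) := by
      rw [Real.rpow_def_of_pos (by norm_num), ← hst]; ring_nf
    have e3 : (2 : ℝ) ^ (β * s) * ((1 + 2 ^ (-s)) / 2) =
        (Real.exp (β * t) + Real.exp (-((1 - β) * t))) / 2 := by
      rw [e1, e2, show -((1 - β) * t) = β * t + -t by ring, Real.exp_add]; ring
    have b1 := (abs_le.1 (Real.abs_exp_sub_one_sub_id_le (x := β * t)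
      (by rw [abs_le]; constructor <;> nlinarith))).2
    have b2 := (abs_le.1 (Real.abs_exp_sub_one_sub_id_le (x := -((1 - β) * t))
      (by rw [abs_le]; constructor <;> nlinarith))).2
    rw [e3]
    have h4 : (β * t) ^ 2 + (-((1 - β) * t)) ^ 2 ≤ t ^ 2 := by
      nlinarith [mul_nonneg hβ0.le (by linarith : 0 ≤ 1 - β), sq_nonneg t]
    nlinarith
  have hcont : ContinuousAt (fun u : ℝ => (2 : ℝ) ^ (β * s) * ((u ^ (-s) + 2 ^ (-s)) / 2)) 1 := by
    have : ContinuousAt (fun u : ℝ => u ^ (-s)) 1 :=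
      Real.continuousAt_rpow_const _ _ (Or.inl one_ne_zero)
    fun_prop
  have hev := hcont.eventually (Iio_mem_nhds (by simpa using hkey))
  have hev2 : ∀ᶠ u in nhdsWithin (1 : ℝ) (Set.Iio 1), 0 < u :=
    nhdsWithin_le_nhds (Ioi_mem_nhds one_pos)
  obtain ⟨u, ⟨hu, hu0⟩, hu1⟩ :=
    (((hev.filter_mono nhdsWithin_le_nhds).and hev2).and self_mem_nhdsWithin).exists
  exact ⟨s, u, _, hs0, hu0, hu1, le_rfl, by positivity, hu⟩

namespace IsPolarArray

variable {Z : (l : ℕ) → Fin (2 ^ l) → ℝ} (hZ : IsPolarArray Z)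
include hZ

/-- The potential contracts only below the threshold z₀. Truncation at 1 and the supermartingale
term z/z₀ replace a stopping time: they pay for the paths that climb above z₀. -/
lemma levelMean_ratePotential_le {s u ρ : ℝ} (hs : 0 < s) (hu0 : 0 < u) (hu1 : u < 1)
    (hρ : (u ^ (-s) + 2 ^ (-s)) / 2 ≤ ρ) (hρ0 : 0 < ρ) {K : ℝ} (hK : 0 ≤ K) (k n : ℕ) :
    levelMean (k + n) (fun i => min 1 (Z (k + n) i / (2 : ℝ) ^ (-(1 - u)⁻¹) +
        K * ratePotential s (Z (k + n) i))) ≤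
      levelMean k fun i => min 1 (Z k i / (2 : ℝ) ^ (-(1 - u)⁻¹) +
        K * ρ ^ n * ratePotential s (Z k i)) := by
  set z₀ : ℝ := (2 : ℝ) ^ (-(1 - u)⁻¹)
  have hz₀ : 0 < z₀ := by positivity
  induction n generalizing K with
  | zero => simp
  | succ n ih =>
    have hstep := hZ.levelMean_succ_le
      (g := fun z => min 1 (z / z₀ + K * ρ * ratePotential s z))
      (h := fun z => min 1 (z / z₀ + K * ratePotential s z)) ?_ (k + n)
    · refine hstep.trans ((ih (K := K * ρ) (by positivity)).trans_eq ?_)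
      simp only [pow_succ, mul_assoc, mul_comm ρ]
    · intro z zm zp h0 h1 hm0 hm1 hp0 hp1 hm hp
      rcases le_or_gt z z₀ with hz | hz
      · have hpot := ratePotential_step hs hu0 hu1 hρ h0 hz hm0 hp0 hm hp
        rcases le_total 1 (z / z₀ + K * ρ * ratePotential s z) with h | h
        · rw [min_eq_left h]
          linarith [min_le_left 1 (zm / z₀ + K * ratePotential s zm),
            min_le_left 1 (zp / z₀ + K * ratePotential s zp)]
        · rw [min_eq_right h]
          have h5 : zm / z₀ + zp / z₀ ≤ 2 * (z / z₀) := by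
            rw [← add_div, ← mul_div_assoc]
            gcongr
            linarith
          have h6 := mul_le_mul_of_nonneg_left hpot hK
          linarith [min_le_right 1 (zm / z₀ + K * ratePotential s zm),
            min_le_right 1 (zp / z₀ + K * ratePotential s zp)]
      -- Above z₀ the truncated quantity of the parent is already 1, so nothing has to be known
      -- about the children.
      · have h7 : 1 ≤ z / z₀ := by rw [le_div_iff₀ hz₀]; linarith
        have h8 := ratePotential_nonneg (s := s) h0 h1
        rw [min_eq_left (le_add_of_le_of_nonneg h7 (by positivity))]
        linarith [min_le_left 1 (zm / z₀ + K * ratePotential s zm),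
          min_le_left 1 (zp / z₀ + K * ratePotential s zp)]

/-- The fraction of the indices whose parameter is neither very small nor close to one vanishes. -/
theorem tendsto_levelMean_slow {β : ℝ} (hβ0 : 0 < β) (hβ : β < 1 / 2) :
    Tendsto (fun l => levelMean l fun i =>
      if (2 : ℝ) ^ (-((2 : ℝ) ^ (β * l))) < Z l i ∧ Z l i < 3 / 4 then (1 : ℝ) else 0)
      atTop (nhds 0) := by
  obtain ⟨s, u, ρ, hs, hu0, hu1, hρ, hρ0, hβρ⟩ := exists_rate_parameters hβ0 hβ
  set z₀ : ℝ := (2 : ℝ) ^ (-(1 - u)⁻¹) with hz₀def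
  have hz₀ : 0 < z₀ := by positivity
  set d : ℕ → ℝ := fun l => levelMean l fun i => Z l i * (1 - Z l i) with hd
  have hdlim : Tendsto d atTop (nhds 0) := hZ.tendsto_levelMean_mul_one_sub
  set M : ℕ → ℝ := fun l => levelMean l (Z l) with hM
  have hbdd : BddBelow (Set.range M) :=
    ⟨0, by rintro _ ⟨l, rfl⟩; exact levelMean_nonneg (hZ.nonneg l)⟩
  have hMlim : Tendsto M atTop (nhds (⨅ l, M l)) :=
    tendsto_atTop_ciInf hZ.antitone_levelMean hbdd
  have hdnn : ∀ l i, 0 ≤ Z l i * (1 - Z l i) := fun l i =>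
    mul_nonneg (hZ.nonneg l i) (sub_nonneg.2 (hZ.le_one l i))
  have main : ∀ (δ : ℝ), 0 < δ → δ < 1 → ∀ k n : ℕ,
      (levelMean (k + n) fun i => if (2 : ℝ) ^ (-((2 : ℝ) ^ (β * (k + n : ℕ)))) < Z (k + n) i ∧
        Z (k + n) i < 3 / 4 then (1 : ℝ) else 0) ≤
      (M k - M (k + n)) + d k / δ + 4 * d (k + n) + δ / z₀ +
        (((2 : ℝ) ^ (β * s)) ^ k * ratePotential s δ) * ((2 : ℝ) ^ (β * s) * ρ) ^ n := by
    intro δ hδ0 hδ1 k n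
    set T : ℝ := (2 : ℝ) ^ (β * (k + n : ℕ)) with hT
    have hT1 : 1 ≤ T := Real.one_le_rpow (by norm_num) (by positivity)
    have hθ : (2 : ℝ) ^ (-T) ≤ 1 / 2 := by
      calc (2 : ℝ) ^ (-T) ≤ (2 : ℝ) ^ (-1 : ℝ) :=
            Real.rpow_le_rpow_of_exponent_le (by norm_num) (by linarith)
        _ = 1 / 2 := by rw [Real.rpow_neg_one]; norm_num
    -- For z > 2^(−T) the minimum equals 1, because the potential is then at least T^(−s) (or z =
    -- 1). The subtracted term is z(4z − 3): nonpositive exactly up to 3/4, at most 1 beyond. It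
    -- removes the indices close to one from the count.
    have h1 : ∀ i, (if (2 : ℝ) ^ (-T) < Z (k + n) i ∧ Z (k + n) i < 3 / 4 then (1 : ℝ) else 0) ≤
        min 1 (Z (k + n) i / z₀ + T ^ s * ratePotential s (Z (k + n) i)) -
          (Z (k + n) i - 4 * (Z (k + n) i * (1 - Z (k + n) i))) := by
      intro i
      set z := Z (k + n) i
      have hz0 : 0 ≤ z := hZ.nonneg _ _
      have hz1 : z ≤ 1 := hZ.le_one _ _
      have hpot := ratePotential_nonneg (s := s) hz0 hz1
      have hlarge : (2 : ℝ) ^ (-T) < z → 1 ≤ z / z₀ + T ^ s * ratePotential s z := by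
        intro hz
        have hzpos : 0 < z := lt_trans (by positivity) hz
        rcases hz1.eq_or_lt with h | h
        · have : 1 ≤ z / z₀ := by
            rw [le_div_iff₀ hz₀, h, one_mul]
            exact Real.rpow_le_one_of_one_le_of_nonpos (by norm_num)
              (by rw [neg_nonpos, inv_nonneg]; linarith)
          have : 0 ≤ T ^ s * ratePotential s z := by positivity
          linarith
        · have hlt : -Real.logb 2 z ≤ T := by
            have := (Real.lt_logb_iff_rpow_lt (by norm_num : (1 : ℝ) < 2) hzpos).2 hz
            linarith
          have hpos : 0 < -Real.logb 2 z := by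
            have := Real.logb_neg (by norm_num : (1 : ℝ) < 2) hzpos h
            linarith
          have h9 : T ^ (-s) ≤ ratePotential s z :=
            Real.rpow_le_rpow_of_nonpos hpos hlt (by linarith)
          have h10 : (1 : ℝ) = T ^ s * T ^ (-s) := by
            rw [← Real.rpow_add (by linarith), add_neg_cancel, Real.rpow_zero]
          have h11 : T ^ s * T ^ (-s) ≤ T ^ s * ratePotential s z := by gcongr
          have : 0 ≤ z / z₀ := by positivity
          linarith
      split_ifs with h
      · rw [min_eq_left (hlarge h.1)]
        nlinarith [h.2]
      · rw [not_and_or, not_lt, not_lt] at h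
        have hmin : 0 ≤ min 1 (z / z₀ + T ^ s * ratePotential s z) := by positivity
        rcases h with h | h
        · nlinarith
        · rw [min_eq_left (hlarge (by linarith))]
          nlinarith
    -- At the earlier level k the indices with z ≤ δ are controlled by the potential, the others by
    -- 1 = z + (1 − z) ≤ z + z(1 − z)/δ. The mean of z from here is compared with that at level k +
    -- n; the difference is small because the level means converge.
    have h2 : ∀ i, min 1 (Z k i / z₀ + T ^ s * ρ ^ n * ratePotential s (Z k i)) ≤
        Z k i + (1 / δ) * (Z k i * (1 - Z k i)) +
          (δ / z₀ + T ^ s * ρ ^ n * ratePotential s δ) := by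
      intro i
      set z := Z k i
      have hz0 : 0 ≤ z := hZ.nonneg _ _
      have hz1 : z ≤ 1 := hZ.le_one _ _
      have hdz := hdnn k i
      have hTn : 0 ≤ T ^ s * ρ ^ n := by positivity
      rcases le_or_gt z δ with h | h
      · refine (min_le_right _ _).trans ?_
        have h3 : z / z₀ ≤ δ / z₀ := by gcongr
        have h4 : T ^ s * ρ ^ n * ratePotential s z ≤ T ^ s * ρ ^ n * ratePotential s δ := by
          gcongr
          exact ratePotential_mono hs hz0 h hδ0 hδ1
        have : 0 ≤ (1 / δ) * (z * (1 - z)) := by positivity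
        linarith
      · refine (min_le_left _ _).trans ?_
        have h3 : 1 - z ≤ (1 / δ) * (z * (1 - z)) := by
          rw [one_div, inv_mul_eq_div, le_div_iff₀ hδ0]
          nlinarith
        have := ratePotential_nonneg (s := s) hδ0.le hδ1.le
        have : 0 ≤ δ / z₀ + T ^ s * ρ ^ n * ratePotential s δ := by positivity
        linarith
    have h3 := hZ.levelMean_ratePotential_le hs hu0 hu1 hρ hρ0 (K := T ^ s) (by positivity) k n
    have h4 := levelMean_mono h1
    have h5 := levelMean_mono h2
    rw [levelMean_sub, levelMean_sub, levelMean_const_mul] at h4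
    rw [levelMean_add, levelMean_add, levelMean_const_mul, levelMean_const] at h5
    have h6 : T ^ s * ρ ^ n * ratePotential s δ =
        (((2 : ℝ) ^ (β * s)) ^ k * ratePotential s δ) * ((2 : ℝ) ^ (β * s) * ρ) ^ n := by
      have : T ^ s = ((2 : ℝ) ^ (β * s)) ^ k * ((2 : ℝ) ^ (β * s)) ^ n := by
        rw [← pow_add, hT, ← Real.rpow_mul (by norm_num), ← Real.rpow_natCast,
          ← Real.rpow_mul (by norm_num)]
        ring_nf
      rw [this, mul_pow]; ring
    rw [← h6]
    have h7 : 1 / δ * d k = d k / δ := by ring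
    simp only [hM, hd] at h7 ⊢
    linarith
  refine Metric.tendsto_atTop.2 fun ε hε => ?_
  -- The five terms of `main` contribute at most 1, 1, 4, 1 and 1 times η. One fixes δ, then k, and
  -- lets n grow.
  set η := ε / 9 with hη
  have hη0 : 0 < η := by positivity
  set δ := min (η * z₀) (1 / 2) with hδ
  have hδ0 : 0 < δ := by positivity
  have hδ1 : δ < 1 := (min_le_right _ _).trans_lt (by norm_num)
  have hδz : δ / z₀ ≤ η := by
    rw [div_le_iff₀ hz₀]; exact min_le_left _ _
  obtain ⟨k, hk1, hk2⟩ := ((hdlim.eventually (Iio_mem_nhds (by positivity : 0 < η * δ))).and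
    (hMlim.eventually (Iio_mem_nhds (lt_add_of_pos_right _ hη0)))).exists
  have hgeo : Tendsto (fun n : ℕ => (((2 : ℝ) ^ (β * s)) ^ k * ratePotential s δ) *
      ((2 : ℝ) ^ (β * s) * ρ) ^ n) atTop (nhds 0) := by
    simpa using (tendsto_pow_atTop_nhds_zero_of_lt_one (by positivity) hβρ).const_mul _
  have hdlim' : Tendsto (fun n => d (k + n)) atTop (nhds 0) :=
    hdlim.comp (tendsto_add_atTop_nat k |>.congr fun n => add_comm n k)
  obtain ⟨N, hN⟩ := eventually_atTop.1 ((hgeo.eventually (Iio_mem_nhds hη0)).and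
    (hdlim'.eventually (Iio_mem_nhds hη0)))
  refine ⟨k + N, fun l hl => ?_⟩
  obtain ⟨n, rfl⟩ := Nat.exists_eq_add_of_le (le_trans (Nat.le_add_right k N) hl)
  have hn := hN n (by omega)
  have hMn : (⨅ l, M l) ≤ M (k + n) := ciInf_le hbdd _
  have hdk : d k / δ ≤ η := by
    rw [div_le_iff₀ hδ0]; exact le_of_lt hk1
  have := main δ hδ0 hδ1 k n
  rw [Real.dist_eq, sub_zero, abs_of_nonneg (levelMean_nonneg fun i => by split_ifs <;> norm_num)]
  have hn1 := hn.1
  have hn2 := hn.2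
  linarith

end IsPolarArray

/-! ### Finite distributions: entropies, Bhattacharyya parameters and Fourier coefficients -/

section Finite

variable {α δ : Type*} [Fintype α] [DecidableEq δ]

/-- The push-forward of a weight function on a finite type. -/
def pushSum (g : α → δ) (q : α → ℝ) (b : δ) : ℝ := ∑ a with g a = b, q a

/-- The 1-homogeneous extension of the entropy (in nats) of finite probability distributions. -/
def entropyFn (q : α → ℝ) : ℝ := ∑ a, Real.negMulLog (q a) - Real.negMulLog (∑ a, q a)

lemma pushSum_nonneg {g : α → δ} {q : α → ℝ} (hq : ∀ a, 0 ≤ q a) (b : δ) : 0 ≤ pushSum g q b :=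
  Finset.sum_nonneg fun a _ => hq a

lemma le_pushSum {g : α → δ} {q : α → ℝ} (hq : ∀ a, 0 ≤ q a) (a : α) : q a ≤ pushSum g q (g a) :=
  Finset.single_le_sum (f := q) (fun a _ => hq a) (by simp)

lemma pushSum_const_mul (g : α → δ) (q : α → ℝ) (c : ℝ) (b : δ) :
    pushSum g (fun a => c * q a) b = c * pushSum g q b := by
  simp [pushSum, Finset.mul_sum]

@[simp]
lemma pushSum_id [DecidableEq α] (q : α → ℝ) : pushSum id q = q := by
  funext a
  simp [pushSum, Finset.filter_eq']

variable [Fintype δ]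

lemma sum_pushSum_mul (g : α → δ) (q : α → ℝ) (f : δ → ℝ) :
    ∑ b, pushSum g q b * f b = ∑ a, q a * f (g a) := by
  simp only [pushSum, Finset.sum_mul]
  rw [← Finset.sum_fiberwise (s := Finset.univ) (g := g) (f := fun a => q a * f (g a))]
  refine Finset.sum_congr rfl fun b _ => Finset.sum_congr rfl fun a ha => ?_
  rw [(Finset.mem_filter.1 ha).2]

lemma sum_pushSum (g : α → δ) (q : α → ℝ) : ∑ b, pushSum g q b = ∑ a, q a := by
  simpa using sum_pushSum_mul g q fun _ => 1

lemma pushSum_comp {κ : Type*} [Fintype κ] [DecidableEq κ] (g : α → δ) (h : δ → κ) (q : α → ℝ) :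
    pushSum h (pushSum g q) = pushSum (fun a => h (g a)) q := by
  funext c
  have := sum_pushSum_mul g q fun b => if h b = c then 1 else 0
  simpa [pushSum, Finset.sum_filter] using this

lemma entropyFn_of_sum_eq_one {p : α → ℝ} (h1 : ∑ a, p a = 1) :
    entropyFn p = ∑ a, Real.negMulLog (p a) := by
  simp [entropyFn, h1]

/-- Homogeneity lets mean conditional entropies be computed from densities that are not normalized.
-/
lemma entropyFn_const_mul {q : α → ℝ} {c : ℝ} :
    entropyFn (fun a => c * q a) = c * entropyFn q := by
  simp only [entropyFn, ← Finset.mul_sum, Real.negMulLog_mul, Finset.sum_add_distrib,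
    ← Finset.sum_mul]
  ring

lemma le_one_of_sum_eq_one {p : α → ℝ} (h0 : ∀ a, 0 ≤ p a) (h1 : ∑ a, p a = 1) (a : α) :
    p a ≤ 1 := h1 ▸ Finset.single_le_sum (f := p) (fun a _ => h0 a) (Finset.mem_univ a)

lemma entropyFn_nonneg {p : α → ℝ} (h0 : ∀ a, 0 ≤ p a) (h1 : ∑ a, p a = 1) :
    0 ≤ entropyFn p := by
  rw [entropyFn_of_sum_eq_one h1]
  exact Finset.sum_nonneg fun a _ =>
    Real.negMulLog_nonneg (h0 a) (le_one_of_sum_eq_one h0 h1 a)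

lemma measurable_entropyFn : Measurable (entropyFn : (α → ℝ) → ℝ) := by
  have : Measurable Real.negMulLog := Real.continuous_negMulLog.measurable
  unfold entropyFn
  fun_prop

lemma abs_entropyFn_le {q : α → ℝ} (h0 : ∀ a, 0 ≤ q a) (h1 : ∑ a, q a ≤ 1) :
    |entropyFn q| ≤ Fintype.card α + 1 := by
  have hb : ∀ x : ℝ, 0 ≤ x → x ≤ 1 → 0 ≤ Real.negMulLog x ∧ Real.negMulLog x ≤ 1 := by
    intro x hx0 hx1
    refine ⟨Real.negMulLog_nonneg hx0 hx1, ?_⟩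
    have := Real.negMulLog_le_one_sub_self hx0
    linarith
  have hq : ∀ a, q a ≤ 1 := fun a =>
    (Finset.single_le_sum (f := q) (fun a _ => h0 a) (Finset.mem_univ a)).trans h1
  have hs := hb _ (Finset.sum_nonneg fun a _ => h0 a) h1
  have hl : 0 ≤ ∑ a, Real.negMulLog (q a) := Finset.sum_nonneg fun a _ => (hb _ (h0 a) (hq a)).1
  have hu : ∑ a, Real.negMulLog (q a) ≤ Fintype.card α := by
    calc ∑ a, Real.negMulLog (q a) ≤ ∑ a : α, (1 : ℝ) :=
          Finset.sum_le_sum fun a _ => (hb _ (h0 a) (hq a)).2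
      _ = _ := by simp
  unfold entropyFn
  rw [abs_le]
  constructor <;> linarith

/-- Gibbs' inequality. -/
lemma entropyFn_le_cross {p q : α → ℝ} (h0 : ∀ a, 0 ≤ p a) (h1 : ∑ a, p a = 1)
    (hq : ∀ a, 0 < p a → 0 < q a) (hq0 : ∀ a, 0 ≤ q a) (hq1 : ∑ a, q a ≤ 1) :
    entropyFn p ≤ -∑ a, p a * Real.log (q a) := by
  rw [entropyFn_of_sum_eq_one h1]
  have : ∀ a, Real.negMulLog (p a) ≤ -(p a * Real.log (q a)) + (q a - p a) := by
    intro a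
    rcases (h0 a).eq_or_lt with h | h
    · simp [← h, hq0 a]
    · have h2 := Real.log_le_sub_one_of_pos (div_pos (hq a h) h)
      rw [Real.log_div (hq a h).ne' h.ne'] at h2
      have h3 := mul_le_mul_of_nonneg_left h2 h.le
      have h4 : p a * (q a / p a - 1) = q a - p a := by field_simp
      rw [h4] at h3
      simp only [Real.negMulLog]
      linarith
  calc ∑ a, Real.negMulLog (p a) ≤ ∑ a, (-(p a * Real.log (q a)) + (q a - p a)) :=
        Finset.sum_le_sum fun a _ => this a
    _ = -∑ a, p a * Real.log (q a) + (∑ a, q a - ∑ a, p a) := by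
        simp [Finset.sum_add_distrib, Finset.sum_sub_distrib]
    _ ≤ _ := by linarith

/-- The entropy is at most that of an image plus the logarithm of the size of the fibres. -/
lemma entropyFn_le_pushSum_add_log {p : α → ℝ} (h0 : ∀ a, 0 ≤ p a) (h1 : ∑ a, p a = 1)
    (g : α → δ) {N : ℕ} (hN : 0 < N)
    (hfib : ∀ b, (Finset.univ.filter fun a => g a = b).card ≤ N) :
    entropyFn p ≤ entropyFn (pushSum g p) + Real.log N := by
  have hNr : (0 : ℝ) < N := by exact_mod_cast hN
  have hpos : ∀ a, 0 < p a → 0 < pushSum g p (g a) := fun a ha => ha.trans_le (le_pushSum h0 a)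
  -- Comparison with the image law spread over fibres of nominal size N; its total mass is at most 1
  -- because no fibre is larger than N.
  have h := entropyFn_le_cross h0 h1 (q := fun a => pushSum g p (g a) / N)
    (fun a ha => div_pos (hpos a ha) hNr) (fun a => div_nonneg (pushSum_nonneg h0 _) hNr.le) ?_
  · refine h.trans_eq ?_
    have e : ∀ a, p a * Real.log (pushSum g p (g a) / N) =
        p a * Real.log (pushSum g p (g a)) - p a * Real.log N := by
      intro a
      rcases (h0 a).eq_or_lt with h | h
      · simp [← h]
      · rw [Real.log_div (hpos a h).ne' hNr.ne']; ring
    simp only [e, Finset.sum_sub_distrib, ← Finset.sum_mul, h1]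
    rw [← sum_pushSum_mul g p fun b => Real.log (pushSum g p b),
      entropyFn_of_sum_eq_one (by rw [sum_pushSum, h1])]
    simp only [Real.negMulLog, neg_mul, Finset.sum_neg_distrib]
    ring
  · rw [← Finset.sum_div, div_le_one hNr]
    calc ∑ a, pushSum g p (g a) = ∑ b, ∑ a with g a = b, pushSum g p (g a) :=
          (Finset.sum_fiberwise (s := Finset.univ) (g := g) _).symm
      _ = ∑ b, ∑ a with g a = b, pushSum g p b := by
          refine Finset.sum_congr rfl fun b _ => Finset.sum_congr rfl fun a ha => ?_
          rw [(Finset.mem_filter.1 ha).2]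
      _ ≤ ∑ b, N * pushSum g p b := by
          refine Finset.sum_le_sum fun b _ => ?_
          rw [Finset.sum_const, nsmul_eq_mul]
          have := pushSum_nonneg (g := g) h0 b
          gcongr
          exact hfib b
      _ = N := by rw [← Finset.mul_sum, sum_pushSum, h1, mul_one]

/-- Subadditivity of the entropy. -/
lemma entropyFn_le_sum_marginals {r : ℕ} {β : Type*} [Fintype β] [DecidableEq β]
    {p : (Fin r → β) → ℝ} (h0 : ∀ a, 0 ≤ p a) (h1 : ∑ a, p a = 1) :
    entropyFn p ≤ ∑ j, entropyFn (pushSum (fun v => v j) p) := by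
  have h := entropyFn_le_cross h0 h1 (q := fun v => ∏ j, pushSum (fun v => v j) p (v j))
    (fun v hv => Finset.prod_pos fun j _ => hv.trans_le (le_pushSum (g := fun v => v j) h0 v))
    (fun v => Finset.prod_nonneg fun j _ => pushSum_nonneg h0 _) ?_
  · refine h.trans_eq ?_
    have e : ∀ v, p v * Real.log (∏ j, pushSum (fun v => v j) p (v j)) =
        ∑ j, p v * Real.log (pushSum (fun v => v j) p (v j)) := by
      intro v
      rcases (h0 v).eq_or_lt with h | h
      · simp [← h]
      · rw [Real.log_prod fun j _ => (h.trans_le (le_pushSum (g := fun v => v j) h0 v)).ne',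
          Finset.mul_sum]
    simp only [e]
    rw [Finset.sum_comm, ← Finset.sum_neg_distrib]
    refine Finset.sum_congr rfl fun j _ => ?_
    rw [← sum_pushSum_mul (fun v => v j) p fun b => Real.log (pushSum (fun v => v j) p b),
      entropyFn_of_sum_eq_one (by rw [sum_pushSum, h1])]
    simp [Real.negMulLog]
  · have : ∑ v : Fin r → β, ∏ j, pushSum (fun v => v j) p (v j) =
        ∏ j : Fin r, ∑ b, pushSum (fun v => v j) p b := by
      rw [Finset.prod_univ_sum, Fintype.piFinset_univ]
    rw [this]
    simp [sum_pushSum, h1]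

/-- The weighted vote for the elements of weight more than one half misses with probability at most
twice the entropy. -/
lemma majority_error_le {V : Type*} [AddCommMonoid V] [Fintype V] [DecidableEq V] {p : V → ℝ}
    (h0 : ∀ a, 0 ≤ p a) (h1 : ∑ a, p a = 1) :
    ∑ a, (if (∑ b, if 1 / 2 < p b then b else 0) ≠ a then p a else 0) ≤ 2 * entropyFn p := by
  -- The entropy is at least the min-entropy. If some atom exceeds 1/2 it is the only one, the vote
  -- returns it, and the error 1 − p a is at most −log (p a).
  have hlow : ∀ c : ℝ, 0 < c → (∀ a, p a ≤ c) → -Real.log c ≤ entropyFn p := by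
    intro c hc h
    rw [entropyFn_of_sum_eq_one h1]
    calc -Real.log c = ∑ a, p a * (-Real.log c) := by rw [← Finset.sum_mul, h1, one_mul]
      _ ≤ ∑ a, Real.negMulLog (p a) := by
          refine Finset.sum_le_sum fun a _ => ?_
          rcases (h0 a).eq_or_lt with h2 | h2
          · simp [← h2]
          · have := Real.log_le_log h2 (h a)
            simp only [Real.negMulLog]
            nlinarith
  by_cases hex : ∃ a, 1 / 2 < p a
  · obtain ⟨a, ha⟩ := hex
    have hother : ∀ b, b ≠ a → p b ≤ 1 - p a := by
      intro b hb
      have := Finset.add_le_sum (f := p) (s := Finset.univ) (fun i _ => h0 i)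
        (Finset.mem_univ a) (Finset.mem_univ b) hb.symm
      linarith
    have hest : (∑ b, if 1 / 2 < p b then b else 0) = a := by
      rw [Finset.sum_eq_single a]
      · exact if_pos ha
      · intro b _ hb
        rw [if_neg]
        have := hother b hb
        linarith
      · simp
    rw [hest]
    have hsum : ∑ b, (if a ≠ b then p b else 0) = 1 - p a := by
      have : ∀ b, (if a ≠ b then p b else 0) = p b - if a = b then p b else 0 := by
        intro b; split_ifs <;> simp_all
      simp [this, h1]
    rw [hsum]
    have h2 := hlow (p a) (by linarith) (fun b => by
      by_cases hb : b = a
      · rw [hb]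
      · linarith [hother b hb])
    have h3 := Real.log_le_sub_one_of_pos (show 0 < p a by linarith)
    have h4 := le_one_of_sum_eq_one h0 h1 a
    linarith
  -- Without such an atom the entropy is at least log 2, and 2 log 2 exceeds 1, the trivial bound on
  -- the error.
  · push Not at hex
    have h2 := hlow (1 / 2) (by norm_num) hex
    rw [one_div, Real.log_inv, neg_neg] at h2
    have h3 := Real.log_two_gt_d9
    calc _ ≤ ∑ a, p a := Finset.sum_le_sum fun a _ => by split_ifs <;> simp [h0]
      _ ≤ _ := by rw [h1]; linarith

end Finite

lemma sum_zmod_two {M : Type*} [AddCommMonoid M] (f : ZMod 2 → M) : ∑ b, f b = f 0 + f 1 :=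
  Fin.sum_univ_two f

/-- Applying log t ≤ t − 1 to t = 1/√x gives −x log x ≤ 2√x(1 − √x), and (1 − √x)² ≤ 1 − x = y. -/
lemma negMulLog_le_two_mul_sqrt {x y : ℝ} (hx : 0 ≤ x) (hy : 0 ≤ y) (h : x + y = 1) :
    Real.negMulLog x ≤ 2 * √(x * y) := by
  rcases hx.eq_or_lt with rfl | hx
  · simp
  have hs : 0 < √x := Real.sqrt_pos.2 hx
  have h1 := Real.log_le_sub_one_of_pos (inv_pos.2 hs)
  rw [Real.log_inv, Real.log_sqrt hx.le] at h1
  have hsx := Real.sq_sqrt hx.le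
  have h2 : Real.negMulLog x ≤ 2 * (√x - x) := by
    have := mul_le_mul_of_nonneg_left h1 hx.le
    have h3 : x * (√x)⁻¹ = √x := by rw [← hsx]; field_simp; simp [hsx]
    simp only [Real.negMulLog]
    nlinarith
  have hs1 : √x ≤ 1 := Real.sqrt_le_one.2 (by linarith)
  have h4 : √x - x ≤ √(x * y) := by
    refine Real.le_sqrt_of_sq_le ?_
    have : (√x - x) ^ 2 = x * (1 - √x) ^ 2 := by
      have : √x - x = √x * (1 - √x) := by linear_combination hsx
      rw [this, mul_pow, hsx]
    rw [this]
    have : (1 - √x) ^ 2 ≤ y := by nlinarith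
    gcongr
  linarith

lemma entropyFn_zmod_two_le {p : ZMod 2 → ℝ} (h0 : ∀ a, 0 ≤ p a) (h1 : ∑ a, p a = 1) :
    entropyFn p ≤ 4 * √(p 0 * p 1) := by
  rw [entropyFn_of_sum_eq_one h1, sum_zmod_two]
  rw [sum_zmod_two] at h1
  have a := negMulLog_le_two_mul_sqrt (h0 0) (h0 1) h1
  have b := negMulLog_le_two_mul_sqrt (h0 1) (h0 0) (by linarith)
  rw [mul_comm (p 1)] at b
  linarith

/-- The nontrivial real character of `𝔽₂`. -/
def signChar (b : ZMod 2) : ℝ := if b = 0 then 1 else -1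

lemma signChar_add (a b : ZMod 2) : signChar (a + b) = signChar a * signChar b := by
  have h : ∀ a b : ZMod 2, (a + b = 0 ↔ (a = 0 ↔ b = 0)) := by decide
  have := h a b
  unfold signChar
  by_cases ha : a = 0 <;> by_cases hb : b = 0 <;> simp_all

/-! ### Fourier analysis on 𝔽₂^ι: Bhattacharyya parameters against character sums. -/

section Fourier

lemma signChar_sum {ι : Type*} {s : Finset ι} (f : ι → ZMod 2) :
    signChar (∑ i ∈ s, f i) = ∏ i ∈ s, signChar (f i) := by
  classical
  induction s using Finset.induction_on with
  | empty => simp [signChar]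
  | insert a s ha ih => rw [Finset.sum_insert ha, signChar_add, ih, Finset.prod_insert ha]

variable {ι : Type*} [Fintype ι] [DecidableEq ι]

lemma sum_signChar_dotProduct (x : ι → ZMod 2) :
    ∑ c : ι → ZMod 2, signChar (c ⬝ᵥ x) = if x = 0 then 2 ^ Fintype.card ι else 0 := by
  have h1 : ∑ c : ι → ZMod 2, signChar (c ⬝ᵥ x) = ∏ i, ∑ b : ZMod 2, signChar (b * x i) := by
    rw [Finset.prod_univ_sum, Fintype.piFinset_univ]
    simp only [dotProduct, signChar_sum]
  rw [h1]
  split_ifs with h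
  · subst h
    simp [signChar]
  · obtain ⟨i, hi⟩ := Function.ne_iff.1 h
    refine Finset.prod_eq_zero (Finset.mem_univ i) ?_
    simp only [Pi.zero_apply] at hi
    simp [sum_zmod_two, signChar, hi]

/-- The Bhattacharyya parameter of the linear form `a` under the weights `q`. -/
def bhattFn (a : ι → ZMod 2) (q : (ι → ZMod 2) → ℝ) : ℝ :=
  2 * √(pushSum (fun x => a ⬝ᵥ x) q 0 * pushSum (fun x => a ⬝ᵥ x) q 1)

/-- The Fourier coefficient of the weights `q` at the linear form `a`. -/
def fourierFn (a : ι → ZMod 2) (q : (ι → ZMod 2) → ℝ) : ℝ := ∑ x, q x * signChar (a ⬝ᵥ x)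

lemma fourierFn_eq (a : ι → ZMod 2) (q : (ι → ZMod 2) → ℝ) :
    fourierFn a q = pushSum (fun x => a ⬝ᵥ x) q 0 - pushSum (fun x => a ⬝ᵥ x) q 1 := by
  unfold fourierFn
  rw [← sum_pushSum_mul (fun x => a ⬝ᵥ x) q signChar, sum_zmod_two]
  simp [signChar]
  ring

lemma bhattFn_nonneg (a : ι → ZMod 2) (q : (ι → ZMod 2) → ℝ) : 0 ≤ bhattFn a q := by
  unfold bhattFn; positivity

/-- If u and v are the masses of the two values of the form, then 4uv = (u + v)² − (u − v)² and u +
v = 1. -/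
lemma bhattFn_sq {q : (ι → ZMod 2) → ℝ} (a : ι → ZMod 2) (h0 : ∀ x, 0 ≤ q x)
    (h1 : ∑ x, q x = 1) : bhattFn a q ^ 2 = 1 - fourierFn a q ^ 2 := by
  rw [fourierFn_eq, bhattFn, mul_pow, Real.sq_sqrt
    (mul_nonneg (pushSum_nonneg h0 _) (pushSum_nonneg h0 _))]
  have := sum_pushSum (fun x => a ⬝ᵥ x) q
  rw [h1, sum_zmod_two] at this
  linear_combination (pushSum (fun x => a ⬝ᵥ x) q 0 + pushSum (fun x => a ⬝ᵥ x) q 1 + 1) * this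

lemma bhattFn_le_one {q : (ι → ZMod 2) → ℝ} (a : ι → ZMod 2) (h0 : ∀ x, 0 ≤ q x)
    (h1 : ∑ x, q x = 1) : bhattFn a q ≤ 1 := by
  have := bhattFn_sq a h0 h1
  nlinarith [bhattFn_nonneg a q, sq_nonneg (fourierFn a q)]

lemma bhattFn_const_mul (a : ι → ZMod 2) (q : (ι → ZMod 2) → ℝ) {c : ℝ} (hc : 0 ≤ c) :
    bhattFn a (fun x => c * q x) = c * bhattFn a q := by
  simp only [bhattFn, pushSum_const_mul]
  rw [mul_mul_mul_comm, Real.sqrt_mul (mul_self_nonneg c), Real.sqrt_mul_self hc]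
  ring

/-- Parseval: after expansion of the squares, the character sums vanish unless x + y = 0, that is, x
= y. -/
lemma sum_fourierFn_sq (q : (ι → ZMod 2) → ℝ) :
    ∑ a, fourierFn a q ^ 2 = 2 ^ Fintype.card ι * ∑ x, q x ^ 2 := by
  have hadd : ∀ x y : ι → ZMod 2, x + y = 0 ↔ y = x := by
    have h : ∀ b c : ZMod 2, b + c = 0 ↔ c = b := by decide
    intro x y
    simp only [funext_iff, Pi.add_apply, Pi.zero_apply, h]
  calc ∑ a, fourierFn a q ^ 2
      = ∑ a : ι → ZMod 2, ∑ x, ∑ y, q x * q y * signChar (a ⬝ᵥ (x + y)) := by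
        refine Finset.sum_congr rfl fun a _ => ?_
        rw [sq, fourierFn, Finset.sum_mul_sum]
        refine Finset.sum_congr rfl fun x _ => Finset.sum_congr rfl fun y _ => ?_
        rw [dotProduct_add, signChar_add]; ring
    _ = ∑ x, ∑ y, q x * q y * ∑ a : ι → ZMod 2, signChar (a ⬝ᵥ (x + y)) := by
        rw [Finset.sum_comm]
        refine Finset.sum_congr rfl fun x _ => ?_
        rw [Finset.sum_comm]
        simp only [Finset.mul_sum]
    _ = _ := by
        simp only [sum_signChar_dotProduct, hadd]
        simp only [mul_ite, mul_zero, Finset.sum_ite_eq', Finset.mem_univ, if_true, Finset.mul_sum]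
        exact Finset.sum_congr rfl fun x _ => by ring

/-- A distribution whose Fourier coefficients outside of `T` are small has a large entropy. -/
lemma le_entropyFn_of_fourier {p : (ι → ZMod 2) → ℝ} (h0 : ∀ x, 0 ≤ p x) (h1 : ∑ x, p x = 1)
    {T : Finset (ι → ZMod 2)} (hT : T.Nonempty) :
    Fintype.card ι * Real.log 2 - Real.log T.card - ∑ a ∈ Tᶜ, 2 * (1 - bhattFn a p) ≤
      entropyFn p := by
  have hTc : (1 : ℝ) ≤ T.card := by exact_mod_cast hT.card_pos
  have hTpos : (0 : ℝ) < T.card := by linarith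
  -- When T is a subspace, s is the weight of a point under the uniform law on its annihilator, the
  -- extremal case.
  set s : ℝ := T.card / 2 ^ Fintype.card ι with hs
  have hs0 : 0 < s := by positivity
  have hlogs : -Real.log s = Fintype.card ι * Real.log 2 - Real.log T.card := by
    rw [hs, Real.log_div hTpos.ne' (by positivity), Real.log_pow]; ring
  -- The inequality log t ≤ t − 1 at t = p/s trades the entropy for the collision sum ∑ p², to which
  -- Parseval applies.
  have hpt : ∀ x, p x * (-Real.log s) + p x - p x ^ 2 / s ≤ Real.negMulLog (p x) := by
    intro x
    rcases (h0 x).eq_or_lt with h | h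
    · simp [← h]
    · have h2 := Real.log_le_sub_one_of_pos (div_pos h hs0)
      rw [Real.log_div h.ne' hs0.ne'] at h2
      have h3 := mul_le_mul_of_nonneg_left h2 h.le
      have h4 : p x * (p x / s - 1) = p x ^ 2 / s - p x := by ring
      simp only [Real.negMulLog]
      linarith
  have hsum := Finset.sum_le_sum fun x (_ : x ∈ Finset.univ) => hpt x
  rw [Finset.sum_sub_distrib, Finset.sum_add_distrib, ← Finset.sum_mul, h1, ← Finset.sum_div,
    one_mul, ← entropyFn_of_sum_eq_one h1, hlogs] at hsum
  have hpars : (∑ x, p x ^ 2) / s = (∑ a, fourierFn a p ^ 2) / T.card := by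
    rw [sum_fourierFn_sq, hs]; field_simp
  -- On T a squared coefficient is at most 1; off T it is 1 − Z² ≤ 2(1 − Z).
  have hf : ∑ a, fourierFn a p ^ 2 ≤ T.card + ∑ a ∈ Tᶜ, 2 * (1 - bhattFn a p) := by
    rw [← Finset.sum_add_sum_compl T]
    refine add_le_add ?_ (Finset.sum_le_sum fun a _ => ?_)
    · calc ∑ a ∈ T, fourierFn a p ^ 2 ≤ ∑ a ∈ T, (1 : ℝ) := Finset.sum_le_sum fun a _ => by
            nlinarith [bhattFn_sq a h0 h1, sq_nonneg (bhattFn a p)]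
        _ = T.card := by simp
    · nlinarith [bhattFn_sq a h0 h1, sq_nonneg (1 - bhattFn a p)]
  have hE : 0 ≤ ∑ a ∈ Tᶜ, 2 * (1 - bhattFn a p) :=
    Finset.sum_nonneg fun a _ => by linarith [bhattFn_le_one a h0 h1]
  have h6 : (∑ x, p x ^ 2) / s ≤ 1 + ∑ a ∈ Tᶜ, 2 * (1 - bhattFn a p) := by
    rw [hpars, div_le_iff₀ hTpos]
    nlinarith
  linarith

/-- The entropy of a vector of linear forms is bounded by their Bhattacharyya parameters. -/
lemma entropyFn_pushSum_mulVec_le {p : (ι → ZMod 2) → ℝ} (h0 : ∀ x, 0 ≤ p x)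
    (h1 : ∑ x, p x = 1) {r : ℕ} (A : Matrix (Fin r) ι (ZMod 2)) :
    entropyFn (pushSum (fun x => A *ᵥ x) p) ≤ ∑ j, 2 * bhattFn (A j) p := by
  refine (entropyFn_le_sum_marginals (pushSum_nonneg h0) (by rw [sum_pushSum, h1])).trans
    (Finset.sum_le_sum fun j _ => ?_)
  rw [pushSum_comp]
  refine (entropyFn_zmod_two_le (pushSum_nonneg h0) (by rw [sum_pushSum, h1])).trans_eq ?_
  simp only [bhattFn, Matrix.mulVec]
  ring

end Fourier

/-! ### Joint laws with a finite first component: densities and functionals of the posterior -/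

section Density

variable {α 𝓩 : Type*} [Fintype α] [MeasurableSpace α] [MeasurableSpace 𝓩]

/-- `q` is a density of the law `ρ` on `α × 𝓩` with respect to the product of the counting measure
and `ν`. -/
structure HasDensity (ρ : Measure (α × 𝓩)) (ν : Measure 𝓩) (q : α → 𝓩 → ℝ) : Prop where
  measurable : ∀ a, Measurable (q a)
  nonneg : ∀ a z, 0 ≤ q a z
  lintegral_eq : ∀ f : α × 𝓩 → ENNReal, Measurable f →
    ∫⁻ p, f p ∂ρ = ∫⁻ z, ∑ a, ENNReal.ofReal (q a z) * f (a, z) ∂ν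

section Posterior

variable [MeasurableSingletonClass α]

/-- The posterior probability of `a` given the second component. -/
def posterior [Nonempty α] (ρ : Measure (α × 𝓩)) [IsFiniteMeasure ρ] (a : α) (z : 𝓩) : ℝ :=
  ((ρ.map Prod.swap).condKernel z).real {a}

/-- The mean of a functional of the posterior distribution. -/
def posteriorMean [Nonempty α] (φ : (α → ℝ) → ℝ) (ρ : Measure (α × 𝓩)) [IsFiniteMeasure ρ] : ℝ :=
  ∫ z, φ (fun a => posterior ρ a z) ∂ρ.snd

lemma posterior_nonneg [Nonempty α] (ρ : Measure (α × 𝓩)) [IsFiniteMeasure ρ] (a : α) (z : 𝓩) :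
    0 ≤ posterior ρ a z := measureReal_nonneg

lemma sum_posterior [Nonempty α] (ρ : Measure (α × 𝓩)) [IsFiniteMeasure ρ] (z : 𝓩) :
    ∑ a, posterior ρ a z = 1 := by
  simp [posterior]

lemma measurable_posterior [Nonempty α] (ρ : Measure (α × 𝓩)) [IsFiniteMeasure ρ] (a : α) :
    Measurable (posterior ρ a) :=
  ((ρ.map Prod.swap).condKernel.measurable_coe (measurableSet_singleton a)).ennreal_toReal

lemma hasDensity_posterior [Nonempty α] (ρ : Measure (α × 𝓩)) [IsFiniteMeasure ρ] :
    HasDensity ρ ρ.snd (posterior ρ) where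
  measurable := measurable_posterior ρ
  nonneg := posterior_nonneg ρ
  lintegral_eq f hf := by
    have hfs : Measurable fun p : 𝓩 × α => f p.swap := hf.comp measurable_swap
    have h1 : ∫⁻ p, f p ∂ρ = ∫⁻ p, f p.swap ∂(ρ.map Prod.swap) := by
      rw [lintegral_map hfs measurable_swap]
      simp
    rw [h1]
    conv_lhs => rw [← (ρ.map Prod.swap).disintegrate (ρ.map Prod.swap).condKernel]
    rw [Measure.lintegral_compProd hfs, Measure.fst_map_swap]
    refine lintegral_congr fun z => ?_
    rw [lintegral_fintype]
    refine Finset.sum_congr rfl fun a _ => ?_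
    rw [mul_comm, posterior, ofReal_measureReal]
    rfl

end Posterior

namespace HasDensity

variable {ρ : Measure (α × 𝓩)} {ν : Measure 𝓩} {q : α → 𝓩 → ℝ} (h : HasDensity ρ ν q)
include h

lemma snd_eq : ρ.snd = ν.withDensity fun z => ENNReal.ofReal (∑ a, q a z) := by
  ext B hB
  rw [Measure.snd_apply hB, ← lintegral_indicator_one (measurable_snd hB),
    h.lintegral_eq _ (measurable_one.indicator (measurable_snd hB)), withDensity_apply _ hB,
    ← lintegral_indicator hB]
  refine lintegral_congr fun z => ?_
  by_cases hz : z ∈ B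
  · simp [Set.indicator, hz, ENNReal.ofReal_sum_of_nonneg fun a _ => h.nonneg a z]
  · simp [Set.indicator, hz]

lemma map_snd {𝓩' : Type*} [MeasurableSpace 𝓩'] {f : 𝓩 → 𝓩'} {g : 𝓩' → 𝓩} (hf : Measurable f)
    (hg : Measurable g) (hgf : Function.LeftInverse g f) :
    HasDensity (ρ.map fun p => (p.1, f p.2)) (ν.map f) fun a z => q a (g z) where
  measurable a := (h.measurable a).comp hg
  nonneg a z := h.nonneg a (g z)
  lintegral_eq F hF := by
    have hm : Measurable fun p : α × 𝓩 => (p.1, f p.2) := by fun_prop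
    rw [lintegral_map hF hm, h.lintegral_eq (fun p => F (p.1, f p.2)) (hF.comp hm),
      lintegral_map ?_ hf]
    · simp only [hgf _]
    · refine Finset.measurable_sum _ fun a _ => ?_
      exact ((h.measurable a).comp hg).ennreal_ofReal.mul (hF.comp (by fun_prop))

variable [MeasurableSingletonClass α]

lemma measure_eq [DecidableEq α] (a : α) {B : Set 𝓩} (hB : MeasurableSet B) :
    ρ ({a} ×ˢ B) = ∫⁻ z in B, ENNReal.ofReal (q a z) ∂ν := by
  have hm : MeasurableSet (({a} : Set α) ×ˢ B) := (measurableSet_singleton a).prod hB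
  rw [← lintegral_indicator_one hm, h.lintegral_eq _ (measurable_one.indicator hm),
    ← lintegral_indicator hB]
  refine lintegral_congr fun z => ?_
  by_cases hz : z ∈ B <;> simp [Set.indicator, hz]

/-- Over any measurable B both sides integrate to the mass of {a} × B, and densities with equal
finite integrals agree almost everywhere. -/
lemma ae_eq_posterior [Nonempty α] [IsFiniteMeasure ρ] (a : α) :
    ∀ᵐ z ∂ν, q a z = (∑ b, q b z) * posterior ρ a z := by
  classical
  have hs : Measurable fun z => ENNReal.ofReal (∑ b, q b z) :=
    (Finset.measurable_sum _ fun b _ => h.measurable b).ennreal_ofReal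
  have hk := hasDensity_posterior ρ
  have heq : ν.withDensity (fun z => ENNReal.ofReal (q a z)) =
      ν.withDensity ((fun z => ENNReal.ofReal (∑ b, q b z)) *
        fun z => ENNReal.ofReal (posterior ρ a z)) := by
    rw [withDensity_mul _ hs (measurable_posterior ρ a).ennreal_ofReal, ← h.snd_eq]
    ext B hB
    rw [withDensity_apply _ hB, withDensity_apply _ hB, ← h.measure_eq a hB, hk.measure_eq a hB]
  have hfin : ∫⁻ z, ENNReal.ofReal (q a z) ∂ν ≠ ⊤ := by
    have := h.measure_eq a MeasurableSet.univ
    rw [setLIntegral_univ] at this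
    rw [← this]
    exact measure_ne_top _ _
  have hae := (withDensity_eq_iff (h.measurable a).ennreal_ofReal.aemeasurable
    (hs.mul (measurable_posterior ρ a).ennreal_ofReal).aemeasurable hfin).1 heq
  filter_upwards [hae] with z hz
  have h0 : 0 ≤ ∑ b, q b z := Finset.sum_nonneg fun b _ => h.nonneg b z
  rw [Pi.mul_apply, ← ENNReal.ofReal_mul h0] at hz
  exact (ENNReal.ofReal_eq_ofReal_iff (h.nonneg a z) (mul_nonneg h0 (posterior_nonneg ρ a z))).1 hz

/-- A homogeneous functional of the posterior can be computed from any density. -/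
lemma posteriorMean_eq [Nonempty α] [IsFiniteMeasure ρ] {φ : (α → ℝ) → ℝ}
    (hφ : ∀ c : ℝ, 0 ≤ c → ∀ w, φ (fun a => c * w a) = c * φ w) :
    posteriorMean φ ρ = ∫ z, φ (fun a => q a z) ∂ν := by
  unfold posteriorMean
  have hs : Measurable fun z => (∑ b, q b z).toNNReal :=
    (Finset.measurable_sum _ fun b _ => h.measurable b).real_toNNReal
  rw [h.snd_eq]
  have := integral_withDensity_eq_integral_smul (μ := ν) hs fun z => φ fun a => posterior ρ a z
  refine this.trans (integral_congr_ae ?_)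
  filter_upwards [ae_all_iff.2 h.ae_eq_posterior] with z hz
  have h0 : 0 ≤ ∑ b, q b z := Finset.sum_nonneg fun b _ => h.nonneg b z
  have h1 : (fun a => q a z) = fun a => (∑ b, q b z) * posterior ρ a z := funext hz
  have h2 := hφ _ h0 fun a => posterior ρ a z
  rw [← h1] at h2
  rw [h2, NNReal.smul_def, Real.coe_toNNReal _ h0, smul_eq_mul]

lemma map_fst {δ : Type*} [Fintype δ] [DecidableEq δ] [MeasurableSpace δ] (g : α → δ) :
    HasDensity (ρ.map fun p => (g p.1, p.2)) ν fun b z => pushSum g (fun a => q a z) b where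
  measurable b := Finset.measurable_sum _ fun a _ => h.measurable a
  nonneg b z := pushSum_nonneg (fun a => h.nonneg a z) b
  lintegral_eq f hf := by
    have hg : Measurable fun p : α × 𝓩 => (g p.1, p.2) := by
      have : Measurable g := measurable_of_finite g
      fun_prop
    rw [lintegral_map hf hg, h.lintegral_eq (fun p => f (g p.1, p.2)) (hf.comp hg)]
    refine lintegral_congr fun z => ?_
    simp only [pushSum]
    rw [← Finset.sum_fiberwise (s := Finset.univ) (g := g)]
    refine Finset.sum_congr rfl fun b _ => ?_
    rw [ENNReal.ofReal_sum_of_nonneg fun a _ => h.nonneg a z, Finset.sum_mul]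
    refine Finset.sum_congr rfl fun a ha => ?_
    rw [(Finset.mem_filter.1 ha).2]

end HasDensity

variable [MeasurableSingletonClass α]

/-- A relabelling of the output with a measurable left inverse loses no information. This identifies
the abstract minus and plus laws with the synthetic channels. -/
lemma posteriorMean_map_snd [Nonempty α] {𝓩' : Type*} [MeasurableSpace 𝓩']
    (ρ : Measure (α × 𝓩)) [IsFiniteMeasure ρ] {f : 𝓩 → 𝓩'} {g : 𝓩' → 𝓩} (hf : Measurable f)
    (hg : Measurable g) (hgf : Function.LeftInverse g f) {φ : (α → ℝ) → ℝ}
    (hφ : ∀ c : ℝ, 0 ≤ c → ∀ w, φ (fun a => c * w a) = c * φ w)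
    (hφm : Measurable φ) :
    posteriorMean φ (ρ.map fun p => (p.1, f p.2)) = posteriorMean φ ρ := by
  have hd := hasDensity_posterior ρ
  rw [(hd.map_snd hf hg hgf).posteriorMean_eq hφ, integral_map hf.aemeasurable]
  · simp only [hgf _]
    rfl
  · refine Measurable.aestronglyMeasurable (hφm.comp (measurable_pi_lambda _ fun a => ?_))
    exact (measurable_posterior ρ a).comp hg

lemma posteriorMean_map_fst {δ : Type*} [Fintype δ] [DecidableEq δ] [MeasurableSpace δ]
    [MeasurableSingletonClass δ] [Nonempty α] [Nonempty δ] (ρ : Measure (α × 𝓩)) [IsFiniteMeasure ρ]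
    (g : α → δ) {φ : (δ → ℝ) → ℝ}
    (hφ : ∀ c : ℝ, 0 ≤ c → ∀ w, φ (fun a => c * w a) = c * φ w) :
    posteriorMean φ (ρ.map fun p => (g p.1, p.2)) =
      posteriorMean (fun w => φ (pushSum g w)) ρ := by
  rw [((hasDensity_posterior ρ).map_fst g).posteriorMean_eq hφ]
  rfl

lemma posterior_le_one [Nonempty α] (ρ : Measure (α × 𝓩)) [IsFiniteMeasure ρ] (a : α) (z : 𝓩) :
    posterior ρ a z ≤ 1 :=
  le_one_of_sum_eq_one (fun a => posterior_nonneg ρ a z) (sum_posterior ρ z) a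

lemma integrable_posterior [Nonempty α] (ρ : Measure (α × 𝓩)) [IsFiniteMeasure ρ] (a : α) :
    Integrable (posterior ρ a) ρ.snd :=
  Integrable.of_bound (measurable_posterior ρ a).aestronglyMeasurable 1 (ae_of_all _ fun z => by
    rw [Real.norm_of_nonneg (posterior_nonneg ρ a z)]
    exact posterior_le_one ρ a z)

lemma integrable_entropyFn_posterior {δ : Type*} [Fintype δ] [DecidableEq δ] [Nonempty α] (ρ : Measure (α × 𝓩))
    [IsFiniteMeasure ρ] (g : α → δ) :
    Integrable (fun z => entropyFn (pushSum g fun a => posterior ρ a z)) ρ.snd := by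
  refine Integrable.of_bound (C := Fintype.card δ + 1) (Measurable.aestronglyMeasurable ?_)
    (ae_of_all _ fun z => ?_)
  · refine measurable_entropyFn.comp (measurable_pi_lambda _ fun b => ?_)
    exact Finset.measurable_sum _ fun a _ => measurable_posterior ρ a
  · exact abs_entropyFn_le (pushSum_nonneg fun a => posterior_nonneg ρ a z)
      (by rw [sum_pushSum, sum_posterior])

lemma integral_posterior [Nonempty α] (ρ : Measure (α × 𝓩)) [IsFiniteMeasure ρ] (a : α) :
    ∫ z, posterior ρ a z ∂ρ.snd = ρ.fst.real {a} := by
  classical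
  rw [integral_eq_lintegral_of_nonneg_ae (ae_of_all _ fun z => posterior_nonneg ρ a z)
    (measurable_posterior ρ a).aestronglyMeasurable, measureReal_def,
    Measure.fst_apply (measurableSet_singleton a)]
  have := (hasDensity_posterior ρ).measure_eq a MeasurableSet.univ
  rw [setLIntegral_univ] at this
  rw [← this]
  congr 2
  ext p; simp

/-- The mutual information is the entropy minus the mean entropy of the posterior. -/
theorem mutualInfo_mul_log_two [Nonempty α] (ρ : Measure (α × 𝓩)) [IsProbabilityMeasure ρ] :
    mutualInfo ρ * Real.log 2 =
      ∑ a, Real.negMulLog (ρ.fst.real {a}) - posteriorMean entropyFn ρ := by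
  have hlog : Real.log 2 ≠ 0 := (Real.log_pos (by norm_num)).ne'
  rw [mutualInfo, div_mul_cancel₀ _ hlog]
  set P : α → ℝ := fun a => ρ.fst.real {a} with hP
  set κ := posterior ρ with hκ
  have hP0 : ∀ a, 0 ≤ P a := fun a => measureReal_nonneg
  have hκ0 : ∀ a z, 0 ≤ κ a z := posterior_nonneg ρ
  have hκm : ∀ a, Measurable (κ a) := measurable_posterior ρ
  have hint : ∀ a, ∫ z, κ a z ∂ρ.snd = P a := integral_posterior ρ
  have hzero : ∀ a, P a = 0 → ∀ᵐ z ∂ρ.snd, κ a z = 0 := by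
    intro a ha
    have := (integral_eq_zero_iff_of_nonneg (hκ0 a) (integrable_posterior ρ a)).1
      ((hint a).trans ha)
    filter_upwards [this] with z hz using hz
  set G : α × 𝓩 → ENNReal := fun p => ENNReal.ofReal (κ p.1 p.2 / P p.1) with hG
  have hκm2 : Measurable fun p : α × 𝓩 => κ p.1 p.2 :=
    measurable_from_prod_countable_right fun a => hκm a
  have hPm : Measurable fun p : α × 𝓩 => P p.1 := (measurable_of_finite P).comp measurable_fst
  have hGm : Measurable G := (hκm2.div hPm).ennreal_ofReal
  -- The density is posterior over prior. Where the prior vanishes the posterior vanishes almost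
  -- everywhere, so the convention 0/0 = 0 is harmless.
  have hρ : ρ = (ρ.fst.prod ρ.snd).withDensity G := by
    refine Measure.ext_of_lintegral _ fun f hf => ?_
    rw [(hasDensity_posterior ρ).lintegral_eq f hf, lintegral_withDensity_eq_lintegral_mul _ hGm hf,
      lintegral_prod_symm' _ (hGm.mul hf)]
    refine lintegral_congr_ae ?_
    have : ∀ a, ∀ᵐ z ∂ρ.snd, P a = 0 → κ a z = 0 := by
      intro a
      by_cases ha : P a = 0
      · filter_upwards [hzero a ha] with z hz _ using hz
      · exact ae_of_all _ fun z h => absurd h ha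
    filter_upwards [ae_all_iff.2 this] with z hz
    rw [lintegral_fintype]
    refine Finset.sum_congr rfl fun a _ => ?_
    have hPa : ρ.fst {a} = ENNReal.ofReal (P a) := (ofReal_measureReal).symm
    rw [hPa, Pi.mul_apply, mul_right_comm, hG, ← ENNReal.ofReal_mul (div_nonneg (hκ0 a z) (hP0 a))]
    congr 2
    by_cases ha : P a = 0
    · simp only [ha, mul_zero]; exact hz a ha
    · field_simp; rfl
  have hac : ρ ≪ ρ.fst.prod ρ.snd := by
    conv_lhs => rw [hρ]
    exact withDensity_absolutelyContinuous _ _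
  rw [InformationTheory.toReal_klDiv_eq_integral_klFun hac]
  have hrn : ρ.rnDeriv (ρ.fst.prod ρ.snd) =ᵐ[ρ.fst.prod ρ.snd] G := by
    conv_lhs => rw [hρ]
    have := Measure.rnDeriv_withDensity (ρ.fst.prod ρ.snd) hGm
    rw [← hρ] at this ⊢
    exact this
  have hint1 : ∫ p, InformationTheory.klFun ((ρ.rnDeriv (ρ.fst.prod ρ.snd)) p).toReal
      ∂(ρ.fst.prod ρ.snd) =
      ∫ p, InformationTheory.klFun (κ p.1 p.2 / P p.1) ∂(ρ.fst.prod ρ.snd) := by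
    refine integral_congr_ae ?_
    filter_upwards [hrn] with p hp
    rw [hp, hG, ENNReal.toReal_ofReal (div_nonneg (hκ0 _ _) (hP0 _))]
  have hklm : Measurable fun p : α × 𝓩 => InformationTheory.klFun (κ p.1 p.2 / P p.1) :=
    InformationTheory.measurable_klFun.comp (hκm2.div hPm)
  -- The posterior is at most 1 and the prior takes finitely many values, so the ratio stays in a
  -- compact interval. Boundedness is what Fubini needs.
  have hbound : ∃ C, ∀ p : α × 𝓩, ‖InformationTheory.klFun (κ p.1 p.2 / P p.1)‖ ≤ C := by
    obtain ⟨C, hC⟩ : ∃ C, ∀ x ∈ Set.Icc (0 : ℝ) (∑ a, 1 / P a),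
        ‖InformationTheory.klFun x‖ ≤ C :=
      isCompact_Icc.exists_bound_of_continuousOn
        InformationTheory.continuous_klFun.continuousOn
    refine ⟨C, fun p => hC _ ⟨div_nonneg (hκ0 _ _) (hP0 _), ?_⟩⟩
    refine le_trans ?_ (Finset.single_le_sum (f := fun a => 1 / P a)
      (fun a _ => div_nonneg zero_le_one (hP0 a)) (Finset.mem_univ p.1))
    exact div_le_div_of_nonneg_right (posterior_le_one ρ _ _) (hP0 _)
  obtain ⟨C, hC⟩ := hbound
  rw [hint1, integral_prod _ (Integrable.of_bound hklm.aestronglyMeasurable C (ae_of_all _ hC)),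
    integral_fintype (Integrable.of_finite)]
  have hnm : ∀ a, Integrable (fun z => Real.negMulLog (κ a z)) ρ.snd := by
    intro a
    refine Integrable.of_bound (C := 1)
      (Real.continuous_negMulLog.measurable.comp (hκm a)).aestronglyMeasurable
      (ae_of_all _ fun z => ?_)
    rw [Real.norm_of_nonneg (Real.negMulLog_nonneg (hκ0 a z) (posterior_le_one ρ a z))]
    have := Real.negMulLog_le_one_sub_self (hκ0 a z)
    linarith [hκ0 a z]
  have hterm : ∀ a, P a • ∫ z, InformationTheory.klFun (κ a z / P a) ∂ρ.snd =
      Real.negMulLog (P a) - ∫ z, Real.negMulLog (κ a z) ∂ρ.snd := by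
    intro a
    by_cases ha : P a = 0
    · have : ∫ z, Real.negMulLog (κ a z) ∂ρ.snd = 0 := by
        rw [← integral_zero 𝓩 ℝ (μ := ρ.snd)]
        refine integral_congr_ae ?_
        filter_upwards [hzero a ha] with z hz
        simp [hz]
      rw [this, ha]; simp
    · rw [smul_eq_mul, ← integral_const_mul]
      have hpt : ∀ z, P a * InformationTheory.klFun (κ a z / P a) =
          (P a - Real.negMulLog (κ a z)) - (Real.log (P a) + 1) * κ a z := by
        intro z
        rw [InformationTheory.klFun, Real.negMulLog]
        rcases (hκ0 a z).eq_or_lt with h | h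
        · simp [← h]
        · rw [Real.log_div h.ne' ha]
          field_simp
          ring
      simp only [hpt]
      have hsub : Integrable (fun z => P a - Real.negMulLog (κ a z)) ρ.snd :=
        (integrable_const _).sub (hnm a)
      rw [integral_sub hsub ((integrable_posterior ρ a).const_mul _), integral_sub (integrable_const _) (hnm a),
        integral_const_mul, hint, integral_const]
      simp [Real.negMulLog]
      ring
  calc _ = ∑ a, (Real.negMulLog (P a) - ∫ z, Real.negMulLog (κ a z) ∂ρ.snd) :=
        Finset.sum_congr rfl fun a _ => hterm a
    _ = _ := by
        rw [Finset.sum_sub_distrib, ← integral_finsetSum _ fun a _ => hnm a]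
        congr 1
        refine integral_congr_ae (ae_of_all _ fun z => ?_)
        exact (entropyFn_of_sum_eq_one (sum_posterior ρ z)).symm

end Density

/-! ### The polar transform of a joint law -/

/-- The chain rule for the entropy. -/
lemma sum_entropyFn_split {α δ κ : Type*} [Fintype α] [Fintype δ] [Fintype κ] [DecidableEq κ]
    (e : α ≃ δ × κ) (w : α → ℝ) :
    ∑ c, entropyFn (fun b => w (e.symm (b, c))) =
      entropyFn w - entropyFn (pushSum (fun a => (e a).2) w) := by
  have h1 : ∀ c, pushSum (fun a => (e a).2) w c = ∑ b, w (e.symm (b, c)) := by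
    intro c
    rw [pushSum, Finset.sum_filter, ← e.symm.sum_comp, Fintype.sum_prod_type]
    simp
  have h3 : ∑ c, ∑ b, w (e.symm (b, c)) = ∑ a, w a := by
    rw [← e.symm.sum_comp, Fintype.sum_prod_type_right]
  simp only [entropyFn, Finset.sum_sub_distrib, h1, h3]
  have h2 : ∑ a, Real.negMulLog (w a) = ∑ c, ∑ b, Real.negMulLog (w (e.symm (b, c))) := by
    rw [← e.symm.sum_comp, Fintype.sum_prod_type_right]
  rw [h2]
  ring

/-! ### Moving a component of the input to the output. -/

section Split

variable {α δ κ 𝓩 : Type*} [Fintype α] [MeasurableSpace α] [MeasurableSingletonClass α]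
  [MeasurableSpace δ] [MeasurableSpace κ] [MeasurableSpace 𝓩]

/-- Move one component of the first variable of a joint law to the second variable. -/
def splitLaw (e : α ≃ δ × κ) (ρ : Measure (α × 𝓩)) : Measure (δ × (𝓩 × κ)) :=
  ρ.map fun p => ((e p.1).1, (p.2, (e p.1).2))

lemma measurable_splitLaw_map (e : α ≃ δ × κ) :
    Measurable fun p : α × 𝓩 => ((e p.1).1, (p.2, (e p.1).2)) := by
  have h1 : Measurable fun x => (e x).1 := measurable_of_finite _
  have h2 : Measurable fun x => (e x).2 := measurable_of_finite _
  fun_prop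

instance isProbabilityMeasure_splitLaw (e : α ≃ δ × κ) (ρ : Measure (α × 𝓩))
    [IsProbabilityMeasure ρ] : IsProbabilityMeasure (splitLaw e ρ) :=
  Measure.isProbabilityMeasure_map (measurable_splitLaw_map e).aemeasurable

variable [Fintype δ] [Fintype κ] [MeasurableSingletonClass κ]

lemma HasDensity.splitLaw {ρ : Measure (α × 𝓩)} {ν : Measure 𝓩} [SFinite ν] {q : α → 𝓩 → ℝ}
    (h : HasDensity ρ ν q) (e : α ≃ δ × κ) :
    HasDensity (splitLaw e ρ) (ν.prod Measure.count) fun b zc => q (e.symm (b, zc.2)) zc.1 where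
  measurable b := measurable_from_prod_countable_left fun c => h.measurable (e.symm (b, c))
  nonneg b zc := h.nonneg _ _
  lintegral_eq f hf := by
    have hm := measurable_splitLaw_map (𝓩 := 𝓩) e
    have hmeas : Measurable fun zc : 𝓩 × κ => ∑ b, ENNReal.ofReal (q (e.symm (b, zc.2)) zc.1) *
        f (b, zc) := by
      refine Finset.measurable_sum _ fun b _ => Measurable.mul ?_ (by fun_prop)
      exact (measurable_from_prod_countable_left fun c =>
        h.measurable (e.symm (b, c))).ennreal_ofReal
    rw [PolarMAC.splitLaw, lintegral_map hf hm,
      h.lintegral_eq (fun p => f ((e p.1).1, (p.2, (e p.1).2))) (hf.comp hm),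
      lintegral_prod _ hmeas.aemeasurable]
    refine lintegral_congr fun z => ?_
    rw [lintegral_count, tsum_fintype, ← e.symm.sum_comp, Fintype.sum_prod_type_right]
    simp

variable [MeasurableSingletonClass δ]

/-- The values of the moved component index slices of the posterior. They need no normalization: by
homogeneity their masses act as the conditional probabilities. The bound C serves only Fubini. -/
lemma posteriorMean_splitLaw_eq [Nonempty α] [Nonempty δ] (ρ : Measure (α × 𝓩))
    [IsProbabilityMeasure ρ] (e : α ≃ δ × κ) {φ : (δ → ℝ) → ℝ} (hφm : Measurable φ)
    (hφ : ∀ c : ℝ, 0 ≤ c → ∀ w, φ (fun a => c * w a) = c * φ w) {C : ℝ}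
    (hC : ∀ w : δ → ℝ, (∀ b, 0 ≤ w b) → ∑ b, w b ≤ 1 → |φ w| ≤ C) :
    posteriorMean φ (splitLaw e ρ) =
      ∫ z, ∑ c, φ (fun b => posterior ρ (e.symm (b, c)) z) ∂ρ.snd := by
  rw [((hasDensity_posterior ρ).splitLaw e).posteriorMean_eq hφ, integral_prod]
  · simp only [integral_count]
  · refine Integrable.of_bound (C := C) (Measurable.aestronglyMeasurable ?_)
      (ae_of_all _ fun zc => hC _ (fun b => posterior_nonneg ρ _ _) ?_)
    · refine hφm.comp (measurable_pi_lambda _ fun b => ?_)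
      exact measurable_from_prod_countable_left fun c => measurable_posterior ρ (e.symm (b, c))
    · calc ∑ b, posterior ρ (e.symm (b, zc.2)) zc.1
          ≤ ∑ c, ∑ b, posterior ρ (e.symm (b, c)) zc.1 :=
            Finset.single_le_sum (f := fun c => ∑ b, posterior ρ (e.symm (b, c)) zc.1)
              (fun c _ => Finset.sum_nonneg fun b _ => posterior_nonneg ρ _ _)
              (Finset.mem_univ zc.2)
        _ = ∑ a, posterior ρ a zc.1 := by
            rw [← e.symm.sum_comp, Fintype.sum_prod_type_right]
        _ ≤ 1 := (sum_posterior ρ _).le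

lemma posteriorMean_entropyFn_splitLaw [DecidableEq κ] [Nonempty α] [Nonempty δ] [Nonempty κ]
    (ρ : Measure (α × 𝓩)) [IsProbabilityMeasure ρ] (e : α ≃ δ × κ) :
    posteriorMean entropyFn (splitLaw e ρ) = posteriorMean entropyFn ρ -
      posteriorMean entropyFn (ρ.map fun p => ((e p.1).2, p.2)) := by
  classical
  rw [posteriorMean_splitLaw_eq ρ e measurable_entropyFn (fun c _ w => entropyFn_const_mul)
    (C := Fintype.card δ + 1) fun w h0 h1 => abs_entropyFn_le h0 h1,
    posteriorMean_map_fst ρ (fun a => (e a).2) fun c _ w => entropyFn_const_mul]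
  refine (integral_congr_ae (ae_of_all _ fun z =>
    sum_entropyFn_split e fun a => posterior ρ a z)).trans ?_
  exact integral_sub (by simpa using integrable_entropyFn_posterior ρ (id : α → α))
    (integrable_entropyFn_posterior ρ _)

end Split

/-! ### Two independent copies of a joint law. -/

section Pair

variable {α 𝓩 : Type*} [Fintype α] [MeasurableSpace α] [MeasurableSingletonClass α]
  [MeasurableSpace 𝓩]

/-- The law of two independent copies. -/
def pairLaw (ρ : Measure (α × 𝓩)) : Measure ((α × α) × (𝓩 × 𝓩)) :=
  (ρ.prod ρ).map fun p => ((p.1.1, p.2.1), (p.1.2, p.2.2))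

instance isProbabilityMeasure_pairLaw (ρ : Measure (α × 𝓩)) [IsProbabilityMeasure ρ] :
    IsProbabilityMeasure (pairLaw ρ) :=
  Measure.isProbabilityMeasure_map (by fun_prop)

omit [MeasurableSingletonClass α] in
lemma HasDensity.pairLaw [Finite α] [MeasurableSingletonClass α] {ρ : Measure (α × 𝓩)} [SFinite ρ]
    {ν : Measure 𝓩} [SFinite ν] {q : α → 𝓩 → ℝ} (h : HasDensity ρ ν q) :
    HasDensity (pairLaw ρ) (ν.prod ν) fun x z => q x.1 z.1 * q x.2 z.2 where
  measurable x := ((h.measurable x.1).comp measurable_fst).mul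
    ((h.measurable x.2).comp measurable_snd)
  nonneg x z := mul_nonneg (h.nonneg _ _) (h.nonneg _ _)
  lintegral_eq f hf := by
    have hq : ∀ a, Measurable fun z => ENNReal.ofReal (q a z) :=
      fun a => (h.measurable a).ennreal_ofReal
    have hF : Measurable fun p : (α × 𝓩) × (α × 𝓩) => f ((p.1.1, p.2.1), (p.1.2, p.2.2)) := by
      fun_prop
    have hq1 : ∀ a, Measurable fun z : 𝓩 × 𝓩 => ENNReal.ofReal (q a z.1) :=
      fun a => (hq a).comp measurable_fst
    have hq2 : ∀ a, Measurable fun z : 𝓩 × 𝓩 => ENNReal.ofReal (q a z.2) :=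
      fun a => (hq a).comp measurable_snd
    have hinner : ∀ x z, ∫⁻ p', f ((x, p'.1), (z, p'.2)) ∂ρ =
        ∫⁻ z', ∑ x', ENNReal.ofReal (q x' z') * f ((x, x'), (z, z')) ∂ν := fun x z =>
      h.lintegral_eq (fun p' => f ((x, p'.1), (z, p'.2))) (by fun_prop)
    have houter : Measurable fun p : α × 𝓩 => ∫⁻ p', f ((p.1, p'.1), (p.2, p'.2)) ∂ρ :=
      hF.lintegral_prod_right'
    rw [PolarMAC.pairLaw, lintegral_map hf (by fun_prop), lintegral_prod _ hF.aemeasurable,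
      h.lintegral_eq (fun p => ∫⁻ p', f ((p.1, p'.1), (p.2, p'.2)) ∂ρ) houter,
      lintegral_prod _ (Measurable.aemeasurable ?_)]
    · refine lintegral_congr fun z => ?_
      simp only [hinner]
      have hmeas : ∀ x, Measurable fun z' => ∑ x', ENNReal.ofReal (q x' z') *
          f ((x, x'), (z, z')) := fun x =>
        Finset.measurable_sum _ fun x' _ => (hq x').mul (by fun_prop)
      simp only [← lintegral_const_mul _ (hmeas _)]
      rw [← lintegral_finsetSum _ fun x _ => (hmeas x).const_mul _]
      refine lintegral_congr fun z' => ?_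
      rw [Fintype.sum_prod_type]
      refine Finset.sum_congr rfl fun x _ => ?_
      rw [Finset.mul_sum]
      refine Finset.sum_congr rfl fun x' _ => ?_
      rw [ENNReal.ofReal_mul (h.nonneg _ _), mul_assoc]
    · refine Finset.measurable_sum _ fun x _ => Measurable.mul ?_ (by fun_prop)
      exact (((h.measurable x.1).comp measurable_fst).mul
        ((h.measurable x.2).comp measurable_snd)).ennreal_ofReal

lemma sum_product_weights {α : Type*} [Fintype α] {p p' : α → ℝ} :
    ∑ x : α × α, p x.1 * p' x.2 = (∑ x, p x) * ∑ x, p' x := by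
  rw [Fintype.sum_prod_type, Finset.sum_mul_sum]

lemma entropyFn_product {α : Type*} [Fintype α] {p p' : α → ℝ} (h1 : ∑ x, p x = 1) (h1' : ∑ x, p' x = 1) :
    entropyFn (fun x : α × α => p x.1 * p' x.2) = entropyFn p + entropyFn p' := by
  rw [entropyFn_of_sum_eq_one h1, entropyFn_of_sum_eq_one h1',
    entropyFn_of_sum_eq_one (by rw [sum_product_weights, h1, h1', one_mul])]
  simp only [Real.negMulLog_mul, Fintype.sum_prod_type, Finset.sum_add_distrib, ← Finset.mul_sum,
    ← Finset.sum_mul, h1, h1', one_mul]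

lemma posteriorMean_entropyFn_pairLaw [Nonempty α] (ρ : Measure (α × 𝓩))
    [IsProbabilityMeasure ρ] :
    posteriorMean entropyFn (pairLaw ρ) = 2 * posteriorMean entropyFn ρ := by
  classical
  have hint : Integrable (fun z => entropyFn fun a => posterior ρ a z) ρ.snd := by
    simpa using integrable_entropyFn_posterior ρ (id : α → α)
  rw [(hasDensity_posterior ρ).pairLaw.posteriorMean_eq fun c _ w => entropyFn_const_mul]
  simp only [entropyFn_product (sum_posterior ρ _) (sum_posterior ρ _)]
  rw [integral_add (hint.comp_fst _) (hint.comp_snd _),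
    integral_fun_fst (f := fun z => entropyFn fun a => posterior ρ a z),
    integral_fun_snd (f := fun z => entropyFn fun a => posterior ρ a z)]
  simp [posteriorMean, two_mul]

end Pair

/-! ### One step of the polar transform: conservation of entropy and the Bhattacharyya bounds. -/

section Polar

variable {ι 𝓩 : Type*} [Fintype ι] [DecidableEq ι] [MeasurableSpace 𝓩]

/-- The pair `(x₀, x₁)` is equivalent to `(x₁, x₀ + x₁)`. -/
def plusEquiv (ι : Type*) :
    ((ι → ZMod 2) × (ι → ZMod 2)) ≃ ((ι → ZMod 2) × (ι → ZMod 2)) where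
  toFun p := (p.2, p.1 + p.2)
  invFun p := (p.2 - p.1, p.1)
  left_inv p := by simp
  right_inv p := by simp

/-- The law of the first input of the polar transform and of the outputs. -/
def minusLaw (ρ : Measure ((ι → ZMod 2) × 𝓩)) : Measure ((ι → ZMod 2) × (𝓩 × 𝓩)) :=
  (pairLaw ρ).map fun p => (p.1.1 + p.1.2, p.2)

/-- The law of the second input of the polar transform and of the outputs and the first input. -/
def plusLaw (ρ : Measure ((ι → ZMod 2) × 𝓩)) :
    Measure ((ι → ZMod 2) × ((𝓩 × 𝓩) × (ι → ZMod 2))) :=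
  splitLaw (plusEquiv ι) (pairLaw ρ)

instance isProbabilityMeasure_minusLaw (ρ : Measure ((ι → ZMod 2) × 𝓩)) [IsProbabilityMeasure ρ] :
    IsProbabilityMeasure (minusLaw ρ) := by
  refine Measure.isProbabilityMeasure_map (Measurable.aemeasurable ?_)
  have : Measurable fun x : (ι → ZMod 2) × (ι → ZMod 2) => x.1 + x.2 := measurable_of_finite _
  fun_prop

instance isProbabilityMeasure_plusLaw (ρ : Measure ((ι → ZMod 2) × 𝓩)) [IsProbabilityMeasure ρ] :
    IsProbabilityMeasure (plusLaw ρ) := isProbabilityMeasure_splitLaw _ _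

/-- Chain rule for a bijective image of two independent copies: the plus law conditions on exactly
the component that the minus law keeps. -/
lemma posteriorMean_entropyFn_minusLaw_add_plusLaw (ρ : Measure ((ι → ZMod 2) × 𝓩))
    [IsProbabilityMeasure ρ] :
    posteriorMean entropyFn (minusLaw ρ) + posteriorMean entropyFn (plusLaw ρ) =
      2 * posteriorMean entropyFn ρ := by
  unfold plusLaw
  rw [posteriorMean_entropyFn_splitLaw, posteriorMean_entropyFn_pairLaw]
  exact add_sub_cancel _ _

lemma bhattFn_le_sum {q : (ι → ZMod 2) → ℝ} (a : ι → ZMod 2) (h0 : ∀ x, 0 ≤ q x) :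
    bhattFn a q ≤ ∑ x, q x := by
  rw [← sum_pushSum (fun x => a ⬝ᵥ x) q, sum_zmod_two, bhattFn]
  set u := pushSum (fun x => a ⬝ᵥ x) q 0
  set v := pushSum (fun x => a ⬝ᵥ x) q 1
  have hu : 0 ≤ u := pushSum_nonneg h0 _
  have hv : 0 ≤ v := pushSum_nonneg h0 _
  have : √(u * v) ≤ (u + v) / 2 := Real.sqrt_le_iff.2 ⟨by positivity,
    by nlinarith [sq_nonneg (u - v)]⟩
  linarith

lemma measurable_bhattFn (a : ι → ZMod 2) : Measurable (bhattFn a) := by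
  unfold bhattFn pushSum
  fun_prop

/-- The mean Bhattacharyya parameter of the linear form `a`. -/
def bhatt (a : ι → ZMod 2) (ρ : Measure ((ι → ZMod 2) × 𝓩)) [IsFiniteMeasure ρ] : ℝ :=
  posteriorMean (bhattFn a) ρ

lemma integrable_bhattFn_posterior (a : ι → ZMod 2) (ρ : Measure ((ι → ZMod 2) × 𝓩))
    [IsProbabilityMeasure ρ] : Integrable (fun z => bhattFn a fun x => posterior ρ x z) ρ.snd := by
  refine Integrable.of_bound (C := 1) (Measurable.aestronglyMeasurable ?_) (ae_of_all _ fun z => ?_)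
  · exact (measurable_bhattFn a).comp (measurable_pi_lambda _ fun x => measurable_posterior ρ x)
  · rw [Real.norm_of_nonneg (bhattFn_nonneg _ _)]
    exact bhattFn_le_one a (fun x => posterior_nonneg ρ x z) (sum_posterior ρ z)

lemma bhatt_nonneg (a : ι → ZMod 2) (ρ : Measure ((ι → ZMod 2) × 𝓩)) [IsProbabilityMeasure ρ] :
    0 ≤ bhatt a ρ := integral_nonneg fun _ => bhattFn_nonneg _ _

lemma bhatt_le_one (a : ι → ZMod 2) (ρ : Measure ((ι → ZMod 2) × 𝓩)) [IsProbabilityMeasure ρ] :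
    bhatt a ρ ≤ 1 := by
  calc bhatt a ρ ≤ ∫ _, (1 : ℝ) ∂ρ.snd :=
        integral_mono (integrable_bhattFn_posterior a ρ) (integrable_const _) fun z =>
          bhattFn_le_one a (fun x => posterior_nonneg ρ x z) (sum_posterior ρ z)
    _ = 1 := by simp

lemma pushSum_add_product (a : ι → ZMod 2) (p p' : (ι → ZMod 2) → ℝ) (b : ZMod 2) :
    pushSum (fun x => a ⬝ᵥ x) (pushSum (fun x : (ι → ZMod 2) × (ι → ZMod 2) => x.1 + x.2)
      fun x => p x.1 * p' x.2) b =
      pushSum (fun x => a ⬝ᵥ x) p 0 * pushSum (fun x => a ⬝ᵥ x) p' b +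
        pushSum (fun x => a ⬝ᵥ x) p 1 * pushSum (fun x => a ⬝ᵥ x) p' (b + 1) := by
  have hb : ∀ u b : ZMod 2, 1 + u = b ↔ u = b + 1 := by decide
  have key : ∀ f : ZMod 2 → ℝ, ∑ x, p x * f (a ⬝ᵥ x) =
      pushSum (fun x => a ⬝ᵥ x) p 0 * f 0 + pushSum (fun x => a ⬝ᵥ x) p 1 * f 1 := by
    intro f
    rw [← sum_pushSum_mul (fun x => a ⬝ᵥ x) p f, sum_zmod_two]
  rw [pushSum_comp]
  simp only [dotProduct_add]
  rw [pushSum, Finset.sum_filter, Fintype.sum_prod_type]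
  have h1 : ∀ x : ι → ZMod 2, (∑ y, if a ⬝ᵥ x + a ⬝ᵥ y = b then p x * p' y else 0) =
      p x * ∑ y, if a ⬝ᵥ x + a ⬝ᵥ y = b then p' y else 0 := by
    intro x
    rw [Finset.mul_sum]
    exact Finset.sum_congr rfl fun y _ => by split_ifs <;> simp
  simp only [h1]
  rw [key fun u => ∑ y, if u + a ⬝ᵥ y = b then p' y else 0]
  simp only [zero_add, hb, pushSum, Finset.sum_filter]

/-- Fourier coefficients multiply under convolution, so 1 − Z² is multiplicative and the new Z² is
Z² + Z'² − Z²Z'². This falls short of (Z + Z' − ZZ')² by 2ZZ'(1 − Z)(1 − Z') ≥ 0. -/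
lemma bhattFn_minus_le (a : ι → ZMod 2) {p p' : (ι → ZMod 2) → ℝ} (h0 : ∀ x, 0 ≤ p x)
    (h1 : ∑ x, p x = 1) (h0' : ∀ x, 0 ≤ p' x) (h1' : ∑ x, p' x = 1) :
    bhattFn a (pushSum (fun x : (ι → ZMod 2) × (ι → ZMod 2) => x.1 + x.2)
      fun x => p x.1 * p' x.2) ≤ bhattFn a p + bhattFn a p' - bhattFn a p * bhattFn a p' := by
  have hb0 := bhattFn_nonneg a p
  have hb0' := bhattFn_nonneg a p'
  have hb1 := bhattFn_le_one a h0 h1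
  have hb1' := bhattFn_le_one a h0' h1'
  have hp := bhattFn_sq a h0 h1
  have hp' := bhattFn_sq a h0' h1'
  rw [fourierFn_eq] at hp hp'
  rw [← sum_pushSum (fun x => a ⬝ᵥ x), sum_zmod_two] at h1 h1'
  have e1 : (1 : ZMod 2) + 1 = 0 := by decide
  have hsq : bhattFn a (pushSum (fun x : (ι → ZMod 2) × (ι → ZMod 2) => x.1 + x.2)
      fun x => p x.1 * p' x.2) ^ 2 =
      bhattFn a p ^ 2 + bhattFn a p' ^ 2 - bhattFn a p ^ 2 * bhattFn a p' ^ 2 := by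
    rw [hp, hp']
    unfold bhattFn
    rw [pushSum_add_product, pushSum_add_product, zero_add, e1]
    set u := pushSum (fun x => a ⬝ᵥ x) p 0
    set v := pushSum (fun x => a ⬝ᵥ x) p 1
    set u' := pushSum (fun x => a ⬝ᵥ x) p' 0
    set v' := pushSum (fun x => a ⬝ᵥ x) p' 1
    have hu : 0 ≤ u := pushSum_nonneg h0 _
    have hv : 0 ≤ v := pushSum_nonneg h0 _
    have hu' : 0 ≤ u' := pushSum_nonneg h0' _
    have hv' : 0 ≤ v' := pushSum_nonneg h0' _
    rw [mul_pow, Real.sq_sqrt (by positivity)]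
    clear_value u v u' v'
    clear hp hp'
    obtain rfl : v = 1 - u := by linarith
    obtain rfl : v' = 1 - u' := by linarith
    ring
  refine abs_le_of_sq_le_sq' (a := bhattFn a (pushSum
    (fun x : (ι → ZMod 2) × (ι → ZMod 2) => x.1 + x.2) fun x => p x.1 * p' x.2)) ?_ ?_ |>.2
  · rw [hsq]
    have := mul_nonneg (mul_nonneg hb0 hb0') (mul_nonneg (sub_nonneg.2 hb1) (sub_nonneg.2 hb1'))
    nlinarith
  · nlinarith

/-- If only the value of a on the sum s were known, this would be the single-user identity. Knowing
all of s refines it, and Cauchy–Schwarz over the s with a common value of a shows that refinement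
does not increase the parameter. -/
lemma sum_bhattFn_plus_le (a : ι → ZMod 2) {p p' : (ι → ZMod 2) → ℝ} (h0 : ∀ x, 0 ≤ p x)
    (h0' : ∀ x, 0 ≤ p' x) :
    ∑ s, bhattFn a (fun x => p (s - x) * p' x) ≤ bhattFn a p * bhattFn a p' := by
  set P := pushSum (fun x => a ⬝ᵥ x) p with hP
  set P' := pushSum (fun x => a ⬝ᵥ x) p' with hP'
  have hP0 : ∀ b, 0 ≤ P b := pushSum_nonneg h0
  have hP0' : ∀ b, 0 ≤ P' b := pushSum_nonneg h0'
  set S : (ι → ZMod 2) → ZMod 2 → ℝ := fun s b =>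
    pushSum (fun x => a ⬝ᵥ x) (fun x => p (s - x) * p' x) b with hS
  have hS0 : ∀ s b, 0 ≤ S s b := fun s b =>
    pushSum_nonneg (fun x => mul_nonneg (h0 _) (h0' _)) b
  -- For fixed x with a·x = b, as s runs over a·s = t the difference s − x runs over all y with a·y
  -- = t − b.
  have hfib : ∀ t b, ∑ s with a ⬝ᵥ s = t, S s b = P (t - b) * P' b := by
    intro t b
    simp only [hS, pushSum]
    rw [Finset.sum_comm, hP', pushSum, Finset.mul_sum]
    refine Finset.sum_congr rfl fun x hx => ?_
    rw [← Finset.sum_mul, hP, pushSum, Finset.sum_filter, Finset.sum_filter,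
      ← Equiv.sum_comp (Equiv.addRight x)]
    simp only [Equiv.coe_addRight, dotProduct_add, (Finset.mem_filter.1 hx).2,
      add_sub_cancel_right, eq_sub_iff_add_eq]
  have hCS : ∀ t, ∑ s with a ⬝ᵥ s = t, √(S s 0 * S s 1) ≤ √(P 0 * P 1 * (P' 0 * P' 1)) := by
    intro t
    calc ∑ s with a ⬝ᵥ s = t, √(S s 0 * S s 1)
        = ∑ s with a ⬝ᵥ s = t, √(S s 0) * √(S s 1) :=
          Finset.sum_congr rfl fun s _ => Real.sqrt_mul (hS0 s 0) _
      _ ≤ √(∑ s with a ⬝ᵥ s = t, S s 0) * √(∑ s with a ⬝ᵥ s = t, S s 1) :=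
          Real.sum_sqrt_mul_sqrt_le _ (fun s => hS0 s 0) (fun s => hS0 s 1)
      _ = √(P 0 * P 1 * (P' 0 * P' 1)) := by
          rw [hfib, hfib, ← Real.sqrt_mul (mul_nonneg (hP0 _) (hP0' _))]
          have ht : t = 0 ∨ t = 1 := by revert t; decide
          have e1 : (0 : ZMod 2) - 1 = 1 := by decide
          rcases ht with rfl | rfl
          · rw [sub_zero, e1]; congr 1; ring
          · rw [sub_zero, sub_self]; congr 1; ring
  calc ∑ s, bhattFn a (fun x => p (s - x) * p' x) = 2 * ∑ s, √(S s 0 * S s 1) := by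
        rw [Finset.mul_sum]; rfl
    _ = 2 * ∑ t, ∑ s with a ⬝ᵥ s = t, √(S s 0 * S s 1) := by
        rw [Finset.sum_fiberwise]
    _ ≤ 2 * ∑ t : ZMod 2, √(P 0 * P 1 * (P' 0 * P' 1)) := by
        gcongr with t
        exact hCS t
    _ = bhattFn a p * bhattFn a p' := by
        rw [sum_zmod_two, Real.sqrt_mul (mul_nonneg (hP0 _) (hP0 _))]
        simp only [bhattFn]
        ring

lemma integral_prod_add_sub_mul {ν : Measure 𝓩} [IsProbabilityMeasure ν] {F : 𝓩 → ℝ}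
    (hF : Integrable F ν) :
    ∫ z : 𝓩 × 𝓩, F z.1 + F z.2 - F z.1 * F z.2 ∂(ν.prod ν) =
      2 * ∫ z, F z ∂ν - (∫ z, F z ∂ν) ^ 2 := by
  have hadd : Integrable (fun z : 𝓩 × 𝓩 => F z.1 + F z.2) (ν.prod ν) :=
    (hF.comp_fst _).add (hF.comp_snd _)
  rw [integral_sub hadd (hF.mul_prod hF), integral_add (hF.comp_fst _) (hF.comp_snd _),
    integral_fun_fst (f := F), integral_fun_snd (f := F), integral_prod_mul F F]
  simp
  ring

/-- The pointwise bound is integrated; independence of the two outputs turns the mean of the product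
into a square. -/
lemma bhatt_minusLaw_le (a : ι → ZMod 2) (ρ : Measure ((ι → ZMod 2) × 𝓩))
    [IsProbabilityMeasure ρ] : bhatt a (minusLaw ρ) ≤ 2 * bhatt a ρ - bhatt a ρ ^ 2 := by
  have hφ : ∀ c : ℝ, 0 ≤ c → ∀ w, bhattFn a (fun x => c * w x) = c * bhattFn a w :=
    fun c hc w => bhattFn_const_mul a w hc
  have hd : HasDensity (minusLaw ρ) _ _ := (hasDensity_posterior ρ).pairLaw.map_fst
    fun x : (ι → ZMod 2) × (ι → ZMod 2) => x.1 + x.2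
  obtain ⟨F, hF⟩ : ∃ F : 𝓩 → ℝ, F = fun z => bhattFn a fun x => posterior ρ x z := ⟨_, rfl⟩
  have hint : Integrable F ρ.snd := hF ▸ integrable_bhattFn_posterior a ρ
  have hZ : bhatt a ρ = ∫ z, F z ∂ρ.snd := hF ▸ rfl
  rw [hZ, ← integral_prod_add_sub_mul hint]
  refine (hd.posteriorMean_eq hφ).trans_le ?_
  refine integral_mono_of_nonneg (ae_of_all _ fun z => bhattFn_nonneg _ _)
    (((hint.comp_fst _).add (hint.comp_snd _)).sub (hint.mul_prod hint)) (ae_of_all _ fun z => ?_)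
  have hle := bhattFn_minus_le a (p := fun x => posterior ρ x z.1)
    (p' := fun x => posterior ρ x z.2) (fun x => posterior_nonneg ρ x _) (sum_posterior ρ _)
    (fun x => posterior_nonneg ρ x _) (sum_posterior ρ _)
  rw [hF]
  exact hle

lemma bhatt_plusLaw_le (a : ι → ZMod 2) (ρ : Measure ((ι → ZMod 2) × 𝓩))
    [IsProbabilityMeasure ρ] : bhatt a (plusLaw ρ) ≤ bhatt a ρ ^ 2 := by
  obtain ⟨F, hF⟩ : ∃ F : 𝓩 → ℝ, F = fun z => bhattFn a fun x => posterior ρ x z := ⟨_, rfl⟩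
  have hint : Integrable F ρ.snd := hF ▸ integrable_bhattFn_posterior a ρ
  have hZ : bhatt a ρ = ∫ z, F z ∂ρ.snd := hF ▸ rfl
  have hφ : ∀ c : ℝ, 0 ≤ c → ∀ w, bhattFn a (fun x => c * w x) = c * bhattFn a w :=
    fun c hc w => bhattFn_const_mul a w hc
  have hd : HasDensity (plusLaw ρ) _ _ :=
    (hasDensity_posterior ρ).pairLaw.splitLaw (plusEquiv ι)
  have hcount : ∀ z : 𝓩 × 𝓩, ∫ s, bhattFn a (fun x => posterior ρ (s - x) z.1 *
      posterior ρ x z.2) ∂Measure.count = ∑ s, bhattFn a (fun x => posterior ρ (s - x) z.1 *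
      posterior ρ x z.2) := fun z => by rw [integral_count]
  have hmeas : Measurable fun zs : (𝓩 × 𝓩) × (ι → ZMod 2) =>
      bhattFn a fun x => posterior ρ (zs.2 - x) zs.1.1 * posterior ρ x zs.1.2 := by
    refine (measurable_bhattFn a).comp (measurable_pi_lambda _ fun x => ?_)
    refine measurable_from_prod_countable_left fun s => ?_
    exact Measurable.mul (f := fun z : 𝓩 × 𝓩 => posterior ρ (s - x) z.1)
      (g := fun z : 𝓩 × 𝓩 => posterior ρ x z.2)
      ((measurable_posterior ρ _).comp measurable_fst)
      ((measurable_posterior ρ _).comp measurable_snd)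
  rw [hZ, sq, ← integral_prod_mul F F]
  refine (hd.posteriorMean_eq hφ).trans_le ?_
  change ∫ zs : (𝓩 × 𝓩) × (ι → ZMod 2), bhattFn a (fun x => posterior ρ (zs.2 - x) zs.1.1 *
    posterior ρ x zs.1.2) ∂((ρ.snd.prod ρ.snd).prod Measure.count) ≤ _
  rw [integral_prod]
  · simp only [hcount]
    refine integral_mono_of_nonneg (ae_of_all _ fun z =>
      Finset.sum_nonneg fun s _ => bhattFn_nonneg _ _) (hint.mul_prod hint)
      (ae_of_all _ fun z => ?_)
    have hle := sum_bhattFn_plus_le a (p := fun x => posterior ρ x z.1)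
      (p' := fun x => posterior ρ x z.2) (fun x => posterior_nonneg ρ x _)
      (fun x => posterior_nonneg ρ x _)
    rw [hF]
    exact hle
  · refine Integrable.of_bound (C := 1) hmeas.aestronglyMeasurable (ae_of_all _ fun zs => ?_)
    rw [Real.norm_of_nonneg (bhattFn_nonneg _ _)]
    refine (bhattFn_le_sum a fun x =>
      mul_nonneg (posterior_nonneg ρ _ _) (posterior_nonneg ρ _ _)).trans ?_
    calc ∑ x, posterior ρ (zs.2 - x) zs.1.1 * posterior ρ x zs.1.2
        ≤ ∑ x, posterior ρ x zs.1.2 := Finset.sum_le_sum fun x _ =>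
          mul_le_of_le_one_left (posterior_nonneg ρ _ _) (posterior_le_one ρ _ _)
      _ = 1 := sum_posterior ρ _

end Polar

/-! ### The laws of the synthetic channels -/

lemma lintegral_uniformOn {α : Type*} [Fintype α] [MeasurableSpace α] [MeasurableSingletonClass α]
    (s : Finset α) (f : α → ENNReal) :
    ∫⁻ x, f x ∂(uniformOn (s : Set α)) = (s.card : ENNReal)⁻¹ * ∑ x ∈ s, f x := by
  rw [uniformOn, ProbabilityTheory.cond, lintegral_smul_measure, Measure.count_apply_finset,
    smul_eq_mul, lintegral_finset]
  simp

/-! ### Interleaving of blocks: the indices 2i and 2i + 1 are the children of i. -/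

section Interleave

variable {X : Type*}

/-- The sequence `a₀, b₀, a₁, b₁, …` of length `M`. -/
def interleave {M N : ℕ} (h : M ≤ 2 * N) (a b : Fin N → X) : Fin M → X := fun j =>
  if (j : ℕ) % 2 = 0 then a ⟨j / 2, by have := j.isLt; omega⟩
  else b ⟨j / 2, by have := j.isLt; omega⟩

lemma interleave_even {M N : ℕ} (h : M ≤ 2 * N) (a b : Fin N → X) (j : Fin M) (k : Fin N)
    (hj : (j : ℕ) = 2 * k) : interleave h a b j = a k := by
  unfold interleave
  rw [if_pos (by omega)]
  congr 1
  ext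
  simp only
  omega

lemma interleave_odd {M N : ℕ} (h : M ≤ 2 * N) (a b : Fin N → X) (j : Fin M) (k : Fin N)
    (hj : (j : ℕ) = 2 * k + 1) : interleave h a b j = b k := by
  unfold interleave
  rw [if_neg (by omega)]
  congr 1
  ext
  simp only
  omega

lemma measurable_interleave [MeasurableSpace X] {M N : ℕ} (h : M ≤ 2 * N) :
    Measurable fun p : (Fin N → X) × (Fin N → X) => interleave h p.1 p.2 := by
  refine measurable_pi_lambda _ fun j => ?_
  unfold interleave
  split_ifs <;> fun_prop

lemma two_pow_succ_le (l : ℕ) : 2 ^ (l + 1) ≤ 2 * 2 ^ l := by rw [pow_succ]; omega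

@[simp]
lemma interleave_child_zero (l : ℕ) (a b : Fin (2 ^ l) → X) (i : Fin (2 ^ l)) :
    interleave (two_pow_succ_le l) a b (childEquiv l (i, 0)) = a i :=
  interleave_even _ _ _ _ _ (by rw [childEquiv_val]; simp)

@[simp]
lemma interleave_child_one (l : ℕ) (a b : Fin (2 ^ l) → X) (i : Fin (2 ^ l)) :
    interleave (two_pow_succ_le l) a b (childEquiv l (i, 1)) = b i :=
  interleave_odd _ _ _ _ _ (by rw [childEquiv_val, Fin.val_one]; omega)

/-- Interleaving of two sequences of length `2 ^ l` as an equivalence. -/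
def interleaveEquiv (X : Type*) (l : ℕ) :
    (Fin (2 ^ l) → X) × (Fin (2 ^ l) → X) ≃ (Fin (2 ^ (l + 1)) → X) where
  toFun p := interleave (two_pow_succ_le l) p.1 p.2
  invFun u := (fun i => u (childEquiv l (i, 0)), fun i => u (childEquiv l (i, 1)))
  left_inv p := by simp
  right_inv u := by
    funext j
    obtain ⟨⟨i, b⟩, rfl⟩ := (childEquiv l).surjective j
    fin_cases b <;> simp

/-- A product measure is the product of its even and odd parts. -/
lemma map_interleave_prod_pi [MeasurableSpace X] (l : ℕ) (μ : Fin (2 ^ (l + 1)) → Measure X)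
    [∀ j, IsProbabilityMeasure (μ j)] :
    ((Measure.pi fun i => μ (childEquiv l (i, 0))).prod
      (Measure.pi fun i => μ (childEquiv l (i, 1)))).map
        (fun p => interleave (two_pow_succ_le l) p.1 p.2) = Measure.pi μ := by
  refine (Measure.pi_eq fun s hs => ?_).symm
  rw [Measure.map_apply (measurable_interleave _) (MeasurableSet.univ_pi hs)]
  have : (fun p : (Fin (2 ^ l) → X) × (Fin (2 ^ l) → X) =>
      interleave (two_pow_succ_le l) p.1 p.2) ⁻¹' Set.univ.pi s =
      (Set.univ.pi fun i => s (childEquiv l (i, 0))) ×ˢ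
        (Set.univ.pi fun i => s (childEquiv l (i, 1))) := by
    ext p
    simp only [Set.mem_preimage, Set.mem_pi, Set.mem_univ, true_implies, Set.mem_prod]
    rw [← (childEquiv l).forall_congr_right]
    simp only [Prod.forall, Fin.forall_fin_two, interleave_child_zero, interleave_child_one]
    exact forall_and
  rw [this, Measure.prod_prod, Measure.pi_pi, Measure.pi_pi, ← (childEquiv l).prod_comp,
    Fintype.prod_prod_type]
  simp [Fin.prod_univ_two, Finset.prod_mul_distrib]

end Interleave

variable {m : ℕ} {𝓨 : Type*} [MeasurableSpace 𝓨]

lemma add_self_zmod_two (b : ZMod 2) : b + b = 0 := by revert b; decide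

lemma polarMatrix_succ_apply (l : ℕ) (i j : Fin (2 ^ l)) (b c : Fin 2) :
    polarMatrix (l + 1) (childEquiv l (i, b)) (childEquiv l (j, c)) =
      polarMatrix l i j * (!![1, 0; 1, 1] : Matrix (Fin 2) (Fin 2) (ZMod 2)) b c := by
  change polarMatrix l ((childEquiv l).symm (childEquiv l (i, b))).1
      ((childEquiv l).symm (childEquiv l (j, c))).1 *
    (!![1, 0; 1, 1] : Matrix (Fin 2) (Fin 2) (ZMod 2))
      ((childEquiv l).symm (childEquiv l (i, b))).2 ((childEquiv l).symm (childEquiv l (j, c))).2 = _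
  simp

/-- The polar transform is the transform of pairs, followed by two transforms of half the length. -/
lemma polarTransform_succ (l : ℕ) (v w : Fin (2 ^ l) → Input m) :
    polarTransform (l + 1) (interleave (two_pow_succ_le l) (v + w) w) =
      interleave (two_pow_succ_le l) (polarTransform l v) (polarTransform l w) := by
  funext j k
  obtain ⟨⟨j, c⟩, rfl⟩ := (childEquiv l).surjective j
  simp only [polarTransform, Matrix.vecMul, dotProduct]
  rw [sum_childEquiv]
  simp only [polarMatrix_succ_apply, interleave_child_zero, interleave_child_one, Pi.add_apply]
  fin_cases c
  · simp only [Fin.zero_eta, Fin.isValue, interleave_child_zero]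
    refine Finset.sum_congr rfl fun i _ => ?_
    simp
    -- In the even columns w enters twice, through v + w and through w, and cancels.
    linear_combination (polarMatrix l i j) * add_self_zmod_two (w i k)
  · simp only [Fin.mk_one, Fin.isValue, interleave_child_one]
    refine Finset.sum_congr rfl fun i _ => ?_
    simp

variable (P : Kernel (Input m) 𝓨) [IsMarkovKernel P]

/-- The joint law of all the bits and of the output of the block channel. -/
def blockLaw (l : ℕ) : Measure ((Fin (2 ^ l) → Input m) × (Fin (2 ^ l) → 𝓨)) :=
  uniformOn (Set.univ : Set (Fin (2 ^ l) → Input m)) ⊗ₘ blockChannel P l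

instance isProbabilityMeasure_uniformOn_univ {α : Type*} [Finite α] [Nonempty α]
    [MeasurableSpace α] [MeasurableSingletonClass α] :
    IsProbabilityMeasure (uniformOn (Set.univ : Set α)) :=
  isProbabilityMeasure_uniformOn Set.finite_univ Set.univ_nonempty

instance isProbabilityMeasure_blockLaw (l : ℕ) : IsProbabilityMeasure (blockLaw P l) := by
  unfold blockLaw
  infer_instance

lemma lintegral_blockLaw (l : ℕ) {f : (Fin (2 ^ l) → Input m) × (Fin (2 ^ l) → 𝓨) → ENNReal}
    (hf : Measurable f) :
    ∫⁻ p, f p ∂blockLaw P l = (Fintype.card (Fin (2 ^ l) → Input m) : ENNReal)⁻¹ *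
      ∑ u, ∫⁻ y, f (u, y) ∂(Measure.pi fun j => P (polarTransform l u j)) := by
  rw [blockLaw, Measure.lintegral_compProd hf, ← Finset.coe_univ, lintegral_uniformOn]
  rfl

/-- The block of length `2 ^ (l + 1)` from two independent blocks of length `2 ^ l`. -/
def joinBlocks (m l : ℕ) (𝓨 : Type*) (p : ((Fin (2 ^ l) → Input m) × (Fin (2 ^ l) → 𝓨)) ×
    ((Fin (2 ^ l) → Input m) × (Fin (2 ^ l) → 𝓨))) :
    (Fin (2 ^ (l + 1)) → Input m) × (Fin (2 ^ (l + 1)) → 𝓨) :=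
  (interleave (two_pow_succ_le l) (p.1.1 + p.2.1) p.2.1,
    interleave (two_pow_succ_le l) p.1.2 p.2.2)

lemma measurable_joinBlocks (l : ℕ) : Measurable (joinBlocks m l 𝓨) := by
  have h1 : Measurable fun p : (Fin (2 ^ l) → Input m) × (Fin (2 ^ l) → Input m) =>
      interleave (two_pow_succ_le l) (p.1 + p.2) p.2 := measurable_of_finite _
  have h2 := measurable_interleave (X := 𝓨) (two_pow_succ_le l)
  exact (h1.comp (measurable_fst.fst.prodMk measurable_snd.fst)).prodMk
    (h2.comp (measurable_fst.snd.prodMk measurable_snd.snd))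

/-- Summation over the pairs `(v, w)` is summation over the interleavings of `v + w` and `w`. -/
lemma sum_interleave_shear {M : Type*} [AddCommMonoid M] (l : ℕ)
    (g : (Fin (2 ^ (l + 1)) → Input m) → M) :
    ∑ u, g u = ∑ v, ∑ w, g (interleave (two_pow_succ_le l) (v + w) w) := by
  rw [← (interleaveEquiv (Input m) l).sum_comp, Fintype.sum_prod_type_right]
  refine Eq.trans ?_ Finset.sum_comm
  refine Finset.sum_congr rfl fun w _ => ?_
  exact (Equiv.sum_comp (Equiv.addRight w) fun x => g (interleave (two_pow_succ_le l) x w)).symm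

/-- The shear (v, w) ↦ (v + w, w) is bijective, so it preserves uniform inputs, and by
`polarTransform_succ` it decouples the channel uses into two independent half blocks. -/
lemma map_joinBlocks (l : ℕ) :
    ((blockLaw P l).prod (blockLaw P l)).map (joinBlocks m l 𝓨) = blockLaw P (l + 1) := by
  refine (Measure.ext_of_lintegral _ fun f hf => ?_).symm
  have hF : Measurable fun p => f (joinBlocks m l 𝓨 p) := hf.comp (measurable_joinBlocks l)
  rw [lintegral_map hf (measurable_joinBlocks l), lintegral_prod _ hF.aemeasurable,
    lintegral_blockLaw P l hF.lintegral_prod_right', lintegral_blockLaw P (l + 1) hf,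
    sum_interleave_shear]
  have hinner : ∀ v y, ∫⁻ p, f (joinBlocks m l 𝓨 ((v, y), p)) ∂blockLaw P l =
      (Fintype.card (Fin (2 ^ l) → Input m) : ENNReal)⁻¹ *
      ∑ w, ∫⁻ y', f (joinBlocks m l 𝓨 ((v, y), (w, y')))
        ∂(Measure.pi fun j => P (polarTransform l w j)) := fun v y =>
    lintegral_blockLaw P l (hF.comp measurable_prodMk_left)
  simp only [hinner]
  have hcard : (Fintype.card (Fin (2 ^ (l + 1)) → Input m) : ENNReal)⁻¹ =
      (Fintype.card (Fin (2 ^ l) → Input m) : ENNReal)⁻¹ *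
        (Fintype.card (Fin (2 ^ l) → Input m) : ENNReal)⁻¹ := by
    rw [← Fintype.card_congr (interleaveEquiv (Input m) l), Fintype.card_prod, Nat.cast_mul,
      ENNReal.mul_inv (Or.inr (by simp)) (Or.inl (by simp))]
  have hm : ∀ v w, Measurable fun q : (Fin (2 ^ l) → 𝓨) × (Fin (2 ^ l) → 𝓨) =>
      f (joinBlocks m l 𝓨 ((v, q.1), (w, q.2))) := fun v w => hF.comp (by fun_prop)
  have hmi : ∀ v w, Measurable fun y => ∫⁻ y', f (joinBlocks m l 𝓨 ((v, y), (w, y')))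
        ∂(Measure.pi fun j => P (polarTransform l w j)) := fun v w =>
    (hm v w).lintegral_prod_right'
  rw [hcard, mul_assoc]
  congr 1
  rw [Finset.mul_sum]
  refine Finset.sum_congr rfl fun v _ => ?_
  rw [lintegral_const_mul _ (Finset.measurable_sum _ fun w _ => hmi v w),
    lintegral_finsetSum _ fun w _ => hmi v w]
  congr 1
  refine Finset.sum_congr rfl fun w _ => ?_
  rw [polarTransform_succ, ← map_interleave_prod_pi, lintegral_map (by fun_prop)
    (measurable_interleave _)]
  simp only [interleave_child_zero, interleave_child_one]
  exact lintegral_prod _ (hm v w).aemeasurable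

/-- The joint law of the input and the output of the synthetic channel. -/
def synthLaw (l : ℕ) (i : Fin (2 ^ l)) :
    Measure (Input m × ((Fin (2 ^ l) → 𝓨) × (Fin (i : ℕ) → Input m))) :=
  (blockLaw P l).map fun p => (p.1 i, (p.2, fun j : Fin (i : ℕ) => p.1 (j.castLE i.isLt.le)))

instance isProbabilityMeasure_synthLaw (l : ℕ) (i : Fin (2 ^ l)) :
    IsProbabilityMeasure (synthLaw P l i) :=
  Measure.isProbabilityMeasure_map (by fun_prop)

/-- All fibres {u | u i = x} have the same size D, so a uniform mixture of the uniform laws on them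
is uniform on all bits. -/
lemma jointLaw_synthChannel (l : ℕ) (i : Fin (2 ^ l)) :
    jointLaw (synthChannel P l i) = synthLaw P l i := by
  refine Measure.ext_of_lintegral _ fun f hf => ?_
  have hmap : Measurable fun p : (Fin (2 ^ l) → Input m) × (Fin (2 ^ l) → 𝓨) =>
      (p.1 i, (p.2, fun j : Fin (i : ℕ) => p.1 (j.castLE i.isLt.le))) := by fun_prop
  have hmap2 : Measurable fun p : (Fin (2 ^ l) → Input m) × (Fin (2 ^ l) → 𝓨) =>
      (p.2, fun j : Fin (i : ℕ) => p.1 (j.castLE i.isLt.le)) := by fun_prop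
  have hfmap : Measurable fun p : (Fin (2 ^ l) → Input m) × (Fin (2 ^ l) → 𝓨) =>
      f (p.1 i, (p.2, fun j : Fin (i : ℕ) => p.1 (j.castLE i.isLt.le))) := hf.comp hmap
  rw [synthLaw, lintegral_map hf hmap, lintegral_blockLaw P l hfmap, jointLaw,
    Measure.lintegral_compProd hf, ← Finset.coe_univ, lintegral_uniformOn]
  set h : (Fin (2 ^ l) → Input m) → ENNReal := fun u =>
    ∫⁻ y, f (u i, (y, fun j : Fin (i : ℕ) => u (j.castLE i.isLt.le)))
      ∂(Measure.pi fun j => P (polarTransform l u j)) with hh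
  set D : ℕ := Fintype.card ({j : Fin (2 ^ l) // j ≠ i} → Input m) with hD
  have hfib : ∀ x, (Finset.univ.filter fun u : Fin (2 ^ l) → Input m => u i = x).card = D := by
    intro x
    rw [hD, ← Finset.card_univ]
    refine Finset.card_bij' (fun u _ j => u j) (fun w _ j => if hj : j = i then x else w ⟨j, hj⟩)
      (by simp) (by simp) ?_ ?_
    · intro u hu
      funext j
      have := (Finset.mem_filter.1 hu).2
      by_cases hj : j = i
      · subst hj; simp [this]
      · simp [hj]
    · intro w _
      funext j
      simp [j.2]
  have hcard : Fintype.card (Fin (2 ^ l) → Input m) = Fintype.card (Input m) * D := by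
    rw [← Finset.card_univ, Finset.card_eq_sum_card_fiberwise (f := fun u => u i)
      (t := Finset.univ) (by simp)]
    simp [hfib]
  have hsynth : ∀ x, ∫⁻ z, f (x, z) ∂(synthChannel P l i x) =
      (D : ENNReal)⁻¹ * ∑ u with u i = x, h u := by
    intro x
    have hprob : IsProbabilityMeasure (uniformOn {u : Fin (2 ^ l) → Input m | u i = x}) :=
      isProbabilityMeasure_uniformOn (Set.toFinite _) ⟨fun _ => x, rfl⟩
    have hfx : Measurable fun z => f (x, z) := hf.comp measurable_prodMk_left
    have hfx2 : Measurable fun p : (Fin (2 ^ l) → Input m) × (Fin (2 ^ l) → 𝓨) =>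
        f (x, (p.2, fun j : Fin (i : ℕ) => p.1 (j.castLE i.isLt.le))) := hfx.comp hmap2
    change ∫⁻ z, f (x, z) ∂((uniformOn {u : Fin (2 ^ l) → Input m | u i = x} ⊗ₘ
      blockChannel P l).map _) = _
    rw [lintegral_map hfx hmap2, Measure.lintegral_compProd hfx2]
    have hset : {u : Fin (2 ^ l) → Input m | u i = x} =
        ((Finset.univ.filter fun u : Fin (2 ^ l) → Input m => u i = x) :
          Set (Fin (2 ^ l) → Input m)) := by ext; simp
    rw [hset, lintegral_uniformOn, hfib]
    congr 1
    refine Finset.sum_congr rfl fun u hu => ?_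
    rw [hh, ← (Finset.mem_filter.1 hu).2]
    rfl
  simp only [hsynth]
  rw [← Finset.mul_sum, Finset.sum_fiberwise, ← mul_assoc, hcard, Finset.card_univ, Nat.cast_mul,
    ENNReal.mul_inv (Or.inr (by simp)) (Or.inl (by simp))]

/-! ### The recursion of the synthetic channels -/

section Relabel

variable {m : ℕ} {𝓨 : Type*}

/-- The output of a synthetic channel from the outputs of its two parents; `s` fills the last
position if there is one more previous bit. -/
def relabel (l : ℕ) {N M : ℕ} (s : Input m)
    (z : ((Fin (2 ^ l) → 𝓨) × (Fin N → Input m)) × ((Fin (2 ^ l) → 𝓨) × (Fin N → Input m))) :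
    (Fin (2 ^ (l + 1)) → 𝓨) × (Fin M → Input m) :=
  (interleave (two_pow_succ_le l) z.1.1 z.2.1, fun j =>
    if h : (j : ℕ) < 2 * N then interleave le_rfl (z.1.2 + z.2.2) z.2.2 ⟨j, h⟩ else s)

/-- A left inverse of `relabel`. -/
def unlabel (l : ℕ) {N M : ℕ} (h : 2 * N ≤ M)
    (z : (Fin (2 ^ (l + 1)) → 𝓨) × (Fin M → Input m)) :
    ((Fin (2 ^ l) → 𝓨) × (Fin N → Input m)) × ((Fin (2 ^ l) → 𝓨) × (Fin N → Input m)) :=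
  ((fun j => z.1 (childEquiv l (j, 0)), fun k => z.2 ⟨2 * k, by have := k.isLt; omega⟩ +
      z.2 ⟨2 * k + 1, by have := k.isLt; omega⟩),
    (fun j => z.1 (childEquiv l (j, 1)), fun k => z.2 ⟨2 * k + 1, by have := k.isLt; omega⟩))

lemma add_add_self_input (x y : Input m) : x + y + y = x := by
  funext k
  simp [add_assoc, add_self_zmod_two]

/-- Both pasts can be read off whatever fills the last place: the odd positions hold y and the even
ones x + y, and x = (x + y) + y. -/
lemma unlabel_relabel (l : ℕ) {N M : ℕ} (h : 2 * N ≤ M) (s : Input m)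
    (z : ((Fin (2 ^ l) → 𝓨) × (Fin N → Input m)) × ((Fin (2 ^ l) → 𝓨) × (Fin N → Input m))) :
    unlabel l h (relabel l (M := M) s z) = z := by
  have h1 : ∀ k : Fin N, (2 * k : ℕ) < 2 * N := fun k => by have := k.isLt; omega
  have h2 : ∀ k : Fin N, (2 * k + 1 : ℕ) < 2 * N := fun k => by have := k.isLt; omega
  have e1 : ∀ k : Fin N, interleave le_rfl (z.1.2 + z.2.2) z.2.2 ⟨2 * k, h1 k⟩ =
      (z.1.2 + z.2.2) k := fun k => interleave_even _ _ _ _ _ rfl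
  have e2 : ∀ k : Fin N, interleave le_rfl (z.1.2 + z.2.2) z.2.2 ⟨2 * k + 1, h2 k⟩ =
      z.2.2 k := fun k => interleave_odd _ _ _ _ _ rfl
  simp only [unlabel, relabel, h1, h2, dif_pos, e1, e2, interleave_child_zero,
    interleave_child_one, Pi.add_apply, add_add_self_input]

variable [MeasurableSpace 𝓨]

lemma measurable_relabel (l : ℕ) {N M : ℕ} :
    Measurable fun p : (((Fin (2 ^ l) → 𝓨) × (Fin N → Input m)) ×
      ((Fin (2 ^ l) → 𝓨) × (Fin N → Input m))) × Input m => relabel l (M := M) p.2 p.1 := by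
  have h1 := measurable_interleave (X := 𝓨) (two_pow_succ_le l)
  have h2 : Measurable fun p : ((Fin N → Input m) × (Fin N → Input m)) × Input m =>
      fun j : Fin M => if h : (j : ℕ) < 2 * N then interleave le_rfl (p.1.1 + p.1.2) p.1.2 ⟨j, h⟩
        else p.2 := measurable_of_finite _
  exact (h1.comp (measurable_fst.fst.fst.prodMk measurable_fst.snd.fst)).prodMk
    (h2.comp ((measurable_fst.fst.snd.prodMk measurable_fst.snd.snd).prodMk measurable_snd))

lemma measurable_unlabel (l : ℕ) {N M : ℕ} (h : 2 * N ≤ M) :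
    Measurable (unlabel l h : (Fin (2 ^ (l + 1)) → 𝓨) × (Fin M → Input m) → _) := by
  have h1 : Measurable fun w : Fin M → Input m => fun k : Fin N =>
      w ⟨2 * k, by have := k.isLt; omega⟩ + w ⟨2 * k + 1, by have := k.isLt; omega⟩ :=
    measurable_of_finite _
  have h2 : Measurable fun w : Fin M → Input m => fun k : Fin N =>
      w ⟨2 * k + 1, by have := k.isLt; omega⟩ := measurable_of_finite _
  exact (Measurable.prodMk (by fun_prop) (h1.comp measurable_snd)).prodMk
    (Measurable.prodMk (by fun_prop) (h2.comp measurable_snd))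

end Relabel

section Recursion

variable {m : ℕ} {𝓨 : Type*} [MeasurableSpace 𝓨]

/-- The input and the output of the synthetic channel. -/
def synthMap (m l : ℕ) (𝓨 : Type*) (i : Fin (2 ^ l))
    (p : (Fin (2 ^ l) → Input m) × (Fin (2 ^ l) → 𝓨)) :
    Input m × ((Fin (2 ^ l) → 𝓨) × (Fin (i : ℕ) → Input m)) :=
  (p.1 i, (p.2, fun j : Fin (i : ℕ) => p.1 (j.castLE i.isLt.le)))

lemma measurable_synthMap (l : ℕ) (i : Fin (2 ^ l)) : Measurable (synthMap m l 𝓨 i) := by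
  unfold synthMap
  fun_prop

lemma synthLaw_eq_map (P : Kernel (Input m) 𝓨) (l : ℕ) (i : Fin (2 ^ l)) :
    synthLaw P l i = (blockLaw P l).map (synthMap m l 𝓨 i) := rfl

variable (P : Kernel (Input m) 𝓨) [IsMarkovKernel P]

lemma pairLaw_synthLaw (l : ℕ) (i : Fin (2 ^ l)) :
    pairLaw (synthLaw P l i) = ((blockLaw P l).prod (blockLaw P l)).map fun p =>
      ((p.1.1 i, p.2.1 i), ((synthMap m l 𝓨 i p.1).2, (synthMap m l 𝓨 i p.2).2)) := by
  have h := measurable_synthMap (𝓨 := 𝓨) (m := m) l i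
  rw [pairLaw, synthLaw_eq_map, Measure.map_prod_map _ _ h h,
    Measure.map_map (by fun_prop) (h.prodMap h)]
  rfl

/-- The even children of a synthetic channel. -/
lemma synthLaw_child_zero (l : ℕ) (i : Fin (2 ^ l)) :
    synthLaw P (l + 1) (childEquiv l (i, 0)) =
      (minusLaw (synthLaw P l i)).map fun p => (p.1, relabel l 0 p.2) := by
  have hs := measurable_synthMap (𝓨 := 𝓨) (m := m) l i
  have hr : Measurable fun z : ((Fin (2 ^ l) → 𝓨) × (Fin (i : ℕ) → Input m)) ×
      ((Fin (2 ^ l) → 𝓨) × (Fin (i : ℕ) → Input m)) =>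
      (relabel l 0 z : _ × (Fin (childEquiv l (i, 0) : ℕ) → Input m)) :=
    (measurable_relabel l).comp (measurable_id.prodMk measurable_const)
  have ha : Measurable fun x : Input m × Input m => x.1 + x.2 := measurable_of_finite _
  rw [minusLaw, pairLaw_synthLaw, Measure.map_map (by fun_prop) (by fun_prop),
    Measure.map_map (by fun_prop) (by fun_prop), synthLaw_eq_map, ← map_joinBlocks,
    Measure.map_map (measurable_synthMap _ _) (measurable_joinBlocks l)]
  congr 1
  funext p
  simp only [Function.comp_apply, synthMap, joinBlocks, relabel, interleave_child_zero,
    Prod.mk.injEq, true_and, Pi.add_apply]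
  funext j
  -- The child 2i has exactly 2i predecessors, so the filler 0 never appears.
  have hj : (j : ℕ) < 2 * i := by
    have h1 := childEquiv_val l i 0
    have h2 := j.isLt
    rw [Fin.val_zero] at h1
    omega
  rw [dif_pos hj]
  rfl

/-- The odd children of a synthetic channel. -/
lemma synthLaw_child_one (l : ℕ) (i : Fin (2 ^ l)) :
    synthLaw P (l + 1) (childEquiv l (i, 1)) =
      (plusLaw (synthLaw P l i)).map fun p => (p.1, relabel l p.2.2 p.2.1) := by
  have hs := measurable_synthMap (𝓨 := 𝓨) (m := m) l i
  have hr : Measurable fun z : (((Fin (2 ^ l) → 𝓨) × (Fin (i : ℕ) → Input m)) ×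
      ((Fin (2 ^ l) → 𝓨) × (Fin (i : ℕ) → Input m))) × Input m =>
      (relabel l z.2 z.1 : _ × (Fin (childEquiv l (i, 1) : ℕ) → Input m)) :=
    measurable_relabel l
  have hr' : Measurable fun p : Input m × ((((Fin (2 ^ l) → 𝓨) × (Fin (i : ℕ) → Input m)) ×
      ((Fin (2 ^ l) → 𝓨) × (Fin (i : ℕ) → Input m))) × Input m) =>
      (p.1, (relabel l p.2.2 p.2.1 : _ × (Fin (childEquiv l (i, 1) : ℕ) → Input m))) :=
    measurable_fst.prodMk (hr.comp measurable_snd)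
  rw [plusLaw, splitLaw, pairLaw_synthLaw, Measure.map_map (measurable_splitLaw_map _)
      (by fun_prop),
    Measure.map_map hr' ((measurable_splitLaw_map _).comp (by fun_prop)),
    synthLaw_eq_map, ← map_joinBlocks,
    Measure.map_map (measurable_synthMap _ _) (measurable_joinBlocks l)]
  congr 1
  funext p
  simp only [Function.comp_apply, synthMap, joinBlocks, relabel, interleave_child_one, plusEquiv,
    Equiv.coe_fn_mk, Prod.mk.injEq, true_and]
  funext j
  by_cases hj : (j : ℕ) < 2 * i
  · rw [dif_pos hj]
    rfl
  -- The one extra predecessor, at position 2i, is the first input of the transform, which the plus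
  -- law keeps beside the outputs.
  · rw [dif_neg hj]
    have hj2 : (j : ℕ) = 2 * i := by
      have h1 := childEquiv_val l i 1
      have h2 := j.isLt
      rw [Fin.val_one] at h1
      omega
    exact interleave_even _ _ _ _ _ hj2

variable {P}

lemma posteriorMean_congr {α 𝓩 : Type*} [Fintype α] [MeasurableSpace α]
    [MeasurableSingletonClass α] [MeasurableSpace 𝓩] [Nonempty α] {ρ ρ' : Measure (α × 𝓩)}
    [IsFiniteMeasure ρ] [IsFiniteMeasure ρ'] (φ : (α → ℝ) → ℝ) (h : ρ = ρ') :
    posteriorMean φ ρ = posteriorMean φ ρ' := by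
  subst h
  rfl

lemma posteriorMean_synthLaw_child_zero (l : ℕ) (i : Fin (2 ^ l)) {φ : (Input m → ℝ) → ℝ}
    (hφ : ∀ c : ℝ, 0 ≤ c → ∀ w, φ (fun a => c * w a) = c * φ w) (hφm : Measurable φ) :
    posteriorMean φ (synthLaw P (l + 1) (childEquiv l (i, 0))) =
      posteriorMean φ (minusLaw (synthLaw P l i)) := by
  have hle : 2 * (i : ℕ) ≤ (childEquiv l (i, 0) : ℕ) := by rw [childEquiv_val]; omega
  refine (posteriorMean_congr φ (synthLaw_child_zero P l i)).trans ?_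
  exact posteriorMean_map_snd _
    ((measurable_relabel l).comp (measurable_id.prodMk measurable_const))
    (measurable_unlabel l hle) (fun z => unlabel_relabel l hle 0 z) hφ hφm

lemma posteriorMean_synthLaw_child_one (l : ℕ) (i : Fin (2 ^ l)) {φ : (Input m → ℝ) → ℝ}
    (hφ : ∀ c : ℝ, 0 ≤ c → ∀ w, φ (fun a => c * w a) = c * φ w) (hφm : Measurable φ) :
    posteriorMean φ (synthLaw P (l + 1) (childEquiv l (i, 1))) =
      posteriorMean φ (plusLaw (synthLaw P l i)) := by
  have hval : (childEquiv l (i, 1) : ℕ) = 2 * i + 1 := by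
    rw [childEquiv_val, Fin.val_one]; omega
  have hle : 2 * (i : ℕ) ≤ (childEquiv l (i, 1) : ℕ) := by omega
  have hlt : 2 * (i : ℕ) < (childEquiv l (i, 1) : ℕ) := by omega
  refine (posteriorMean_congr φ (synthLaw_child_one P l i)).trans ?_
  refine posteriorMean_map_snd (g := fun z => (unlabel l hle z, z.2 ⟨2 * i, hlt⟩)) _
    (measurable_relabel l) ?_ (fun z => ?_) hφ hφm
  · exact (measurable_unlabel l hle).prodMk (by fun_prop)
  · refine Prod.ext (unlabel_relabel l hle z.2 z.1) ?_
    simp [relabel]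

/-- The Bhattacharyya parameters of the synthetic channels form a polar array. -/
theorem isPolarArray_bhatt (a : Input m) :
    IsPolarArray fun l i => bhatt a (synthLaw P l i) where
  nonneg _ _ := bhatt_nonneg a _
  le_one _ _ := bhatt_le_one a _
  minus l i := (posteriorMean_synthLaw_child_zero l i (fun _ hc w => bhattFn_const_mul a w hc)
    (measurable_bhattFn a)).trans_le (bhatt_minusLaw_le a _)
  plus l i := (posteriorMean_synthLaw_child_one l i (fun _ hc w => bhattFn_const_mul a w hc)
    (measurable_bhattFn a)).trans_le (bhatt_plusLaw_le a _)

/-- The mean conditional entropy of the synthetic channels is preserved. -/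
lemma levelMean_entropy_succ (l : ℕ) :
    levelMean (l + 1) (fun i => posteriorMean entropyFn (synthLaw P (l + 1) i)) =
      levelMean l fun i => posteriorMean entropyFn (synthLaw P l i) := by
  rw [levelMean_succ]
  congr 1
  funext i
  rw [posteriorMean_synthLaw_child_zero l i (fun _ _ _ => entropyFn_const_mul) measurable_entropyFn,
    posteriorMean_synthLaw_child_one l i (fun _ _ _ => entropyFn_const_mul) measurable_entropyFn,
    posteriorMean_entropyFn_minusLaw_add_plusLaw]
  ring

lemma jointLaw_eq_map_synthLaw_zero :
    synthLaw P 0 0 = (jointLaw P).map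
      fun p => (p.1, ((fun _ => p.2 : Fin (2 ^ 0) → 𝓨), (Fin.elim0 : Fin 0 → Input m))) := by
  refine Measure.ext_of_lintegral _ fun f hf => ?_
  have hg : Measurable fun p : Input m × 𝓨 =>
      (p.1, ((fun _ => p.2 : Fin (2 ^ 0) → 𝓨), (Fin.elim0 : Fin 0 → Input m))) := by fun_prop
  have hfg : Measurable fun p : Input m × 𝓨 =>
      f (p.1, ((fun _ => p.2 : Fin (2 ^ 0) → 𝓨), (Fin.elim0 : Fin 0 → Input m))) := hf.comp hg
  have hfs : Measurable fun p => f (synthMap m 0 𝓨 0 p) := hf.comp (measurable_synthMap 0 0)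
  rw [synthLaw_eq_map, lintegral_map hf (measurable_synthMap 0 0), lintegral_blockLaw P 0 hfs,
    lintegral_map hf hg, jointLaw, Measure.lintegral_compProd hfg, ← Finset.coe_univ,
    lintegral_uniformOn, Finset.card_univ]
  have hu : Unique (Fin (2 ^ 0)) := inferInstanceAs (Unique (Fin 1))
  have e := (Equiv.funUnique (Fin (2 ^ 0)) (Input m))
  rw [Fintype.card_congr e]
  congr 1
  rw [← (Equiv.funUnique (Fin (2 ^ 0)) (Input m)).symm.sum_comp]
  refine Finset.sum_congr rfl fun x _ => ?_
  have hT : ∀ j, polarTransform 0 ((Equiv.funUnique (Fin (2 ^ 0)) (Input m)).symm x) j = x := by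
    intro j
    funext k
    simp [polarTransform, polarMatrix]
  simp only [hT]
  have hpi : Measure.pi (fun _ : Fin (2 ^ 0) => P x) = (P x).map fun y _ => y := by
    refine Measure.pi_eq fun s hs => ?_
    rw [Measure.map_apply (by fun_prop) (MeasurableSet.univ_pi hs), Fintype.prod_unique]
    congr 1
    ext y
    simp [Unique.forall_iff]
  have hfx : Measurable fun y : Fin (2 ^ 0) → 𝓨 => f (synthMap m 0 𝓨 0
      ((Equiv.funUnique (Fin (2 ^ 0)) (Input m)).symm x, y)) := hfs.comp measurable_prodMk_left
  rw [hpi, lintegral_map hfx (by fun_prop)]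
  refine lintegral_congr fun y => ?_
  congr 1
  refine Prod.ext ?_ (Prod.ext rfl (funext fun j => j.elim0))
  simp [synthMap]

instance isProbabilityMeasure_jointLaw {𝓩 : Type*} [MeasurableSpace 𝓩] (W : Kernel (Input m) 𝓩)
    [IsMarkovKernel W] : IsProbabilityMeasure (jointLaw W) := by
  unfold jointLaw
  infer_instance

lemma levelMean_entropy (l : ℕ) :
    levelMean l (fun i => posteriorMean entropyFn (synthLaw P l i)) =
      posteriorMean entropyFn (jointLaw P) := by
  induction l with
  | zero =>
    have h : levelMean 0 (fun i => posteriorMean entropyFn (synthLaw P 0 i)) =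
        posteriorMean entropyFn (synthLaw P 0 0) := by
      simp [levelMean]
    rw [h]
    refine (posteriorMean_congr entropyFn jointLaw_eq_map_synthLaw_zero).trans ?_
    exact posteriorMean_map_snd (jointLaw P)
      (f := fun y => ((fun _ => y : Fin (2 ^ 0) → 𝓨), (Fin.elim0 : Fin 0 → Input m)))
      (g := fun z => z.1 0) (by fun_prop) (by fun_prop)
      (fun _ => rfl) (fun _ _ _ => entropyFn_const_mul) measurable_entropyFn
  | succ l ih => rw [levelMean_entropy_succ, ih]

end Recursion

/-! ### Linear images of the uniform distribution -/

section LinearImages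

variable {ι : Type*} [Fintype ι]

lemma mulVec_surjective_of_linearIndependent {r : ℕ} {A : Matrix (Fin r) ι (ZMod 2)}
    (hA : LinearIndependent (ZMod 2) A.row) : Function.Surjective fun x => A *ᵥ x := by
  have h : Module.finrank (ZMod 2) (LinearMap.range A.mulVecLin) =
      Module.finrank (ZMod 2) (Fin r → ZMod 2) := by
    rw [Module.finrank_fin_fun]
    simpa [Matrix.rank] using hA.rank_matrix
  exact LinearMap.range_eq_top.1 (Submodule.eq_top_of_finrank_eq h)

lemma card_fiber_mulVec [DecidableEq ι] {r : ℕ} {A : Matrix (Fin r) ι (ZMod 2)}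
    (hA : Function.Surjective fun x => A *ᵥ x) (b : Fin r → ZMod 2) :
    2 ^ r * (Finset.univ.filter fun x => A *ᵥ x = b).card = 2 ^ Fintype.card ι := by
  have hfib : ∀ c, (Finset.univ.filter fun x => A *ᵥ x = c).card =
      (Finset.univ.filter fun x => A *ᵥ x = b).card := fun c =>
    AddMonoidHom.card_fiber_eq_of_mem_range A.mulVecLin.toAddMonoidHom (hA c) (hA b)
  have htot := Finset.card_eq_sum_card_fiberwise (s := (Finset.univ : Finset (ι → ZMod 2)))
    (t := (Finset.univ : Finset (Fin r → ZMod 2))) (f := fun x => A *ᵥ x) (by simp)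
  simp only [hfib, Finset.sum_const, Finset.card_univ, Fintype.card_pi, ZMod.card,
    Finset.prod_const, Fintype.card_fin, smul_eq_mul] at htot
  exact htot.symm

end LinearImages

/-! ### Uniform inputs -/

section Uniform

variable {δ : Type*} [Fintype δ]

lemma sum_negMulLog_uniform {p : δ → ℝ} [Nonempty δ] (hp : ∀ b, p b = 1 / Fintype.card δ) :
    ∑ b, Real.negMulLog (p b) = Real.log (Fintype.card δ) := by
  have h : (Fintype.card δ : ℝ) ≠ 0 := by simp
  simp only [hp, Finset.sum_const, Finset.card_univ, nsmul_eq_mul, Real.negMulLog, one_div,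
    Real.log_inv]
  field_simp

lemma entropyFn_le_log_card_support [DecidableEq δ] {p : δ → ℝ} (h0 : ∀ a, 0 ≤ p a) (h1 : ∑ a, p a = 1)
    {S : Finset δ} (hS : ∀ a, 0 < p a → a ∈ S) : entropyFn p ≤ Real.log S.card := by
  have hSne : S.Nonempty := by
    by_contra h
    rw [Finset.not_nonempty_iff_eq_empty] at h
    have : ∀ a, p a = 0 := fun a => by
      by_contra hne
      have := hS a (lt_of_le_of_ne (h0 a) (Ne.symm hne))
      simp [h] at this
    simp [this] at h1
  have hc : (0 : ℝ) < S.card := by exact_mod_cast hSne.card_pos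
  have h := entropyFn_le_cross h0 h1 (q := fun a => if a ∈ S then (S.card : ℝ)⁻¹ else 0)
    (fun a ha => by rw [if_pos (hS a ha)]; positivity) (fun a => by split_ifs <;> positivity)
    (by simp [hc.ne'])
  refine h.trans_eq ?_
  have : ∀ a, p a * Real.log (if a ∈ S then (S.card : ℝ)⁻¹ else 0) =
      p a * (-Real.log S.card) := by
    intro a
    rcases (h0 a).eq_or_lt with h | h
    · simp [← h]
    · rw [if_pos (hS a h), Real.log_inv]
  simp only [this, ← Finset.sum_mul, h1]
  ring

variable {α : Type*} [Fintype α] [MeasurableSpace α] [MeasurableSingletonClass α]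

lemma uniformOn_univ_real (s : Finset α) :
    (uniformOn (Set.univ : Set α)).real s = s.card / Fintype.card α := by
  have h := lintegral_uniformOn (Finset.univ : Finset α) ((s : Set α).indicator 1)
  rw [lintegral_indicator_one s.measurableSet, Finset.coe_univ] at h
  have h2 : ∑ x : α, (s : Set α).indicator (1 : α → ENNReal) x = s.card := by
    classical
    simp [Set.indicator_apply]
  rw [measureReal_def, h, h2, ENNReal.toReal_mul, ENNReal.toReal_inv, ENNReal.toReal_natCast,
    ENNReal.toReal_natCast, Finset.card_univ, div_eq_inv_mul]

lemma fst_map_real_singleton {δ 𝓩 : Type*} [MeasurableSpace 𝓩] [DecidableEq δ]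
    [MeasurableSpace δ] [MeasurableSingletonClass δ] {ρ : Measure (α × 𝓩)} (hρ : ρ.fst = uniformOn Set.univ)
    {𝓩' : Type*} [MeasurableSpace 𝓩']
    {f : α × 𝓩 → δ × 𝓩'} (hf : Measurable f) {g : α → δ}
    (hfg : ∀ p, (f p).1 = g p.1) (b : δ) :
    (ρ.map f).fst.real {b} =
      (Finset.univ.filter fun a => g a = b).card / Fintype.card α := by
  rw [← uniformOn_univ_real, ← hρ, Measure.fst, map_measureReal_apply measurable_fst (by simp),
    map_measureReal_apply hf (measurable_fst (by simp)), Measure.fst,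
    map_measureReal_apply measurable_fst (Finset.measurableSet _)]
  congr 1
  ext p
  simp [hfg]

end Uniform

/-! ### Mutual informations in terms of conditional entropies. -/

section Info

variable {m : ℕ} {𝓩 : Type*} [MeasurableSpace 𝓩] (W : Kernel (Input m) 𝓩) [IsMarkovKernel W]

lemma log_two_pos : 0 < Real.log 2 := Real.log_pos (by norm_num)

lemma fst_jointLaw : (jointLaw W).fst = uniformOn Set.univ := by
  rw [jointLaw, Measure.fst_compProd]

/-- Restriction to `J` and its complement. -/
def restrictEquiv (J : Finset (Fin m)) :
    Input m ≃ (J → ZMod 2) × ((Jᶜ : Finset (Fin m)) → ZMod 2) where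
  toFun x := (J.restrict x, (Jᶜ : Finset (Fin m)).restrict x)
  invFun p k := if h : k ∈ J then p.1 ⟨k, h⟩ else p.2 ⟨k, by simpa using h⟩
  left_inv x := by
    funext k
    by_cases h : k ∈ J <;> simp [h]
  right_inv p := by
    refine Prod.ext (funext fun k => ?_) (funext fun k => ?_)
    · simp
    · have : (k : Fin m) ∉ J := Finset.mem_compl.1 k.2
      simp [this]

/-- Chain rule: H(X[J] | Y X[Jᶜ]) = H(X | Y) − H(X[Jᶜ] | Y). The integrality of I[J] is thus a
question about conditional entropies given Y alone. -/
lemma info_mul_log_two (J : Finset (Fin m)) :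
    info W J * Real.log 2 = J.card * Real.log 2 - (posteriorMean entropyFn (jointLaw W) -
      posteriorMean entropyFn ((jointLaw W).map
        fun p => ((Jᶜ : Finset (Fin m)).restrict p.1, p.2))) := by
  have h := mutualInfo_mul_log_two (splitLaw (restrictEquiv J) (jointLaw W))
  rw [posteriorMean_entropyFn_splitLaw] at h
  refine h.trans ?_
  congr 1
  rw [sum_negMulLog_uniform]
  · simp [Real.log_pow]
  · intro b
    rw [splitLaw, fst_map_real_singleton (fst_jointLaw W) (measurable_splitLaw_map _)
      (g := fun x => (restrictEquiv J x).1) fun p => rfl]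
    have h1 : (Finset.univ.filter fun x : Input m => (restrictEquiv J x).1 = b).card =
        Fintype.card ((Jᶜ : Finset (Fin m)) → ZMod 2) := by
      rw [← Finset.card_univ]
      refine Finset.card_bij' (fun x _ => (restrictEquiv J x).2)
        (fun c _ => (restrictEquiv J).symm (b, c)) (by simp) (by simp) ?_ (by simp)
      intro x hx
      rw [← (Finset.mem_filter.1 hx).2, Prod.mk.eta, Equiv.symm_apply_apply]
    rw [h1, Fintype.card_congr (restrictEquiv J), Fintype.card_prod, Nat.cast_mul]
    have h2 : (Fintype.card ((Jᶜ : Finset (Fin m)) → ZMod 2) : ℝ) ≠ 0 := by simp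
    field_simp

lemma posteriorMean_entropyFn_nonneg {α : Type*} [Fintype α] [Nonempty α] [MeasurableSpace α]
    [MeasurableSingletonClass α] (ρ : Measure (α × 𝓩)) [IsProbabilityMeasure ρ] :
    0 ≤ posteriorMean entropyFn ρ :=
  integral_nonneg fun z => entropyFn_nonneg (fun a => posterior_nonneg ρ a z) (sum_posterior ρ z)

lemma posteriorMean_entropyFn_of_subsingleton {α : Type*} [Fintype α] [Nonempty α]
    [Subsingleton α] [MeasurableSpace α] [MeasurableSingletonClass α] (ρ : Measure (α × 𝓩))
    [IsProbabilityMeasure ρ] : posteriorMean entropyFn ρ = 0 := by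
  have : ∀ q : α → ℝ, entropyFn q = 0 := by
    intro q
    obtain ⟨a⟩ := ‹Nonempty α›
    have := uniqueOfSubsingleton a
    simp [entropyFn]
  simp [posteriorMean, this]

lemma uniformSumRate_mul_log_two :
    uniformSumRate W * Real.log 2 =
      m * Real.log 2 - posteriorMean entropyFn (jointLaw W) := by
  have hsub : Subsingleton (((Finset.univ : Finset (Fin m))ᶜ : Finset (Fin m)) → ZMod 2) := by
    have : IsEmpty ((Finset.univ : Finset (Fin m))ᶜ : Finset (Fin m)) :=
      ⟨fun k => Finset.mem_compl.1 k.2 (Finset.mem_univ _)⟩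
    infer_instance
  have hprob : IsProbabilityMeasure ((jointLaw W).map
      fun p => (((Finset.univ : Finset (Fin m))ᶜ : Finset (Fin m)).restrict p.1, p.2)) :=
    Measure.isProbabilityMeasure_map (by fun_prop)
  rw [uniformSumRate, info_mul_log_two, Finset.card_univ, Fintype.card_fin,
    posteriorMean_entropyFn_of_subsingleton ((jointLaw W).map
      fun p => (((Finset.univ : Finset (Fin m))ᶜ : Finset (Fin m)).restrict p.1, p.2)), sub_zero]

lemma uniformSumRate_le : uniformSumRate W ≤ m := by
  have h := uniformSumRate_mul_log_two W
  have h2 := posteriorMean_entropyFn_nonneg (jointLaw W)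
  nlinarith [log_two_pos]

variable {r : ℕ} (A : Matrix (Fin r) (Fin m) (ZMod 2))

/-- The joint law of the linear forms `A X` and the output. -/
def linearLaw {𝓩 : Type*} [MeasurableSpace 𝓩] (ρ : Measure (Input m × 𝓩)) {r : ℕ}
    (A : Matrix (Fin r) (Fin m) (ZMod 2)) : Measure ((Fin r → ZMod 2) × 𝓩) :=
  ρ.map fun p => (A *ᵥ p.1, p.2)

lemma measurable_linearLaw_map :
    Measurable fun p : Input m × 𝓩 => (A *ᵥ p.1, p.2) := by
  have : Measurable fun x : Input m => A *ᵥ x := measurable_of_finite _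
  fun_prop

instance isProbabilityMeasure_linearLaw (ρ : Measure (Input m × 𝓩)) [IsProbabilityMeasure ρ] :
    IsProbabilityMeasure (linearLaw ρ A) :=
  Measure.isProbabilityMeasure_map (measurable_linearLaw_map A).aemeasurable

lemma linearInfo_mul_log_two :
    linearInfo W A * Real.log 2 =
      ∑ b, Real.negMulLog ((linearLaw (jointLaw W) A).fst.real {b}) -
        posteriorMean entropyFn (linearLaw (jointLaw W) A) :=
  mutualInfo_mul_log_two (linearLaw (jointLaw W) A)

lemma linearInfo_mul_log_two_of_surjective (hA : Function.Surjective fun x => A *ᵥ x) :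
    linearInfo W A * Real.log 2 =
      r * Real.log 2 - posteriorMean entropyFn (linearLaw (jointLaw W) A) := by
  rw [linearInfo_mul_log_two, sum_negMulLog_uniform]
  · simp [Real.log_pow]
  · intro b
    rw [linearLaw, fst_map_real_singleton (fst_jointLaw W) (measurable_linearLaw_map A)
      (g := fun x => A *ᵥ x) fun p => rfl]
    have h := card_fiber_mulVec hA b
    have h' : (2 : ℝ) ^ r * ((Finset.univ.filter fun x => A *ᵥ x = b).card : ℝ) = 2 ^ m := by
      have := congrArg (Nat.cast : ℕ → ℝ) h
      push_cast at this
      simpa using this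
    simp only [Fintype.card_pi, ZMod.card, Finset.prod_const, Finset.card_univ, Fintype.card_fin]
    push_cast
    rw [div_eq_div_iff (by positivity) (by positivity)]
    linarith

/-- AX lives on the range of A, which has 2^rank points. No surjectivity is assumed, since the
matrix of a code is known only through its information. -/
lemma linearInfo_le_rank :
    linearInfo W A * Real.log 2 ≤
      A.rank * Real.log 2 - posteriorMean entropyFn (linearLaw (jointLaw W) A) := by
  classical
  rw [linearInfo_mul_log_two]
  gcongr
  set p : (Fin r → ZMod 2) → ℝ := fun b => (linearLaw (jointLaw W) A).fst.real {b} with hp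
  have hp1 : ∑ b, p b = 1 := by simp [hp]
  have hsupp : ∀ b, 0 < p b → b ∈ Finset.univ.filter fun b => b ∈ LinearMap.range A.mulVecLin := by
    intro b hb
    simp only [hp, linearLaw] at hb
    rw [fst_map_real_singleton (fst_jointLaw W) (measurable_linearLaw_map A)
      (g := fun x => A *ᵥ x) fun p => rfl] at hb
    by_contra hne
    rw [Finset.filter_eq_empty_iff.2] at hb
    · simp at hb
    · intro x _ hx
      exact hne (by simp [← hx])
  have h := entropyFn_le_log_card_support (fun b => measureReal_nonneg) hp1 hsupp
  rw [entropyFn_of_sum_eq_one hp1] at h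
  refine h.trans_eq ?_
  have hcard : (Finset.univ.filter fun b => b ∈ LinearMap.range A.mulVecLin).card =
      2 ^ A.rank := by
    rw [← Fintype.card_subtype]
    have := Module.card_eq_pow_finrank (K := ZMod 2) (V := LinearMap.range A.mulVecLin)
    rw [ZMod.card] at this
    rw [Matrix.rank, ← this]
  rw [hcard]
  push_cast
  rw [Real.log_pow]

variable {W A}

lemma posteriorMean_entropyFn_linearLaw_lt {γ : ℝ} (h : (r : ℝ) - γ < linearInfo W A) :
    posteriorMean entropyFn (linearLaw (jointLaw W) A) < γ * Real.log 2 := by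
  have h1 := linearInfo_le_rank W A
  have h2 : (A.rank : ℝ) ≤ r := by
    exact_mod_cast (A.rank_le_height)
  nlinarith [log_two_pos]

/-- Linear forms that are almost determined by the output are independent. -/
lemma rank_eq_of_lt_linearInfo {γ : ℝ} (hγ : γ ≤ 1) (h : (r : ℝ) - γ < linearInfo W A) :
    A.rank = r := by
  have h1 := linearInfo_le_rank W A
  have h2 := posteriorMean_entropyFn_nonneg (linearLaw (jointLaw W) A)
  refine le_antisymm A.rank_le_height ?_
  by_contra hlt
  have h3 : (A.rank : ℝ) + 1 ≤ r := by exact_mod_cast not_le.1 hlt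
  nlinarith [log_two_pos]

/-- Column rank equals row rank: the columns span a space of dimension r, so r of them form a basis.
These give the users that send data. -/
lemma exists_linearIndependent_cols (hA : A.rank = r) :
    ∃ sel : Fin r ↪ Fin m, LinearIndependent (ZMod 2) fun j => A.col (sel j) := by
  obtain ⟨f, hf, -, hli⟩ :=
    Submodule.exists_fun_fin_finrank_span_eq (ZMod 2) (Set.range A.col)
  have hr : r = Module.finrank (ZMod 2) (Submodule.span (ZMod 2) (Set.range A.col)) := by
    rw [← Matrix.rank_eq_finrank_span_cols, hA]
  have hli' := hli.comp _ (Fin.cast_injective hr)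
  choose sel hsel using hf
  have heq : (fun j => A.col (sel (Fin.cast hr j))) = f ∘ Fin.cast hr := funext fun j => hsel _
  refine ⟨⟨fun j => sel (Fin.cast hr j), fun i j hij => ?_⟩, ?_⟩
  · refine hli'.injective ?_
    rw [← heq]
    exact congrArg A.col hij
  · change LinearIndependent _ fun j => A.col (sel (Fin.cast hr j))
    rwa [heq]

end Info

/-! ### Channels whose linear forms are extremal are polarized -/

section Extremal

variable {ι 𝓩 : Type*} [Fintype ι] [DecidableEq ι] [MeasurableSpace 𝓩]

lemma posteriorMean_le_sum_bhatt {r : ℕ} (A : Matrix (Fin r) ι (ZMod 2))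
    (ρ : Measure ((ι → ZMod 2) × 𝓩)) [IsProbabilityMeasure ρ] :
    posteriorMean (fun w => entropyFn (pushSum (fun x => A *ᵥ x) w)) ρ ≤
      ∑ j, 2 * bhatt (A j) ρ := by
  have hint : ∀ j, Integrable (fun z => 2 * bhattFn (A j) fun x => posterior ρ x z) ρ.snd :=
    fun j => (integrable_bhattFn_posterior (A j) ρ).const_mul 2
  have h : posteriorMean (fun w => entropyFn (pushSum (fun x => A *ᵥ x) w)) ρ ≤
      ∫ z, ∑ j, 2 * bhattFn (A j) (fun x => posterior ρ x z) ∂ρ.snd :=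
    integral_mono (integrable_entropyFn_posterior ρ fun x => A *ᵥ x)
      (integrable_finsetSum _ fun j _ => hint j) fun z =>
        entropyFn_pushSum_mulVec_le (fun x => posterior_nonneg ρ x z) (sum_posterior ρ z) A
  refine h.trans_eq ?_
  rw [integral_finsetSum _ fun j _ => hint j]
  exact Finset.sum_congr rfl fun j _ => integral_const_mul _ _

/-- If every linear form is almost determined or almost uniform given the output, then the
conditional entropy of the input is almost an integer number of bits. -/
lemma exists_matrix_of_extremal (ρ : Measure ((ι → ZMod 2) × 𝓩)) [IsProbabilityMeasure ρ]
    {θ τ : ℝ} (hθ : 0 ≤ θ) (hτ : 0 ≤ τ) (h : ∀ a, bhatt a ρ ≤ θ ∨ 1 - τ ≤ bhatt a ρ) :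
    ∃ (r : ℕ) (A : Matrix (Fin r) ι (ZMod 2)), r ≤ Fintype.card ι ∧
      LinearIndependent (ZMod 2) A.row ∧ (∀ j, bhatt (A j) ρ ≤ θ) ∧
      posteriorMean entropyFn ρ ≤
        ((Fintype.card ι : ℝ) - r) * Real.log 2 + Fintype.card ι * (2 * θ) ∧
      ((Fintype.card ι : ℝ) - r) * Real.log 2 - 2 ^ Fintype.card ι * (2 * τ) ≤
        posteriorMean entropyFn ρ := by
  classical
  -- A basis of the span S is extracted from the small forms themselves. S may contain forms that
  -- are not small; only the basis and the forms outside S matter.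
  have hex := Submodule.exists_fun_fin_finrank_span_eq (ZMod 2) {a : ι → ZMod 2 | bhatt a ρ ≤ θ}
  obtain ⟨S, hS⟩ : ∃ S, S = Submodule.span (ZMod 2) {a : ι → ZMod 2 | bhatt a ρ ≤ θ} := ⟨_, rfl⟩
  obtain ⟨r, hr⟩ : ∃ r, r = Module.finrank (ZMod 2) S := ⟨_, rfl⟩
  rw [← hS, ← hr] at hex
  obtain ⟨A, hAmem, -, hAli⟩ := hex
  have hrle : r ≤ Fintype.card ι := by
    have := Submodule.finrank_le S
    rwa [Module.finrank_fintype_fun_eq_card, ← hr] at this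
  have hsurj := mulVec_surjective_of_linearIndependent (A := Matrix.of A) hAli
  have hpost0 : ∀ x z, 0 ≤ posterior ρ x z := posterior_nonneg ρ
  have hpost1 : ∀ z, ∑ x, posterior ρ x z = 1 := sum_posterior ρ
  have hint : Integrable (fun z => entropyFn fun x => posterior ρ x z) ρ.snd := by
    simpa using integrable_entropyFn_posterior ρ (id : (ι → ZMod 2) → (ι → ZMod 2))
  refine ⟨r, Matrix.of A, hrle, hAli, hAmem, ?_, ?_⟩
  -- Upper bound: given AX, the input ranges over a fibre of size 2^(card ι − r), and AX itself has
  -- small conditional entropy.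
  · have hfib : ∀ b, (Finset.univ.filter fun x => Matrix.of A *ᵥ x = b).card ≤
        2 ^ (Fintype.card ι - r) := by
      intro b
      have h1 := card_fiber_mulVec hsurj b
      have h2 : 2 ^ r * 2 ^ (Fintype.card ι - r) = 2 ^ Fintype.card ι := by
        rw [← pow_add]; congr 1; omega
      exact (Nat.eq_of_mul_eq_mul_left (by positivity) (h1.trans h2.symm)).le
    have hpt : ∀ z, entropyFn (fun x => posterior ρ x z) ≤
        entropyFn (pushSum (fun x => Matrix.of A *ᵥ x) fun x => posterior ρ x z) +
          ((Fintype.card ι : ℝ) - r) * Real.log 2 := by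
      intro z
      have h1 := entropyFn_le_pushSum_add_log (fun x => hpost0 x z) (hpost1 z)
        (fun x => Matrix.of A *ᵥ x) (N := 2 ^ (Fintype.card ι - r)) (by positivity) hfib
      push_cast at h1
      rwa [Real.log_pow, Nat.cast_sub hrle] at h1
    have hmean := integral_mono hint ((integrable_entropyFn_posterior ρ
      fun x => Matrix.of A *ᵥ x).add (integrable_const _)) hpt
    have hadd := integral_add (integrable_entropyFn_posterior ρ fun x => Matrix.of A *ᵥ x)
      (integrable_const (((Fintype.card ι : ℝ) - r) * Real.log 2) : Integrable _ ρ.snd)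
    have hle := posteriorMean_le_sum_bhatt (Matrix.of A) ρ
    have hsum : ∑ j : Fin r, 2 * bhatt (Matrix.of A j) ρ ≤ Fintype.card ι * (2 * θ) := by
      calc ∑ j : Fin r, 2 * bhatt (Matrix.of A j) ρ ≤ ∑ j : Fin r, 2 * θ := by
            refine Finset.sum_le_sum fun j _ => ?_
            have : bhatt (Matrix.of A j) ρ ≤ θ := hAmem j
            linarith
        _ = r * (2 * θ) := by simp
        _ ≤ _ := by gcongr
    unfold posteriorMean at hle ⊢
    have hconst : ∫ _, ((Fintype.card ι : ℝ) - r) * Real.log 2 ∂ρ.snd =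
        ((Fintype.card ι : ℝ) - r) * Real.log 2 := by simp
    have := hmean.trans_eq hadd
    linarith
  -- Lower bound: a form outside S is not small, hence is almost uniform by the dichotomy, and the
  -- Fourier criterion applies with T = S.
  · set T : Finset (ι → ZMod 2) := Finset.univ.filter fun a => a ∈ S with hT
    have hTne : T.Nonempty := ⟨0, by simp [hT]⟩
    have hTcard : T.card = 2 ^ r := by
      rw [hT, ← Fintype.card_subtype]
      have := Module.card_eq_pow_finrank (K := ZMod 2) (V := S)
      rw [ZMod.card] at this
      rw [hr, ← this]
    have hbint : ∀ a, Integrable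
        (fun z => 2 * (1 - bhattFn a fun x => posterior ρ x z)) ρ.snd := fun a =>
      ((integrable_const (1 : ℝ)).sub (integrable_bhattFn_posterior a ρ)).const_mul 2
    have hpt : ∀ z, ((Fintype.card ι : ℝ) - r) * Real.log 2 -
        ∑ a ∈ Tᶜ, 2 * (1 - bhattFn a fun x => posterior ρ x z) ≤
          entropyFn fun x => posterior ρ x z := by
      intro z
      have h1 := le_entropyFn_of_fourier (fun x => hpost0 x z) (hpost1 z) hTne
      rw [hTcard] at h1
      push_cast at h1
      rw [Real.log_pow] at h1
      linarith
    have hmean := integral_mono ((integrable_const _).sub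
      (integrable_finsetSum Tᶜ fun a _ => hbint a)) hint hpt
    have hsub := integral_sub (integrable_const (((Fintype.card ι : ℝ) - r) * Real.log 2))
      (integrable_finsetSum Tᶜ fun a _ => hbint a)
    have hsumint : ∫ z, ∑ a ∈ Tᶜ, 2 * (1 - bhattFn a fun x => posterior ρ x z) ∂ρ.snd =
        ∑ a ∈ Tᶜ, 2 * (1 - bhatt a ρ) := by
      refine (integral_finsetSum Tᶜ fun a _ => hbint a).trans ?_
      refine Finset.sum_congr rfl fun a _ => ?_
      refine (integral_const_mul _ _).trans ?_
      congr 1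
      refine (integral_sub (integrable_const _) (integrable_bhattFn_posterior a ρ)).trans ?_
      simp [bhatt, posteriorMean]
    have hbound : ∑ a ∈ Tᶜ, 2 * (1 - bhatt a ρ) ≤ 2 ^ Fintype.card ι * (2 * τ) := by
      calc ∑ a ∈ Tᶜ, 2 * (1 - bhatt a ρ) ≤ ∑ a ∈ Tᶜ, 2 * τ := by
            refine Finset.sum_le_sum fun a ha => ?_
            have hna : a ∉ S := by simpa [hT] using ha
            have : 1 - τ ≤ bhatt a ρ := (h a).resolve_left fun hsmall =>
              hna (hS ▸ Submodule.subset_span hsmall)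
            linarith
        _ ≤ ∑ a : ι → ZMod 2, 2 * τ :=
            Finset.sum_le_sum_of_subset_of_nonneg (Finset.subset_univ _)
              fun _ _ _ => by positivity
        _ = _ := by simp
    unfold posteriorMean
    have hconst : ∫ _, ((Fintype.card ι : ℝ) - r) * Real.log 2 ∂ρ.snd =
        ((Fintype.card ι : ℝ) - r) * Real.log 2 := by simp
    have := hsub.symm.trans_le hmean
    linarith

/-- The extension of a linear form by zero. -/
def extendForm (K : Finset ι) (c : K → ZMod 2) : ι → ZMod 2 :=
  fun k => if h : k ∈ K then c ⟨k, h⟩ else 0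

lemma dotProduct_restrict (K : Finset ι) (c : K → ZMod 2) (x : ι → ZMod 2) :
    c ⬝ᵥ K.restrict x = extendForm K c ⬝ᵥ x := by
  simp only [dotProduct, extendForm, Finset.restrict]
  rw [← Finset.sum_subset (Finset.subset_univ K) (fun k _ hk => by simp [hk]),
    ← Finset.sum_coe_sort K]
  exact Finset.sum_congr rfl fun k _ => by simp

/-- A form on a subset of the users is a form on all of them, so the dichotomy passes to subsets. -/
lemma bhatt_map_restrict (K : Finset ι) (c : K → ZMod 2) (ρ : Measure ((ι → ZMod 2) × 𝓩))
    [IsProbabilityMeasure ρ] [IsProbabilityMeasure (ρ.map fun p => (K.restrict p.1, p.2))] :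
    bhatt c (ρ.map fun p => (K.restrict p.1, p.2)) = bhatt (extendForm K c) ρ := by
  unfold bhatt
  refine (posteriorMean_map_fst ρ K.restrict fun _ hc w => bhattFn_const_mul c w hc).trans ?_
  simp only [bhattFn, pushSum_comp, dotProduct_restrict]
  rfl

end Extremal

section Polarized

variable {m : ℕ} {𝓩 : Type*} [MeasurableSpace 𝓩] (W : Kernel (Input m) 𝓩) [IsMarkovKernel W]

lemma posteriorMean_linearLaw_le {r : ℕ} (A : Matrix (Fin r) (Fin m) (ZMod 2)) :
    posteriorMean entropyFn (linearLaw (jointLaw W) A) ≤ ∑ j, 2 * bhatt (A j) (jointLaw W) :=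
  (posteriorMean_map_fst (jointLaw W) (fun x => A *ᵥ x) fun _ _ _ => entropyFn_const_mul).trans_le
    (posteriorMean_le_sum_bhatt A (jointLaw W))

/-- A channel all of whose linear forms are extremal is polarized. -/
lemma isPolarized_of_extremal {θ τ ε γ : ℝ} (hθ : 0 ≤ θ) (hτ : 0 ≤ τ)
    (h : ∀ a, bhatt a (jointLaw W) ≤ θ ∨ 1 - τ ≤ bhatt a (jointLaw W))
    (hε : 2 * (m * (2 * θ) + 2 ^ m * (2 * τ)) < ε * Real.log 2)
    (hγ : m * (2 * θ) < γ * Real.log 2) : IsPolarized W ε γ := by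
  have hlog := log_two_pos
  have hm0 : (0 : ℝ) ≤ m := Nat.cast_nonneg m
  have hE1 : 0 ≤ m * (2 * θ) := by positivity
  have hE2 : 0 ≤ 2 ^ m * (2 * τ) := by positivity
  obtain ⟨r, A, hr, hli, hA, hup, hlow⟩ := exists_matrix_of_extremal (jointLaw W) hθ hτ h
  rw [Fintype.card_fin] at hr hup hlow
  refine ⟨fun J => ?_, r, A, ?_, ?_⟩
  · set K : Finset (Fin m) := Jᶜ with hK
    have hprob : IsProbabilityMeasure ((jointLaw W).map fun p => (K.restrict p.1, p.2)) :=
      Measure.isProbabilityMeasure_map (by fun_prop)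
    obtain ⟨rK, -, -, -, -, hupK, hlowK⟩ := exists_matrix_of_extremal
      ((jointLaw W).map fun p => (K.restrict p.1, p.2)) hθ hτ fun c => by
        rw [bhatt_map_restrict]
        exact h _
    have hcard : Fintype.card K ≤ m := by
      rw [Fintype.card_coe]
      exact (Finset.card_le_univ K).trans_eq (Fintype.card_fin m)
    have hcard' : (Fintype.card K : ℝ) * (2 * θ) ≤ m * (2 * θ) := by gcongr
    have hpow : (2 : ℝ) ^ Fintype.card K * (2 * τ) ≤ 2 ^ m * (2 * τ) := by
      gcongr
      norm_num
    have hinfo := info_mul_log_two W J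
    -- Replace H(X | Y) by m − r and H(X[Jᶜ] | Y) by |Jᶜ| − rK bits in the chain rule. The two
    -- approximations account for the factor 2 in `hε`.
    refine ⟨(J.card : ℤ) - (m - r) + (Fintype.card K - rK), ?_⟩
    push_cast
    have hmul : |info W J - ((J.card : ℝ) - (m - r) + (Fintype.card K - rK))| * Real.log 2 <
        ε * Real.log 2 := by
      rw [← abs_of_pos hlog, ← abs_mul, abs_of_pos hlog, sub_mul, hinfo, abs_lt]
      constructor <;> nlinarith
    exact lt_of_mul_lt_mul_right hmul hlog.le
  · have hrate := uniformSumRate_mul_log_two W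
    have hmul : |uniformSumRate W - r| * Real.log 2 < ε * Real.log 2 := by
      rw [← abs_of_pos hlog, ← abs_mul, abs_of_pos hlog, sub_mul, hrate, abs_lt]
      constructor <;> nlinarith
    exact lt_of_mul_lt_mul_right hmul hlog.le
  · have hinfo := linearInfo_mul_log_two_of_surjective W A
      (mulVec_surjective_of_linearIndependent hli)
    have hle : ∑ j, 2 * bhatt (A j) (jointLaw W) ≤ m * (2 * θ) := by
      calc ∑ j, 2 * bhatt (A j) (jointLaw W) ≤ ∑ j : Fin r, 2 * θ :=
            Finset.sum_le_sum fun j _ => by linarith [hA j]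
        _ = r * (2 * θ) := by simp
        _ ≤ _ := by gcongr
    have := posteriorMean_linearLaw_le W A
    refine lt_of_mul_lt_mul_right ?_ hlog.le
    rw [hinfo, sub_mul]
    linarith

end Polarized

/-! ### Estimators -/

/-- The estimate is the value of posterior probability above 1/2, or 0 if there is none. Written as
a sum, it is visibly measurable. -/
lemma exists_estimator {V 𝓩 : Type*} [AddCommMonoid V] [Fintype V] [MeasurableSpace V]
    [DiscreteMeasurableSpace V] [MeasurableSpace 𝓩] (ρ : Measure (V × 𝓩))
    [IsProbabilityMeasure ρ] :
    ∃ est : 𝓩 → V, Measurable est ∧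
      ρ.real {p | est p.2 ≠ p.1} ≤ 2 * posteriorMean entropyFn ρ := by
  classical
  set est : 𝓩 → V := fun z => ∑ b, if 1 / 2 < posterior ρ b z then b else 0 with hest
  have hm : Measurable est := by
    have : MeasurableAdd₂ V := ⟨measurable_of_finite _⟩
    refine Finset.measurable_sum _ fun b _ => Measurable.ite ?_ measurable_const measurable_const
    exact measurableSet_lt measurable_const (measurable_posterior ρ b)
  refine ⟨est, hm, ?_⟩
  have hset : MeasurableSet {p : V × 𝓩 | est p.2 ≠ p.1} :=
    (measurableSet_eq_fun (hm.comp measurable_snd) measurable_fst).compl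
  have hind : ∀ a, Measurable fun z => if est z ≠ a then posterior ρ a z else 0 := fun a =>
    Measurable.ite (hm (MeasurableSet.of_discrete (s := {a}))).compl (measurable_posterior ρ a)
      measurable_const
  have hnn : ∀ a z, 0 ≤ if est z ≠ a then posterior ρ a z else 0 := by
    intro a z
    split_ifs
    exacts [posterior_nonneg ρ a z, le_rfl]
  have hlint : ρ {p | est p.2 ≠ p.1} =
      ∫⁻ z, ENNReal.ofReal (∑ a, if est z ≠ a then posterior ρ a z else 0) ∂ρ.snd := by
    rw [← lintegral_indicator_one hset,
      (hasDensity_posterior ρ).lintegral_eq _ (measurable_one.indicator hset)]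
    refine lintegral_congr fun z => ?_
    rw [ENNReal.ofReal_sum_of_nonneg fun a _ => hnn a z]
    refine Finset.sum_congr rfl fun a _ => ?_
    by_cases h : est z = a <;> simp [Set.indicator, h]
  rw [measureReal_def, hlint, ← integral_eq_lintegral_of_nonneg_ae
    (ae_of_all _ fun z => Finset.sum_nonneg fun a _ => hnn a z)
    (Finset.measurable_sum _ fun a _ => hind a).aestronglyMeasurable, posteriorMean,
    ← integral_const_mul]
  have hint : Integrable (fun z => entropyFn fun a => posterior ρ a z) ρ.snd := by
    simpa using integrable_entropyFn_posterior ρ (id : V → V)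
  refine integral_mono_of_nonneg (ae_of_all _ fun z => Finset.sum_nonneg fun a _ => hnn a z)
    (hint.const_mul 2) (ae_of_all _ fun z => ?_)
  exact majority_error_le (fun a => posterior_nonneg ρ a z) (sum_posterior ρ z)

lemma exists_stage {m : ℕ} {𝓩 : Type*} [MeasurableSpace 𝓩] (W : Kernel (Input m) 𝓩)
    [IsMarkovKernel W] {ε γ : ℝ} (hγ0 : 0 ≤ γ) (hγ1 : γ ≤ 1) :
    ∃ (r : ℕ) (A : Matrix (Fin r) (Fin m) (ZMod 2)) (sel : Fin r ↪ Fin m)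
      (est : 𝓩 → Fin r → ZMod 2), (LinearIndependent (ZMod 2) fun j => A.col (sel j)) ∧
      Measurable est ∧ (IsPolarized W ε γ → IsGoodMatrix W ε γ A) ∧
      (¬ IsPolarized W ε γ → r = 0) ∧
      (jointLaw W).real {p | est p.2 ≠ A *ᵥ p.1} ≤ 2 * (γ * Real.log 2) := by
  by_cases hW : IsPolarized W ε γ
  · obtain ⟨-, r, A, hA⟩ := id hW
    obtain ⟨sel, hsel⟩ := exists_linearIndependent_cols (rank_eq_of_lt_linearInfo hγ1 hA.2)
    obtain ⟨est, hest, herr⟩ := exists_estimator (linearLaw (jointLaw W) A)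
    refine ⟨r, A, sel, est, hsel, hest, fun _ => hA, fun h => absurd hW h, ?_⟩
    have hset : MeasurableSet {p : (Fin r → ZMod 2) × 𝓩 | est p.2 ≠ p.1} :=
      (measurableSet_eq_fun (hest.comp measurable_snd) measurable_fst).compl
    have hmap : (linearLaw (jointLaw W) A).real {p | est p.2 ≠ p.1} =
        (jointLaw W).real {p | est p.2 ≠ A *ᵥ p.1} :=
      map_measureReal_apply (measurable_linearLaw_map A) hset
    rw [← hmap]
    have := posteriorMean_entropyFn_linearLaw_lt hA.2
    exact herr.trans (by linarith)
  · refine ⟨0, 0, ⟨Fin.elim0, fun i => i.elim0⟩, fun _ => 0, linearIndependent_empty_type,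
      measurable_const, fun h => absurd h hW, fun _ => rfl, ?_⟩
    have : {p : Input m × 𝓩 | (0 : Fin 0 → ZMod 2) ≠
        (0 : Matrix (Fin 0) (Fin m) (ZMod 2)) *ᵥ p.1} = ∅ := by
      ext p
      simp
    rw [this, measureReal_empty]
    have := log_two_pos
    positivity

/-! ### Successive decoding -/

namespace PolarCode

variable {m l : ℕ} {𝓨 : Type*} [MeasurableSpace 𝓨] (c : PolarCode m l 𝓨)

lemma mem_activeUsers {i : Fin (2 ^ l)} {k : Fin m} :
    k ∈ c.activeUsers i ↔ ∃ j, c.sel i j = k := by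
  simp [activeUsers]

lemma card_activeUsers (i : Fin (2 ^ l)) : (c.activeUsers i).card = c.r i := by
  simp [activeUsers]

lemma sumRate_eq : c.sumRate = levelMean l fun i => (c.r i : ℝ) := by
  unfold sumRate levelMean
  congr 1
  simp only [← card_activeUsers, dataIndices, Finset.card_filter, Nat.cast_sum]
  rw [Finset.sum_comm]
  refine Finset.sum_congr rfl fun i _ => ?_
  rw [← Nat.cast_sum]
  congr 1
  simp

/-- Off the active users x and its frozen part agree, so A x − A f involves only the selected
columns, which form an invertible matrix. -/
lemma decodeStage_eq (i : Fin (2 ^ l)) (out : (Fin (2 ^ l) → 𝓨) × (Fin (i : ℕ) → Input m))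
    (x : Input m) (h : c.est i out = c.A i *ᵥ x) :
    c.decodeStage i out (fun k => if k ∈ c.activeUsers i then 0 else x k) = x := by
  set f : Input m := fun k => if k ∈ c.activeUsers i then 0 else x k with hf
  have hunit : IsUnit ((c.A i).submatrix id (c.sel i)) :=
    Matrix.linearIndependent_cols_iff_isUnit.1 (c.linearIndependent i)
  have hsub : c.A i *ᵥ x - c.A i *ᵥ f =
      (c.A i).submatrix id (c.sel i) *ᵥ fun j => x (c.sel i j) := by
    rw [← Matrix.mulVec_sub]
    funext a
    simp only [Matrix.mulVec, dotProduct, Matrix.submatrix_apply, id, Pi.sub_apply]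
    rw [← Finset.sum_subset (Finset.subset_univ (c.activeUsers i)), activeUsers, Finset.sum_map]
    · refine Finset.sum_congr rfl fun j _ => ?_
      have : c.sel i j ∈ c.activeUsers i := c.mem_activeUsers.2 ⟨j, rfl⟩
      simp [hf, this]
    · intro k _ hk
      simp [hf, hk]
  unfold decodeStage
  rw [h, hsub, Matrix.mulVec_mulVec, Matrix.nonsing_inv_mul _
    ((Matrix.isUnit_iff_isUnit_det _).1 hunit), Matrix.one_mulVec]
  funext k
  by_cases hk : ∃ j, c.sel i j = k
  · obtain ⟨j, rfl⟩ := hk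
    exact (c.sel i).injective.extend_apply _ _ j
  · rw [Function.extend_apply' _ _ _ hk, hf]
    simp only [c.mem_activeUsers, hk, if_false]

lemma decodeUpTo_eq (y : Fin (2 ^ l) → 𝓨) (u : Fin (2 ^ l) → Input m)
    (h : ∀ i : Fin (2 ^ l), c.est i (y, fun j : Fin (i : ℕ) => u (j.castLE i.isLt.le)) =
      c.A i *ᵥ u i) (i : ℕ) (hi : i ≤ 2 ^ l) :
    c.decodeUpTo y (c.frozenPart u) i hi = fun j => u (j.castLE hi) := by
  induction i with
  | zero => exact funext fun j => j.elim0
  | succ i ih =>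
    have ih' := ih (Nat.le_of_succ_le hi)
    rw [decodeUpTo, ih']
    funext j
    refine Fin.lastCases ?_ (fun j => ?_) j
    · rw [Fin.snoc_last]
      exact c.decodeStage_eq ⟨i, hi⟩ _ (u ⟨i, hi⟩) (h ⟨i, hi⟩)
    · rw [Fin.snoc_castSucc]
      rfl

/-- If every rule is right on the true past, then by induction all decisions are right. Errors can
therefore be counted with a genie-aided decoder, whose stages are the synthetic channels. -/
lemma exists_est_ne {y : Fin (2 ^ l) → 𝓨} {u : Fin (2 ^ l) → Input m}
    (h : c.decode y (c.frozenPart u) ≠ u) : ∃ i : Fin (2 ^ l),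
      c.est i (y, fun j : Fin (i : ℕ) => u (j.castLE i.isLt.le)) ≠ c.A i *ᵥ u i := by
  by_contra! hall
  exact h (c.decodeUpTo_eq y u hall _ le_rfl)

/-- The union bound over the stages of the decoder. -/
lemma blockErrorProb_le (P : Kernel (Input m) 𝓨) [IsMarkovKernel P] {δ : ℝ}
    (h : ∀ i, (jointLaw (synthChannel P l i)).real {p | c.est i p.2 ≠ c.A i *ᵥ p.1} ≤ δ) :
    c.blockErrorProb P ≤ 2 ^ l * δ := by
  have hsub : {p : (Fin (2 ^ l) → Input m) × (Fin (2 ^ l) → 𝓨) |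
      c.decode p.2 (c.frozenPart p.1) ≠ p.1} ⊆
      ⋃ i, synthMap m l 𝓨 i ⁻¹' {p | c.est i p.2 ≠ c.A i *ᵥ p.1} := by
    intro p hp
    obtain ⟨i, hi⟩ := c.exists_est_ne hp
    exact Set.mem_iUnion.2 ⟨i, hi⟩
  calc c.blockErrorProb P
      ≤ (blockLaw P l).real (⋃ i, synthMap m l 𝓨 i ⁻¹' {p | c.est i p.2 ≠ c.A i *ᵥ p.1}) :=
        measureReal_mono hsub
    _ ≤ ∑ i, (blockLaw P l).real (synthMap m l 𝓨 i ⁻¹' {p | c.est i p.2 ≠ c.A i *ᵥ p.1}) :=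
        measureReal_iUnion_fintype_le _
    _ ≤ ∑ _i : Fin (2 ^ l), δ := by
        refine Finset.sum_le_sum fun i _ => ?_
        have hset : MeasurableSet {p : Input m × ((Fin (2 ^ l) → 𝓨) × (Fin (i : ℕ) → Input m)) |
            c.est i p.2 ≠ c.A i *ᵥ p.1} := by
          have hA : Measurable fun x : Input m => c.A i *ᵥ x := measurable_of_finite _
          exact (measurableSet_eq_fun ((c.measurable_est i).comp measurable_snd)
            (hA.comp measurable_fst)).compl
        rw [← map_measureReal_apply (measurable_synthMap l i) hset, ← synthLaw_eq_map,
          ← jointLaw_synthChannel]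
        exact h i
    _ = 2 ^ l * δ := by simp

end PolarCode

lemma exists_polarCode {m : ℕ} {𝓨 : Type*} [MeasurableSpace 𝓨] (P : Kernel (Input m) 𝓨)
    [IsMarkovKernel P] (l : ℕ) {ε γ : ℝ} (hγ0 : 0 ≤ γ) (hγ1 : γ ≤ 1) :
    ∃ c : PolarCode m l 𝓨, c.IsPolarFor P ε γ ∧
      c.blockErrorProb P ≤ 2 ^ l * (2 * (γ * Real.log 2)) := by
  choose r A sel est hsel hest hgood hbad herr using fun i : Fin (2 ^ l) =>
    exists_stage (synthChannel P l i) (ε := ε) hγ0 hγ1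
  refine ⟨⟨r, A, sel, hsel, est, hest⟩, fun i => ⟨hgood i, fun h => ?_⟩,
    PolarCode.blockErrorProb_le _ P herr⟩
  rw [← Finset.card_eq_zero, PolarCode.card_activeUsers]
  exact hbad i h

/-- The sum rate of a code is at least the mean sum rate of the polarized synthetic channels. -/
lemma PolarCode.IsPolarFor.le_sumRate {m l : ℕ} {𝓨 : Type*} [MeasurableSpace 𝓨]
    {P : Kernel (Input m) 𝓨} [IsMarkovKernel P] {ε γ : ℝ} (hε : 0 ≤ ε) {c : PolarCode m l 𝓨}
    (hc : c.IsPolarFor P ε γ) {bad : Fin (2 ^ l) → ℝ} (hbad0 : ∀ i, 0 ≤ bad i)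
    (hbad : ∀ i, ¬ IsPolarized (synthChannel P l i) ε γ → 1 ≤ bad i) :
    uniformSumRate P - ε - m * levelMean l bad ≤ c.sumRate := by
  have hpt : ∀ i, uniformSumRate (synthChannel P l i) - ε - m * bad i ≤ c.r i := by
    intro i
    have hm : (0 : ℝ) ≤ m := Nat.cast_nonneg m
    have hr : (0 : ℝ) ≤ c.r i := Nat.cast_nonneg _
    by_cases h : IsPolarized (synthChannel P l i) ε γ
    · have h1 := (abs_lt.1 ((hc i).1 h).1).2
      have := mul_nonneg hm (hbad0 i)
      linarith
    · have h1 := uniformSumRate_le (synthChannel P l i)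
      have := mul_le_mul_of_nonneg_left (hbad i h) hm
      linarith
  have hmean := levelMean_mono hpt
  rw [levelMean_sub, levelMean_sub, levelMean_const_mul, levelMean_const, ← c.sumRate_eq] at hmean
  have hrate : levelMean l (fun i => uniformSumRate (synthChannel P l i)) = uniformSumRate P := by
    have h1 : ∀ W : Fin (2 ^ l) → ℝ, levelMean l W * Real.log 2 =
        levelMean l fun i => W i * Real.log 2 := by
      intro W
      simp only [levelMean, ← Finset.sum_mul]
      ring
    refine mul_right_cancel₀ log_two_pos.ne' ?_
    rw [h1]
    simp only [uniformSumRate_mul_log_two]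
    rw [levelMean_sub, levelMean_const, ← levelMean_entropy l]
    congr 2
    funext i
    exact posteriorMean_congr entropyFn (jointLaw_synthChannel P l i)
  linarith

/-! ### Choice of the thresholds -/

/-- The doubly exponentially decaying sequence `2 ^ (-n ^ b)`, `n = 2 ^ l`. -/
def decay (b : ℝ) (l : ℕ) : ℝ := (2 : ℝ) ^ (-((2 : ℝ) ^ (b * l)))

lemma decay_pos (b : ℝ) (l : ℕ) : 0 < decay b l := by
  unfold decay
  positivity

lemma decay_lt_one (b : ℝ) (l : ℕ) : decay b l < 1 :=
  Real.rpow_lt_one_of_one_lt_of_neg one_lt_two (neg_lt_zero.2 (by positivity))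

lemma eventually_add_rpow_le {a b : ℝ} (hab : a < b) (hb : 0 < b) (C : ℝ) :
    ∀ᶠ l : ℕ in atTop, (l : ℝ) + C + (2 : ℝ) ^ (a * l) ≤ (2 : ℝ) ^ (b * l) := by
  have hpow : ∀ (e : ℝ) (l : ℕ), (2 : ℝ) ^ (e * l) = ((2 : ℝ) ^ e) ^ l := fun e l => by
    rw [Real.rpow_mul two_pos.le, Real.rpow_natCast]
  have hy : (1 : ℝ) < 2 ^ b := Real.one_lt_rpow one_lt_two hb
  have hxy : (2 : ℝ) ^ a < 2 ^ b := Real.rpow_lt_rpow_of_exponent_lt one_lt_two hab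
  have h1 := tendsto_pow_const_div_const_pow_of_one_lt 1 hy
  have h2 := (tendsto_pow_const_div_const_pow_of_one_lt 0 hy).const_mul C
  have h3 : Tendsto (fun l : ℕ => ((2 : ℝ) ^ a / 2 ^ b) ^ l) atTop (nhds 0) :=
    tendsto_pow_atTop_nhds_zero_of_lt_one (by positivity) ((div_lt_one (by positivity)).2 hxy)
  have h := (h1.add h2).add h3
  rw [mul_zero, add_zero, add_zero] at h
  filter_upwards [h.eventually_le_const one_pos] with l hl
  rw [hpow, hpow]
  have hp : (0 : ℝ) < (2 ^ b) ^ l := by positivity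
  rw [div_pow, ← mul_div_assoc, ← add_div, ← add_div, div_le_one hp] at hl
  simpa using hl

/-- A smaller exponent absorbs any fixed multiple of n, such as the number of stages in the union
bound. -/
lemma eventually_two_pow_mul_decay_le {a b : ℝ} (hab : a < b) (hb : 0 < b) (k : ℕ) :
    ∀ᶠ l : ℕ in atTop, (2 : ℝ) ^ (l + k) * decay b l ≤ decay a l := by
  filter_upwards [eventually_add_rpow_le hab hb k] with l hl
  unfold decay
  rw [← Real.rpow_natCast, ← Real.rpow_add two_pos]
  refine Real.rpow_le_rpow_of_exponent_le one_le_two ?_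
  push_cast
  linarith

lemma tendsto_half_pow : Tendsto (fun l : ℕ => ((1 : ℝ) / 2) ^ l) atTop (nhds 0) :=
  tendsto_pow_atTop_nhds_zero_of_lt_one (by norm_num) (by norm_num)

lemma eventually_decay_le {a b : ℝ} (hab : a < b) (hb : 0 < b) :
    ∀ᶠ l : ℕ in atTop, decay b l ≤ (1 / 2) ^ l * decay a l := by
  filter_upwards [eventually_two_pow_mul_decay_le hab hb 0] with l hl
  rw [one_div, inv_pow, inv_mul_eq_div, le_div_iff₀ (by positivity), mul_comm]
  exact hl

lemma tendsto_decay {b : ℝ} (hb : 0 < b) : Tendsto (decay b) atTop (nhds 0) := by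
  refine tendsto_of_tendsto_of_tendsto_of_le_of_le' tendsto_const_nhds tendsto_half_pow
    (Eventually.of_forall fun l => (decay_pos b l).le) ?_
  filter_upwards [eventually_decay_le (half_lt_self hb) hb] with l hl
  exact hl.trans (mul_le_of_le_one_right (by positivity) (decay_lt_one _ l).le)

/-! ### Simultaneous polarization of finitely many arrays. -/

section Indicator

variable {ι : Type*} [Fintype ι]

/-- A weight that is at least `1` as soon as some `Z a` is neither at most `θ` nor at least
`1 - τ`. -/
def badWeight (θ τ : ℝ) (Z : ι → ℝ) : ℝ :=
  ∑ a, ((if θ < Z a ∧ Z a < 3 / 4 then (1 : ℝ) else 0) + 4 / τ * (Z a * (1 - Z a)))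

lemma badWeight_nonneg {θ τ : ℝ} (hτ : 0 < τ) {Z : ι → ℝ} (h0 : ∀ a, 0 ≤ Z a)
    (h1 : ∀ a, Z a ≤ 1) : 0 ≤ badWeight θ τ Z := by
  refine Finset.sum_nonneg fun a _ => ?_
  have := mul_nonneg (h0 a) (sub_nonneg.2 (h1 a))
  split_ifs <;> positivity

lemma one_le_badWeight {θ τ : ℝ} (hτ : 0 < τ) {Z : ι → ℝ} (h0 : ∀ a, 0 ≤ Z a)
    (h1 : ∀ a, Z a ≤ 1) (h : ¬ ∀ a, Z a ≤ θ ∨ 1 - τ ≤ Z a) : 1 ≤ badWeight θ τ Z := by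
  push Not at h
  obtain ⟨a, ha, ha'⟩ := h
  have hnn : ∀ b, 0 ≤ (if θ < Z b ∧ Z b < 3 / 4 then (1 : ℝ) else 0) +
      4 / τ * (Z b * (1 - Z b)) := fun b => by
    have := mul_nonneg (h0 b) (sub_nonneg.2 (h1 b))
    split_ifs <;> positivity
  refine le_trans ?_ (Finset.single_le_sum (fun b _ => hnn b) (Finset.mem_univ a))
  have hp := mul_nonneg (h0 a) (sub_nonneg.2 (h1 a))
  by_cases h34 : Z a < 3 / 4
  · rw [if_pos ⟨ha, h34⟩]
    have : 0 ≤ 4 / τ * (Z a * (1 - Z a)) := by positivity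
    linarith
  -- Here Z ≥ 3/4 and 1 − Z > τ, so Z(1 − Z) exceeds τ/4.
  · rw [if_neg fun h => h34 h.2, zero_add, div_mul_eq_mul_div, one_le_div hτ]
    push Not at h34
    nlinarith

/-- If every `Z a` polarizes, then so do all of them jointly, with a common threshold `τ` that tends
to `0`. -/
lemma exists_tendsto_levelMean_badWeight {Z : ι → (l : ℕ) → Fin (2 ^ l) → ℝ}
    (hZ : ∀ a, IsPolarArray (Z a)) {b : ℝ} (hb0 : 0 < b) (hb : b < 1 / 2) :
    ∃ τ : ℕ → ℝ, (∀ l, 0 < τ l) ∧ Tendsto τ atTop (nhds 0) ∧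
      Tendsto (fun l => levelMean l fun i => badWeight (decay b l) (τ l) fun a => Z a l i)
        atTop (nhds 0) := by
  set D : ℕ → ℝ := fun l => ∑ a, levelMean l fun i => Z a l i * (1 - Z a l i) with hD
  have hD0 : ∀ l, 0 ≤ D l := fun l => Finset.sum_nonneg fun a _ => levelMean_nonneg fun i =>
    mul_nonneg ((hZ a).nonneg l i) (sub_nonneg.2 ((hZ a).le_one l i))
  have hDlim : Tendsto D atTop (nhds 0) := by
    simpa using tendsto_finsetSum Finset.univ
      fun a _ => (hZ a).tendsto_levelMean_mul_one_sub
  have hsq : Tendsto (fun l => √(D l)) atTop (nhds 0) := by simpa using hDlim.sqrt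
  have hslow : Tendsto (fun l => ∑ a, levelMean l fun i =>
      if decay b l < Z a l i ∧ Z a l i < 3 / 4 then (1 : ℝ) else 0) atTop (nhds 0) := by
    have := tendsto_finsetSum Finset.univ fun a _ => (hZ a).tendsto_levelMean_slow hb0 hb
    rwa [Finset.sum_const_zero] at this
  -- Markov's inequality with a threshold of order √D leaves a fraction of order D/√D = √D. The
  -- geometric term only makes τ positive.
  set τ : ℕ → ℝ := fun l => √(D l) + (1 / 2) ^ l with hτ
  have hτpos : ∀ l, 0 < τ l := fun l => by positivity
  have hτlim := hsq.add tendsto_half_pow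
  rw [add_zero] at hτlim
  refine ⟨τ, hτpos, hτlim, ?_⟩
  have hlim := hslow.add (hsq.const_mul 4)
  rw [mul_zero, add_zero] at hlim
  refine squeeze_zero (fun l => levelMean_nonneg fun i => badWeight_nonneg (hτpos l)
    (fun a => (hZ a).nonneg l i) fun a => (hZ a).le_one l i) (fun l => ?_) hlim
  simp only [badWeight]
  rw [levelMean_sum]
  simp only [levelMean_add, levelMean_const_mul]
  rw [Finset.sum_add_distrib, ← Finset.mul_sum]
  refine add_le_add_right ?_ _
  change 4 / τ l * D l ≤ 4 * √(D l)
  rw [div_mul_eq_mul_div, div_le_iff₀ (hτpos l), mul_assoc]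
  refine mul_le_mul_of_nonneg_left ?_ (by norm_num)
  calc D l = √(D l) * √(D l) := (Real.mul_self_sqrt (hD0 l)).symm
    _ ≤ √(D l) * τ l := by
      refine mul_le_mul_of_nonneg_left ?_ (Real.sqrt_nonneg _)
      exact le_add_of_nonneg_right (by positivity)

end Indicator

lemma PolarCode.sumRate_le {m l : ℕ} {𝓨 : Type*} [MeasurableSpace 𝓨] (c : PolarCode m l 𝓨) :
    c.sumRate ≤ m := by
  rw [c.sumRate_eq]
  refine (levelMean_mono fun i => ?_).trans (levelMean_const l (m : ℝ)).le
  rw [← c.card_activeUsers]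
  exact_mod_cast (Finset.card_le_univ _).trans (Fintype.card_fin m).le

/-- The synthetic channels that are not polarized, for thresholds that decay fast enough, have a
vanishing proportion. -/
lemma exists_thresholds {m : ℕ} {𝓨 : Type*} [MeasurableSpace 𝓨] (P : Kernel (Input m) 𝓨)
    [IsMarkovKernel P] {b : ℝ} (hb0 : 0 < b) (hb : b < 1 / 2) :
    ∃ (ε : ℕ → ℝ) (bad : (l : ℕ) → Fin (2 ^ l) → ℝ),
      (∀ l, 0 < ε l ∧ ε l < 1 / 2) ∧ Tendsto ε atTop (nhds 0) ∧
      (∀ l i, 0 ≤ bad l i) ∧ Tendsto (fun l => levelMean l (bad l)) atTop (nhds 0) ∧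
      ∀ᶠ l in atTop, ∀ i, ¬ IsPolarized (synthChannel P l i) (ε l) (decay b l) →
        1 ≤ bad l i := by
  have hlog := log_two_pos
  -- The forms polarize at the faster rate d, so that θ is eventually smaller than γ by more than
  -- the constant factor lost to the number of forms.
  obtain ⟨d, hbd, hd⟩ := exists_between hb
  have hd0 := hb0.trans hbd
  obtain ⟨τ, hτ, hτlim, hbadlim⟩ :=
    exists_tendsto_levelMean_badWeight (fun a => isPolarArray_bhatt (P := P) a) hd0 hd
  -- The smallest ε allowed by `isPolarized_of_extremal`, plus a geometric term for strictness. The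
  -- minimum with 1/4 keeps ε below 1/2 at every level and is eventually inactive.
  set e : ℕ → ℝ := fun l =>
    2 * (m * (2 * decay d l) + 2 ^ m * (2 * τ l)) / Real.log 2 + (1 / 2) ^ l with he
  have he0 : ∀ l, 0 < e l := fun l => by
    have := decay_pos d l
    have := hτ l
    positivity
  have helim : Tendsto e atTop (nhds 0) := by
    have := (((((tendsto_decay hd0).const_mul 2).const_mul (m : ℝ)).add
      ((hτlim.const_mul 2).const_mul (2 ^ m))).const_mul 2).div_const (Real.log 2)
    simpa [he] using this.add tendsto_half_pow
  refine ⟨fun l => min (1 / 4) (e l), fun l i =>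
    badWeight (decay d l) (τ l) fun a => bhatt a (synthLaw P l i), fun l =>
    ⟨lt_min (by norm_num) (he0 l), (min_le_left _ _).trans_lt (by norm_num)⟩, ?_, fun l i =>
    badWeight_nonneg (hτ l) (fun a => bhatt_nonneg a _) fun a => bhatt_le_one a _, hbadlim, ?_⟩
  · refine squeeze_zero (fun l => (lt_min (by norm_num) (he0 l)).le)
      (fun l => min_le_right _ _) helim
  · have hsmall := (tendsto_half_pow.const_mul ((m : ℝ) * 2))
    rw [mul_zero] at hsmall
    filter_upwards [helim.eventually_le_const (by norm_num : (0 : ℝ) < 1 / 4),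
      hsmall.eventually_lt_const hlog, eventually_decay_le hbd hd0] with l hl1 hl2 hl3 i hi
    refine one_le_badWeight (hτ l) (fun a => bhatt_nonneg a _) (fun a => bhatt_le_one a _)
      fun h => hi ?_
    refine isPolarized_of_extremal _ (decay_pos d l).le (hτ l).le (fun a => ?_) ?_ ?_
    · have : bhatt a (jointLaw (synthChannel P l i)) = bhatt a (synthLaw P l i) :=
        posteriorMean_congr _ (jointLaw_synthChannel P l i)
      rw [this]
      exact h a
    · rw [min_eq_right hl1, he, add_mul, div_mul_cancel₀ _ hlog.ne']
      exact lt_add_of_pos_right _ (by positivity)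
    · have hdec := decay_pos b l
      calc (m : ℝ) * (2 * decay d l) ≤ m * (2 * ((1 / 2) ^ l * decay b l)) := by gcongr
        _ = decay b l * (m * 2 * (1 / 2) ^ l) := by ring
        _ < decay b l * Real.log 2 := by gcongr

end PolarMAC

end

/-! ### Assembly. -/

theorem mainTheorem1 {m : ℕ} (hm : 1 ≤ m) {𝓨 : Type*} [MeasurableSpace 𝓨]
    (P : Kernel (PolarMAC.Input m) 𝓨) [IsMarkovKernel P] (β : ℝ) (hβ : β < 1 / 2) :
    ∃ (n₀ : ℕ) (ε γ : ℕ → ℝ) (c : (l : ℕ) → PolarMAC.PolarCode m l 𝓨),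
      (∀ l, 0 < ε l ∧ ε l < 1 / 2) ∧ Tendsto ε atTop (nhds 0) ∧
      (∀ l, 0 < γ l ∧ γ l < 1) ∧ Tendsto γ atTop (nhds 0) ∧
      (∀ l, (c l).IsPolarFor P (ε l) (γ l)) ∧
      (∀ l, n₀ ≤ 2 ^ l →
        (c l).blockErrorProb P ≤ (2 : ℝ) ^ (-(((2 : ℝ) ^ l) ^ β))) ∧
      PolarMAC.uniformSumRate P ≤ liminf (fun l => (c l).sumRate) atTop := by
  open PolarMAC in
  -- The maximum with 0 makes b positive even when β is not.
  obtain ⟨b, hβb, hb⟩ := exists_between (max_lt hβ (by norm_num : (0 : ℝ) < 1 / 2))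
  have hb0 : 0 < b := (le_max_right _ _).trans_lt hβb
  obtain ⟨ε, bad, hε, hεlim, hbad0, hbadlim, hbad⟩ := exists_thresholds P hb0 hb
  choose c hc herr using fun l => exists_polarCode P l (ε := ε l) (decay_pos b l).le
    (decay_lt_one b l).le
  obtain ⟨l₀, hl₀⟩ := eventually_atTop.1
    (eventually_two_pow_mul_decay_le ((le_max_left _ _).trans_lt hβb) hb0 1)
  refine ⟨2 ^ l₀, ε, decay b, c, hε, hεlim, fun l => ⟨decay_pos b l, decay_lt_one b l⟩,
    tendsto_decay hb0, hc, fun l hl => ?_, ?_⟩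
  · have hdec := decay_pos b l
    have hpow : ((2 : ℝ) ^ l) ^ β = 2 ^ (β * l) := by
      rw [← Real.rpow_natCast, ← Real.rpow_mul two_pos.le, mul_comm]
    rw [hpow]
    refine (herr l).trans (le_trans ?_ (hl₀ l ((Nat.pow_le_pow_iff_right one_lt_two).1 hl)))
    calc (2 : ℝ) ^ l * (2 * (decay b l * Real.log 2))
        ≤ 2 ^ l * (2 * (decay b l * 1)) := by
          gcongr
          exact Real.log_two_lt_d9.le.trans (by norm_num)
      _ = 2 ^ (l + 1) * decay b l := by ring
  · have hlim : Tendsto (fun l => uniformSumRate P - ε l - m * levelMean l (bad l)) atTop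
        (nhds (uniformSumRate P)) := by
      simpa using (tendsto_const_nhds.sub hεlim).sub (hbadlim.const_mul (m : ℝ))
    rw [← hlim.liminf_eq]
    -- The lower limit in ℝ is meaningful only for suitably bounded sequences; the rates are at most
    -- m.
    have hbdd : IsBoundedUnder (· ≤ ·) atTop fun l => (c l).sumRate :=
      isBoundedUnder_of ⟨(m : ℝ), fun l => (c l).sumRate_le⟩
    refine liminf_le_liminf ?_ hlim.isBoundedUnder_ge hbdd.isCoboundedUnder_ge
    filter_upwards [hbad] with l hl
    exact (hc l).le_sumRate (hε l).1.le (hbad0 l) hl
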